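/- Let $n\ge 2$, let $M$ be a smooth $n$-dimensional manifold (Hausdorff, $\sigma$-compact, without boundary), let $g$ be a smooth Riemannian metric on $M$ and $c=\{e^{2f}g : f\in C^\infty(M)\}$ its conformal class. Let $\gamma=(\gamma(r))_{r\in\mathbb R}$ be an admissible family: $\gamma(r)$ is a field of endomorphisms of $TM$ depending smoothly on $(r,x)\in\mathbb R\times M$, each $\gamma(r)$ is self-adjoint with respect to every metric of $c$, $\gamma(0)=\mathrm{Id}$, and $\gamma(r)$ is nonsingular at every point of $M$ when $|r|$ is less than some positive number. Let $\delta>0$ be such that $\gamma(r)$ is nonsingular at every point for all $|r|<\delta$. On $\widetilde M=\mathbb R_{>0}\times(-\delta,\delta)\times M$, with coordinates $(t,r)$ on the first two factors, let $$\widetilde g=d(rt)\otimes dt+dt\otimes d(rt)+t^2\,g(\gamma(r)\,\cdot,\cdot),$$ let $\widetilde\nabla$ be the Levi-Civita connection of $\widetilde g$ and $\widetilde{\mathrm{Ric}}$ its Ricci tensor. For $u\in C^\infty(M)$ let $\Psi^u:M\to\widetilde M$, $\Psi^u(x)=(e^{u(x)},0,x)$, and let $\xi^u=e^u\,\partial_t|_{\Psi^u}$.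 Definitions. A conformal tractor bundle on $M$ is a smooth vector bundle $\mathcal T\to M$ of rank $n+2$ with a bundle metric $\mathbf h$ of Lorentzian signature and an oriented lightlike line subbundle $\mathcal T^1$. A tractor connection on it is a linear connection $\nabla$ with $\nabla\mathbf h=0$ for which $\beta(v)(\xi)=\nabla_v\sigma+\mathcal T^1$ ($\sigma$ any section of $\mathcal T^1$ through $\xi$) is an isomorphism $\beta:TM\to\mathrm{Hom}(\mathcal T^1,(\mathcal T^1)^\perp/\mathcal T^1)$. The data are a standard conformal tractor bundle for $(M,c)$ if moreover, for every nowhere vanishing section $\sigma$ of $\mathcal T^1$, the metric $(v,w)\mapsto\mathbf h(\nabla_v\sigma,\nabla_w\sigma)$ belongs to $c$. They are the normal conformal tractor bundle of $(M,c)$ if they are a standard conformal tractor bundle whose connection satisfies the normalization conditions: its curvature $R$ satisfies $R(X,Y)\mathcal T^1\subseteq\mathcal T^1$ for all vector fields $X,Y$, and $\operatorname{trace}\big(X\mapsto W(X,Y)Z\big)=0$ for all $Y,Z$, where $W(X,Y)$ is the endomorphism of $TM$ that corresponds to the action of $R(X,Y)$ on $(\mathcal T^1)^\perp/\mathcal T^1$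 under $TM\cong(\mathcal T^1)^\perp/\mathcal T^1$, $Z\mapsto\nabla_Z\sigma+\mathcal T^1$. (For $n\ge3$ these conditions determine the connection up to isomorphism; for $n=2$ they do not.) Theorem. For every $u\in C^\infty(M)$ the pullback bundle $\Psi^{u*}(T\widetilde M)$, with the line subbundle $\mathrm{Span}(\xi^u)$ oriented by $\xi^u$, the restriction of $\widetilde g$ along $\Psi^u$ and the connection induced by $\widetilde\nabla$, is a standard conformal tractor bundle for $(M,c)$; and it is the normal conformal tractor bundle of $(M,c)$ if and only if $\widetilde{\mathrm{Ric}}(V,W)=0$ at all points of $\{r=0\}$ for all $V,W$ which are lifts to $\widetilde M$ of vector fields on $M$. (The last condition does not involve $u$.) -/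

import Mathlib

open Bundle Set Manifold ContDiff Topology

noncomputable section

namespace ExtrinsicTractor

/-! ### Linear connections on vector bundles -/

section General

variable {E : Type*} [NormedAddCommGroup E] [NormedSpace ℝ E]
  {H : Type*} [TopologicalSpace H] (I : ModelWithCorners ℝ E H)
  {M : Type*} [TopologicalSpace M] [ChartedSpace H M]
  (F : Type*) [NormedAddCommGroup F] [NormedSpace ℝ F]
  {V : M → Type*} [TopologicalSpace (TotalSpace F V)]
  [∀ x, AddCommGroup (V x)] [∀ x, Module ℝ (V x)] [∀ x, TopologicalSpace (V x)]
  [∀ x, IsTopologicalAddGroup (V x)] [∀ x, ContinuousSMul ℝ (V x)]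
  [FiberBundle F V] [VectorBundle ℝ F V]

/-- `σ` is a smooth (`C^∞`) section of the vector bundle `V` with model fibre `F`. -/
def IsSmoothSection (σ : Π x : M, V x) : Prop :=
  ContMDiff I (I.prod 𝓘(ℝ, F)) ∞ (fun x ↦ TotalSpace.mk' F x (σ x))

/-- `X` is a smooth vector field on `M`. -/
def IsSmoothField [IsManifold I ∞ M] (X : Π x : M, TangentSpace I x) : Prop :=
  IsSmoothSection I E X

/-- The vector field `X` is differentiable at the point `p`. -/
def IsDiffFieldAt [IsManifold I ∞ M] (X : Π x : M, TangentSpace I x) (p : M) : Prop :=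
  MDifferentiableAt I (I.prod 𝓘(ℝ, E)) (fun x ↦ TotalSpace.mk' E x (X x)) p

variable {F}

/-- The curvature `R(X, Y)σ = ∇_X ∇_Y σ - ∇_Y ∇_X σ - ∇_{[X, Y]} σ`, evaluated at `x`. In a
covariant derivative, `D σ x v` stands for `∇_v σ`. -/
def curvature (D : (Π x : M, V x) → (Π x : M, TangentSpace I x →L[ℝ] V x))
    (X Y : Π x : M, TangentSpace I x) (σ : Π x : M, V x) (x : M) : V x :=
  D (fun y ↦ D σ y (Y y)) x (X x) - D (fun y ↦ D σ y (X y)) x (Y x)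
    - D σ x (VectorField.mlieBracket I X Y x)

end General

/-! ### Levi-Civita connection and Ricci tensor of a pseudo-Riemannian metric -/

section LeviCivita

variable {E : Type*} [NormedAddCommGroup E] [NormedSpace ℝ E]
  {H : Type*} [TopologicalSpace H] (I : ModelWithCorners ℝ E H)
  {M : Type*} [TopologicalSpace M] [ChartedSpace H M] [IsManifold I ∞ M]

/-- The right-hand side of the Koszul formula,
`X g(Y,Z) + Y g(Z,X) - Z g(X,Y) + g([X,Y],Z) - g([X,Z],Y) - g([Y,Z],X)`. -/
def koszul (g : Π p : M, LinearMap.BilinForm ℝ (TangentSpace I p))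
    (X Y Z : Π p : M, TangentSpace I p) (p : M) : ℝ :=
  mvfderiv I (fun q ↦ g q (Y q) (Z q)) p (X p)
    + mvfderiv I (fun q ↦ g q (Z q) (X q)) p (Y p)
    - mvfderiv I (fun q ↦ g q (X q) (Y q)) p (Z p)
    + g p (VectorField.mlieBracket I X Y p) (Z p)
    - g p (VectorField.mlieBracket I X Z p) (Y p)
    - g p (VectorField.mlieBracket I Y Z p) (X p)

open Classical in
/-- The Levi-Civita connection of a pseudo-Riemannian metric `g`: for a vector field `Y` and a
point `p`, the linear endomorphism `v ↦ ∇_v Y` of the tangent space at `p` which is determined by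
the Koszul formula `2 g(∇_X Y, Z) = X g(Y,Z) + ⋯`. -/
def leviCivita (g : Π p : M, LinearMap.BilinForm ℝ (TangentSpace I p))
    (Y : Π p : M, TangentSpace I p) (p : M) : TangentSpace I p →L[ℝ] TangentSpace I p :=
  if h : ∃ A : TangentSpace I p →L[ℝ] TangentSpace I p,
      ∀ X Z : Π p : M, TangentSpace I p, IsDiffFieldAt I X p → IsDiffFieldAt I Z p →
        2 * g p (A (X p)) (Z p) = koszul I g X Y Z p
  then h.choose else 0

/-- The Ricci tensor `Ric(Y, Z) = trace (X ↦ R(X, Y) Z)` of a connection on the tangent bundle, at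
the point `p`. The trace is computed in a basis of the tangent space, whose members are extended
to smooth vector fields near `p`. -/
def ricci [FiniteDimensional ℝ E]
    (D : (Π p : M, TangentSpace I p) → (Π p : M, TangentSpace I p →L[ℝ] TangentSpace I p))
    (Y Z : Π p : M, TangentSpace I p) (p : M) : ℝ :=
  ∑ i, (Module.finBasis ℝ E).coord i
    (curvature I D (FiberBundle.extend E (x := p) (Module.finBasis ℝ E i : TangentSpace I p))
      Y Z p)

end LeviCivita

/-! ### The induced connection on a pullback bundle -/

section Pullback

instance {B B' : Type*} (E : B → Type*) [∀ b, AddCommGroup (E b)] (f : B' → B) (x : B') :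
    AddCommGroup ((f *ᵖ E) x) := inferInstanceAs (AddCommGroup (E (f x)))

instance {B B' : Type*} (E : B → Type*) [∀ b, AddCommGroup (E b)] [∀ b, TopologicalSpace (E b)]
    [∀ b, IsTopologicalAddGroup (E b)] (f : B' → B) (x : B') :
    IsTopologicalAddGroup ((f *ᵖ E) x) := inferInstanceAs (IsTopologicalAddGroup (E (f x)))

instance {B B' : Type*} (E : B → Type*) [∀ b, AddCommGroup (E b)] [∀ b, Module ℝ (E b)]
    [∀ b, TopologicalSpace (E b)]
    [∀ b, ContinuousSMul ℝ (E b)] (f : B' → B) (x : B') :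
    ContinuousSMul ℝ ((f *ᵖ E) x) := inferInstanceAs (ContinuousSMul ℝ (E (f x)))


variable {E : Type*} [NormedAddCommGroup E] [NormedSpace ℝ E]
  {H : Type*} [TopologicalSpace H] {I : ModelWithCorners ℝ E H}
  {M : Type*} [TopologicalSpace M] [ChartedSpace H M]
  {E' : Type*} [NormedAddCommGroup E'] [NormedSpace ℝ E']
  {H' : Type*} [TopologicalSpace H'] {J : ModelWithCorners ℝ E' H'}
  {N : Type*} [TopologicalSpace N] [ChartedSpace H' N]
  (F : Type*) [NormedAddCommGroup F] [NormedSpace ℝ F]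
  {V : N → Type*} [TopologicalSpace (TotalSpace F V)]
  [∀ x, AddCommGroup (V x)] [∀ x, Module ℝ (V x)] [∀ x, TopologicalSpace (V x)]
  [∀ x, IsTopologicalAddGroup (V x)] [∀ x, ContinuousSMul ℝ (V x)]
  [FiberBundle F V] [VectorBundle ℝ F V]

/-- The connection induced on the pullback bundle `f^*V` by a connection `D` on `V`. If
`e_1, …, e_k` is the local frame of `V` which is constant in the preferred trivialization at `f x`,
and `σ = ∑ σ^i (e_i ∘ f)` near `x`, its value is
`∇_v σ = ∑ dσ^i(v) e_i(f x) + ∑ σ^i(x) D_{df(v)} e_i`. The second sum is the derivative of the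
extension of `σ x` with constant coefficients. -/
def pullbackConnection (D : (Π y : N, V y) → (Π y : N, TangentSpace J y →L[ℝ] V y))
    (f : C^∞⟮I, M; J, N⟯) (σ : Π x : M, (f *ᵖ V) x) (x : M) :
    TangentSpace I x →L[ℝ] (f *ᵖ V) x :=
  let e := trivializationAt F V (f x)
  let coeff : M → F := fun y ↦ (e (TotalSpace.mk' F (f y) (σ y))).2
  let A : TangentSpace I x →L[ℝ] V (f x) :=
    (e.symmL ℝ (f x)).comp (mvfderiv I coeff x)
      + (D (FiberBundle.extend F (x := f x) (σ x)) (f x)).comp (mfderiv I J f x)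
  A

end Pullback

/-! ### Conformal tractor bundles -/

section Tractor

/-- The symmetric bilinear form `b` has Lorentzian signature `(-, +, …, +)`: there is a timelike
vector whose orthogonal complement is positive definite. -/
structure IsLorentzian {W : Type*} [AddCommGroup W] [Module ℝ W] (b : LinearMap.BilinForm ℝ W) :
    Prop where
  symm : ∀ v w, b v w = b w v
  signature : ∃ v, b v v < 0 ∧ ∀ w, b v w = 0 → w ≠ 0 → 0 < b w w

variable {E : Type*} [NormedAddCommGroup E] [NormedSpace ℝ E]
  {H : Type*} [TopologicalSpace H] (I : ModelWithCorners ℝ E H)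
  {M : Type*} [TopologicalSpace M] [ChartedSpace H M] [IsManifold I ∞ M]
  (F : Type*) [NormedAddCommGroup F] [NormedSpace ℝ F]
  {V : M → Type*} [TopologicalSpace (TotalSpace F V)]
  [∀ x, AddCommGroup (V x)] [∀ x, Module ℝ (V x)] [∀ x, TopologicalSpace (V x)]
  [∀ x, IsTopologicalAddGroup (V x)] [∀ x, ContinuousSMul ℝ (V x)]
  [FiberBundle F V] [VectorBundle ℝ F V] [ContMDiffVectorBundle ∞ F V I]

/-- The smooth vector bundle `V` over `M`, with the bundle metric `h`, the line subbundle `L` and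
the fibrewise positive half-lines `pos` of `L`, is a (Riemannian) conformal tractor bundle: `V` has
rank `dim M + 2`, the metric `h` is smooth of Lorentzian signature, and `L` is a smooth oriented
lightlike line subbundle. -/
structure IsConformalTractorBundle (h : Π x : M, LinearMap.BilinForm ℝ (V x))
    (L : Π x : M, Submodule ℝ (V x)) (pos : Π x : M, Set (V x)) : Prop where
  rank : Module.finrank ℝ F = Module.finrank ℝ E + 2
  metric_smooth : ∀ σ τ : Π x : M, V x, IsSmoothSection I F σ → IsSmoothSection I F τ →
    ContMDiff I 𝓘(ℝ, ℝ) ∞ (fun x ↦ h x (σ x) (τ x))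
  metric_lorentzian : ∀ x, IsLorentzian (h x)
  line : ∀ x₀ : M, ∃ U ∈ 𝓝 x₀, ∃ σ : Π x : M, V x,
    ContMDiffOn I (I.prod 𝓘(ℝ, F)) ∞ (fun x ↦ TotalSpace.mk' F x (σ x)) U ∧
    ∀ x ∈ U, σ x ≠ 0 ∧ L x = Submodule.span ℝ {σ x} ∧ pos x = {v | ∃ a : ℝ, 0 < a ∧ v = a • σ x}
  lightlike : ∀ x, ∀ v ∈ L x, h x v v = 0

/-- `σ` is a smooth section of the subbundle `L` of `V`. -/
def IsSectionOf (L : Π x : M, Submodule ℝ (V x)) (σ : Π x : M, V x) : Prop :=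
  IsSmoothSection I F σ ∧ ∀ x, σ x ∈ L x

/-- `D` is a tractor connection: a smooth linear connection with `∇h = 0`, such that
`β(v)(ξ) = ∇_v σ + L`, where `σ` is any section of `L` through `ξ`, is a (well defined) isomorphism
`β : TM → Hom(L, L^⊥ / L)`. -/
structure IsTractorConnection (h : Π x : M, LinearMap.BilinForm ℝ (V x))
    (L : Π x : M, Submodule ℝ (V x))
    (D : (Π x : M, V x) → (Π x : M, TangentSpace I x →L[ℝ] V x)) : Prop where
  linear : IsCovariantDerivativeOn F D univ
  smooth : ContMDiffCovariantDerivativeOn F ∞ D univ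
  metric : ∀ σ τ : Π x : M, V x, IsSmoothSection I F σ → IsSmoothSection I F τ →
    ∀ (x : M) (v : TangentSpace I x),
      mvfderiv I (fun y ↦ h y (σ y) (τ y)) x v = h x (D σ x v) (τ x) + h x (σ x) (D τ x v)
  beta : ∃ β : Π x : M, TangentSpace I x ≃ₗ[ℝ]
      (L x →ₗ[ℝ] ((h x).orthogonal (L x) ⧸ (L x).submoduleOf ((h x).orthogonal (L x)))),
    ∀ (σ : Π x : M, V x) (hσ : IsSectionOf I F L σ) (x : M) (v : TangentSpace I x),
      ∃ hv : D σ x v ∈ (h x).orthogonal (L x),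
        β x v ⟨σ x, hσ.2 x⟩ = Submodule.Quotient.mk ⟨D σ x v, hv⟩

/-- The conformal class on `M` induced by a tractor bundle with tractor connection is that of the
Riemannian metric `g`: for every nowhere vanishing section `σ` of `L`, the metric
`h^σ(v, w) = h(∇_v σ, ∇_w σ)` has the form `e^{2f} g` with `f` smooth. -/
def InducesConformalClass (h : Π x : M, LinearMap.BilinForm ℝ (V x))
    (L : Π x : M, Submodule ℝ (V x))
    (D : (Π x : M, V x) → (Π x : M, TangentSpace I x →L[ℝ] V x))
    (g : ContMDiffRiemannianMetric I ∞ E (TangentSpace I : M → Type _)) : Prop :=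
  ∀ σ : Π x : M, V x, IsSectionOf I F L σ → (∀ x, σ x ≠ 0) →
    ∃ f : M → ℝ, ContMDiff I 𝓘(ℝ, ℝ) ∞ f ∧ ∀ (x : M) (v w : TangentSpace I x),
      h x (D σ x v) (D σ x w) = Real.exp (2 * f x) * g.inner x v w

/-- `(V, L, h, D)` is a standard conformal tractor bundle for the conformal class of `g`. -/
structure IsStandardTractorBundle
    (g : ContMDiffRiemannianMetric I ∞ E (TangentSpace I : M → Type _))
    (h : Π x : M, LinearMap.BilinForm ℝ (V x))
    (L : Π x : M, Submodule ℝ (V x)) (pos : Π x : M, Set (V x))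
    (D : (Π x : M, V x) → (Π x : M, TangentSpace I x →L[ℝ] V x)) : Prop where
  bundle : IsConformalTractorBundle I F h L pos
  connection : IsTractorConnection I F h L D
  conformal : InducesConformalClass I F h L D g

/-- `(V, L, h, D)` is the normal conformal tractor bundle of the conformal class of `g`: it is a
standard conformal tractor bundle whose connection is torsion free, `R(X, Y) L ⊆ L`, and such that
the Ricci-type contraction `trace (X ↦ W(X, Y) Z)` vanishes. Here `W(X, Y)` is the endomorphism of
`TM` which corresponds to the action of `R(X, Y)` on `L^⊥ / L` under the isomorphisms
`TM ≅ L^⊥ / L`, `Z ↦ ∇_Z σ + L`, given by sections `σ` of `L`. -/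
structure IsNormalTractorBundle
    (g : ContMDiffRiemannianMetric I ∞ E (TangentSpace I : M → Type _))
    (h : Π x : M, LinearMap.BilinForm ℝ (V x))
    (L : Π x : M, Submodule ℝ (V x)) (pos : Π x : M, Set (V x))
    (D : (Π x : M, V x) → (Π x : M, TangentSpace I x →L[ℝ] V x)) : Prop where
  standard : IsStandardTractorBundle I F g h L pos D
  torsion_free : ∀ X Y : Π x : M, TangentSpace I x, IsSmoothField I X → IsSmoothField I Y →
    ∀ σ : Π x : M, V x, IsSectionOf I F L σ → ∀ x, curvature I D X Y σ x ∈ L x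
  ricci_free : ∃ W : Π x : M, TangentSpace I x →ₗ[ℝ] TangentSpace I x →ₗ[ℝ]
      TangentSpace I x →ₗ[ℝ] TangentSpace I x,
    (∀ X Y Z : Π x : M, TangentSpace I x,
      IsSmoothField I X → IsSmoothField I Y → IsSmoothField I Z →
      ∀ σ : Π x : M, V x, IsSectionOf I F L σ → ∀ x,
        curvature I D X Y (fun y ↦ D σ y (Z y)) x - D σ x (W x (X x) (Y x) (Z x)) ∈ L x) ∧
    ∀ (x : M) (v w : TangentSpace I x),
      LinearMap.trace ℝ (TangentSpace I x) (((W x).flip v).flip w) = 0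

end Tractor

/-! ### The Lorentzian ambient space of a metric and an admissible family -/

section Ambient

variable {n : ℕ} {M : Type*} [TopologicalSpace M] [ChartedSpace (EuclideanSpace ℝ (Fin n)) M]
  [IsManifold (𝓡 n) ∞ M]

/-- Smooth Riemannian metrics on `M`. -/
abbrev Metric (n : ℕ) (M : Type*) [TopologicalSpace M]
    [ChartedSpace (EuclideanSpace ℝ (Fin n)) M] [IsManifold (𝓡 n) ∞ M] :=
  ContMDiffRiemannianMetric (𝓡 n) ∞ (EuclideanSpace ℝ (Fin n))
    (TangentSpace (𝓡 n) : M → Type _)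

/-- The metric `g'` belongs to the conformal class of `g`, that is `g' = e^{2f} g` with `f`
smooth. -/
def IsConformalTo (g g' : Metric n M) : Prop :=
  ∃ f : M → ℝ, ContMDiff (𝓡 n) 𝓘(ℝ, ℝ) ∞ f ∧ ∀ (x : M) (v w : TangentSpace (𝓡 n) x),
    g'.inner x v w = Real.exp (2 * f x) * g.inner x v w

/-- `γ(r)` is nonsingular, at every point of `M`, for `|r| < δ`. -/
def IsNonsingularBelow (γ : ℝ → Π x : M, TangentSpace (𝓡 n) x →L[ℝ] TangentSpace (𝓡 n) x)
    (δ : ℝ) : Prop :=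
  ∀ r : ℝ, |r| < δ → ∀ x : M, Function.Bijective (γ r x)

/-- Admissible smooth one-parameter families of `(1,1)`-tensors for the conformal class of `g`. -/
structure IsAdmissible (g : Metric n M)
    (γ : ℝ → Π x : M, TangentSpace (𝓡 n) x →L[ℝ] TangentSpace (𝓡 n) x) : Prop where
  smooth : ContMDiff (𝓘(ℝ, ℝ).prod (𝓡 n))
    ((𝓡 n).prod 𝓘(ℝ, EuclideanSpace ℝ (Fin n) →L[ℝ] EuclideanSpace ℝ (Fin n))) ∞
    (fun q : ℝ × M ↦ TotalSpace.mk' (EuclideanSpace ℝ (Fin n) →L[ℝ] EuclideanSpace ℝ (Fin n))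
      (E := fun x : M ↦ TangentSpace (𝓡 n) x →L[ℝ] TangentSpace (𝓡 n) x) q.2 (γ q.1 q.2))
  selfAdjoint : ∀ g' : Metric n M, IsConformalTo g g' →
    ∀ (r : ℝ) (x : M) (v w : TangentSpace (𝓡 n) x),
      g'.inner x (γ r x v) w = g'.inner x v (γ r x w)
  zero : ∀ x : M, γ 0 x = ContinuousLinearMap.id ℝ (TangentSpace (𝓡 n) x)
  nonsingular : ∃ δ : ℝ, 0 < δ ∧ IsNonsingularBelow γ δ

/-- The strip `B = ℝ_{>0} × (-δ, δ)`, with coordinates `(t, r)`. -/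
def strip (δ : ℝ) : TopologicalSpace.Opens (ℝ × ℝ) :=
  ⟨{b | 0 < b.1 ∧ |b.2| < δ},
    (isOpen_lt continuous_const continuous_fst).inter
      (isOpen_lt (continuous_abs.comp continuous_snd) continuous_const)⟩

/-- The ambient manifold `B × M`. -/
abbrev Ambient (δ : ℝ) (M : Type*) := strip δ × M

/-- The model of `B × M`, with model vector space `(ℝ × ℝ) × ℝ^n`. -/
abbrev ambientModel (n : ℕ) := 𝓘(ℝ, ℝ × ℝ).prod (𝓡 n)

/-- The coordinate `t`. -/
def tCoord {δ : ℝ} (p : Ambient δ M) : ℝ := p.1.1.1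

/-- The coordinate `r`. -/
def rCoord {δ : ℝ} (p : Ambient δ M) : ℝ := p.1.1.2

/-- The coordinate vector field `∂_t`. -/
def partialT {δ : ℝ} (p : Ambient δ M) : TangentSpace (ambientModel n) p :=
  (((1, 0), 0) : (ℝ × ℝ) × EuclideanSpace ℝ (Fin n))

/-- The natural lift to `B × M` of a vector field on `M`. -/
def lift {δ : ℝ} (X : Π x : M, TangentSpace (𝓡 n) x) (p : Ambient δ M) :
    TangentSpace (ambientModel n) p :=
  mfderiv (𝓡 n) (ambientModel n) (fun y : M ↦ ((p.1, y) : Ambient δ M)) p.2 (X p.2)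

/-- The ambient metric `d(rt) ⊗ dt + dt ⊗ d(rt) + t² g(γ(r)·, ·)`. -/
def ambientMetric (g : Metric n M)
    (γ : ℝ → Π x : M, TangentSpace (𝓡 n) x →L[ℝ] TangentSpace (𝓡 n) x) (δ : ℝ)
    (p : Ambient δ M) : LinearMap.BilinForm ℝ (TangentSpace (ambientModel n) p) :=
  let dt := mvfderiv (ambientModel n) (tCoord : Ambient δ M → ℝ) p
  let drt := mvfderiv (ambientModel n) (fun q : Ambient δ M ↦ rCoord q * tCoord q) p
  let dπ := mfderiv (ambientModel n) (𝓡 n) (Prod.snd : Ambient δ M → M) p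
  LinearMap.mk₂ ℝ
    (fun v w ↦ drt v * dt w + dt v * drt w
      + tCoord p ^ 2 * g.inner p.2 (γ (rCoord p) p.2 (dπ v)) (dπ w))
    (fun v v' w ↦ by simp only [map_add, add_apply]; ring)
    (fun c v w ↦ by
      simp only [map_smul, smul_apply, smul_eq_mul]; ring)
    (fun v w w' ↦ by simp only [map_add]; ring)
    (fun c v w ↦ by simp only [map_smul, smul_eq_mul]; ring)

/-- The Levi-Civita connection of the ambient metric. -/
def ambientConnection (g : Metric n M)
    (γ : ℝ → Π x : M, TangentSpace (𝓡 n) x →L[ℝ] TangentSpace (𝓡 n) x) (δ : ℝ) :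
    (Π p : Ambient δ M, TangentSpace (ambientModel n) p) →
      Π p : Ambient δ M, TangentSpace (ambientModel n) p →L[ℝ] TangentSpace (ambientModel n) p :=
  leviCivita (ambientModel n) (ambientMetric g γ δ)

/-- The immersion `Ψ^u : x ↦ (e^{u(x)}, 0, x)`. -/
def immersion {δ : ℝ} (hδ : 0 < δ) (u : C^∞⟮𝓡 n, M; 𝓘(ℝ, ℝ), ℝ⟯) :
    C^∞⟮𝓡 n, M; ambientModel n, Ambient δ M⟯ where
  val x := (⟨(Real.exp (u x), 0), Real.exp_pos _, by simpa using hδ⟩, x)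
  property := by
    refine ContMDiff.prodMk ?_ contMDiff_id
    rw [← ContMDiff.subtypeVal_comp_iff]
    exact (Real.contDiff_exp.contMDiff.comp u.contMDiff).prodMk_space contMDiff_const

/-- The pullback bundle `Ψ^{u*}(TM̃)`. -/
abbrev PullbackTangent {δ : ℝ} (hδ : 0 < δ) (u : C^∞⟮𝓡 n, M; 𝓘(ℝ, ℝ), ℝ⟯) : M → Type :=
  (immersion hδ u) *ᵖ (TangentSpace (ambientModel n) : Ambient δ M → Type)

/-- The lightlike normal vector field `ξ^u = e^u ∂_t` along `Ψ^u`. -/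
def xi {δ : ℝ} (hδ : 0 < δ) (u : C^∞⟮𝓡 n, M; 𝓘(ℝ, ℝ), ℝ⟯) (x : M) : PullbackTangent hδ u x :=
  Real.exp (u x) • partialT (immersion hδ u x)

/-- The line subbundle `Span(ξ^u)`. -/
def xiLine {δ : ℝ} (hδ : 0 < δ) (u : C^∞⟮𝓡 n, M; 𝓘(ℝ, ℝ), ℝ⟯) (x : M) :
    Submodule ℝ (PullbackTangent hδ u x) :=
  Submodule.span ℝ {xi hδ u x}

/-- The orientation of `Span(ξ^u)` for which `ξ^u` is positive. -/
def xiPos {δ : ℝ} (hδ : 0 < δ) (u : C^∞⟮𝓡 n, M; 𝓘(ℝ, ℝ), ℝ⟯) (x : M) :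
    Set (PullbackTangent hδ u x) :=
  {v | ∃ a : ℝ, 0 < a ∧ v = a • xi hδ u x}

/-- The bundle metric on the pullback bundle: the restriction of the ambient metric along `Ψ^u`. -/
def restrictedMetric (g : Metric n M)
    (γ : ℝ → Π x : M, TangentSpace (𝓡 n) x →L[ℝ] TangentSpace (𝓡 n) x) {δ : ℝ} (hδ : 0 < δ)
    (u : C^∞⟮𝓡 n, M; 𝓘(ℝ, ℝ), ℝ⟯) (x : M) : LinearMap.BilinForm ℝ (PullbackTangent hδ u x) :=
  ambientMetric g γ δ (immersion hδ u x)

/-- The connection on the pullback bundle induced by the Levi-Civita connection of the ambient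
metric. -/
def inducedConnection (g : Metric n M)
    (γ : ℝ → Π x : M, TangentSpace (𝓡 n) x →L[ℝ] TangentSpace (𝓡 n) x) {δ : ℝ} (hδ : 0 < δ)
    (u : C^∞⟮𝓡 n, M; 𝓘(ℝ, ℝ), ℝ⟯) :
    (Π x : M, PullbackTangent hδ u x) →
      Π x : M, TangentSpace (𝓡 n) x →L[ℝ] PullbackTangent hδ u x :=
  pullbackConnection ((ℝ × ℝ) × EuclideanSpace ℝ (Fin n)) (ambientConnection g γ δ)
    (immersion hδ u)

end Ambient

end ExtrinsicTractor

end

noncomputable section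

set_option linter.unusedSectionVars false

namespace ExtrinsicTractor

open VectorField

/-! ### Vector fields, Lie brackets and functions on a manifold -/

section Fields

open VectorField

variable {E : Type*} [NormedAddCommGroup E] [NormedSpace ℝ E]
  {H : Type*} [TopologicalSpace H] {I : ModelWithCorners ℝ E H}
  {M : Type*} [TopologicalSpace M] [ChartedSpace H M] [IsManifold I ∞ M]
  {E' : Type*} [NormedAddCommGroup E'] [NormedSpace ℝ E']
  {H' : Type*} [TopologicalSpace H'] {J : ModelWithCorners ℝ E' H'}
  {N : Type*} [TopologicalSpace N] [ChartedSpace H' N] [IsManifold J ∞ N]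

/-! Everything rests on the field `T = t ∂_t` (`eulerField`). The ambient metric is homogeneous of
degree 2 under its flow, and `g̃(T, ·) = d(r t²)` is a closed form; inserted in the Koszul formula
these two facts give `∇̃T = Id` (`ambientConnection_eulerField`). Along `Ψ^u` the field `ξ^u` is `T`
itself and `dΨ^u(v) = v + du(v) T`, whence `∇_v(f T) = f v + (f du(v) + df(v)) T`
(`inducedConnection_smul_eulerField`). At `r = 0` one has `γ = Id`, so the metric is `t (dr ⊗ dt +
dt ⊗ dr) + t² g`: it is Lorentzian, `T` is lightlike, and `T^⊥ = ker dr = TM ⊕ ℝT`. Hence `β` is `v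
↦ v mod T` up to the factor `f`, and the induced metric of `f T` is `f² e^{2u} g`. This is the
standard tractor bundle.

For normality, `∇̃T = Id` and vanishing torsion give `R(X,Y)T = 0`; by skew-symmetry `R(X,Y)` takes
values in `T^⊥`, and moreover `R(T, ·) = 0` (`curvatureTensor_left_homothety`). The curvature of the
induced connection is therefore `R` evaluated on tangent vectors of `M`, the `T`-parts of `dΨ^u`
dropping out (`curvature_inducedConnection`). It kills the line `L`, so the first normalization
condition is automatic, and `W` has to be the `TM`-component of `R`. Splitting the trace at `r = 0`,
the direction `∂_t` contributes nothing since `R(T, ·) = 0`, and `∂_r` contributes nothing since `dr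
∘ R = 0`; so the Ricci tensor on lifts is the trace of the `TM`-component (`ricci_lift`).

This compares the two conditions on the image of `Ψ^u`, which is a graph in `{r = 0}`. For lifts,
`R(X,Y)Z` commutes with `T`, so its `TM`-component is constant along the flow of `T`
(`tangentialCurvature_eulerFlow`), and the flow sweeps out `{r = 0}` from any such graph. For this
reason `u` disappears from the condition.

The preliminary parts supply the calculus: brackets as commutators, existence and smoothness of the
Levi-Civita connection of a pseudo-Riemannian metric, tensoriality of its curvature, and the
connection induced on a pullback bundle. -/

theorem isManifold_top_add_one : IsManifold I (((⊤ : ℕ∞) : WithTop ℕ∞) + 1) M := by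
  have h : ((⊤ : ℕ∞) : WithTop ℕ∞) + 1 = ∞ := rfl
  rw [h]; infer_instance

theorem isManifold_minSmoothness_two : IsManifold I (minSmoothness ℝ 2) M := by
  rw [minSmoothness_of_isRCLikeNormedField]; infer_instance

theorem contMDiff_mvfderiv_apply {F : Type*} [NormedAddCommGroup F] [NormedSpace ℝ F] {φ : M → F}
    (hφ : CMDiff ∞ φ) {X : Π x : M, TangentSpace I x}
    (hX : CMDiff ∞ (T% X)) : CMDiff ∞ (fun q ↦ mvfderiv I φ q (X q)) := by
  have h : CMDiff ∞ (tangentMap I 𝓘(ℝ, F) φ) := hφ.contMDiff_tangentMap (by simp)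
  have := (contMDiff_snd_tangentBundle_modelSpace F 𝓘(ℝ, F) (n := ∞)).comp (h.comp hX)
  exact this

/-- The Koszul formula that defines `leviCivita` is tested on fields which are only differentiable
at one point, so a pointwise version is needed besides the smooth one. -/
theorem mdifferentiableAt_mvfderiv_apply {F : Type*} [NormedAddCommGroup F] [NormedSpace ℝ F]
    {φ : M → F} (hφ : CMDiff ∞ φ) {X : Π x : M, TangentSpace I x} {p : M}
    (hX : MDiffAt (T% X) p) : MDiffAt (fun q ↦ mvfderiv I φ q (X q)) p := by
  have h : CMDiff ∞ (tangentMap I 𝓘(ℝ, F) φ) := hφ.contMDiff_tangentMap (by simp)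
  have h2 := (contMDiff_snd_tangentBundle_modelSpace F 𝓘(ℝ, F) (n := ∞)).comp h
  exact MDifferentiableAt.comp (f := fun q ↦ (⟨q, X q⟩ : TangentBundle I M)) p
    (h2.mdifferentiableAt (by simp)) hX

variable [FiniteDimensional ℝ E]

theorem contMDiff_mlieBracket {X Y : Π x : M, TangentSpace I x}
    (hX : CMDiff ∞ (T% X)) (hY : CMDiff ∞ (T% Y)) : CMDiff ∞ (T% (mlieBracket I X Y)) := by
  have : CompleteSpace E := FiniteDimensional.complete ℝ E
  have : IsManifold I ((⊤ : ℕ∞) + 1) M := isManifold_top_add_one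
  have : IsManifold I (minSmoothness ℝ 2) M := isManifold_minSmoothness_two
  exact ContDiff.mlieBracket_vectorField (m := ⊤) (n := ⊤) hX hY
    (by simp [minSmoothness_of_isRCLikeNormedField])

theorem jacobi_mlieBracket {x : M} {X Y Z : Π x : M, TangentSpace I x}
    (hX : CMDiff ∞ (T% X)) (hY : CMDiff ∞ (T% Y)) (hZ : CMDiffAt ∞ (T% Z) x) :
    mlieBracket I X (mlieBracket I Y Z) x =
      mlieBracket I (mlieBracket I X Y) Z x + mlieBracket I Y (mlieBracket I X Z) x := by
  have : CompleteSpace E := FiniteDimensional.complete ℝ E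
  have h3 : minSmoothness ℝ 3 = 3 := minSmoothness_of_isRCLikeNormedField
  have : IsManifold I (minSmoothness ℝ 3) M := by rw [h3]; infer_instance
  have h2 : minSmoothness ℝ 2 ≤ ∞ := by
    rw [minSmoothness_of_isRCLikeNormedField]; exact WithTop.coe_le_coe.2 le_top
  exact leibniz_identity_mlieBracket_apply ((hX x).of_le h2) ((hY x).of_le h2) (hZ.of_le h2)

/-- The Lie bracket acts on functions as the commutator of derivations. -/
theorem mvfderiv_mlieBracket {X Y : Π x : M, TangentSpace I x}
    (hX : CMDiff ∞ (T% X)) (hY : CMDiff ∞ (T% Y)) {φ : M → ℝ} (hφ : CMDiff ∞ φ) (x : M) :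
    mvfderiv I φ x (mlieBracket I X Y x) =
      mvfderiv I (fun q ↦ mvfderiv I φ q (Y q)) x (X x)
        - mvfderiv I (fun q ↦ mvfderiv I φ q (X q)) x (Y x) := by
  have : CompleteSpace E := FiniteDimensional.complete ℝ E
  -- The argument compares coefficients of a nonzero tangent vector, which does not exist in
  -- dimension 0.
  rcases subsingleton_or_nontrivial E with hE | hE
  · have h0 (v : TangentSpace I x) : v = 0 := Subsingleton.elim (α := E) _ _
    rw [h0 (mlieBracket I X Y x), h0 (X x), h0 (Y x)]
    simp
  obtain ⟨v, hv⟩ := exists_ne (0 : E)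
  let v' : TangentSpace I x := v
  let Z : Π x : M, TangentSpace I x := FiberBundle.extend E v'
  obtain ⟨s, hs, hZs⟩ := FiberBundle.exists_contMDiffOn_extend (k := ∞) I E v'
  have hZ (y) (hy : y ∈ interior s) : CMDiffAt ∞ (T% Z) y :=
    hZs.contMDiffAt (mem_interior_iff_mem_nhds.1 hy)
  have hs' : interior s ∈ 𝓝 x := interior_mem_nhds.2 hs
  have hxs : x ∈ interior s := mem_interior_iff_mem_nhds.2 hs
  have hZx : Z x = v' := by simp [Z]
  have : IsManifold I ((⊤ : ℕ∞) + 1) M := isManifold_top_add_one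
  have : IsManifold I (minSmoothness ℝ 2) M := isManifold_minSmoothness_two
  have hbr {W : Π x : M, TangentSpace I x} (hW : CMDiff ∞ (T% W)) (y) (hy : y ∈ interior s) :
      CMDiffAt ∞ (T% (mlieBracket I W Z)) y :=
    ContMDiffAt.mlieBracket_vectorField (m := ⊤) (n := ⊤) (hW y) (hZ y hy)
      (by simp [minSmoothness_of_isRCLikeNormedField])
  have n1 : (∞ : WithTop ℕ∞) ≠ 0 := by simp
  -- Jacobi's identity is applied to `φ Z` and to `Z`, where `Z x = v' ≠ 0`. In the expansion of
  -- `[A, [B, φ Z]]` the mixed first order terms are symmetric in `A` and `B`; after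
  -- antisymmetrization only the coefficient of `v'` survives, and its vanishing is the claim.
  have key {A B : Π x : M, TangentSpace I x} (hA : CMDiff ∞ (T% A)) (hB : CMDiff ∞ (T% B)) :
      mlieBracket I A (mlieBracket I B (φ • Z)) x =
        mvfderiv I (fun q ↦ mvfderiv I φ q (B q)) x (A x) • v'
        + mvfderiv I φ x (B x) • mlieBracket I A Z x
        + mvfderiv I φ x (A x) • mlieBracket I B Z x
        + φ x • mlieBracket I A (mlieBracket I B Z) x := by
    have hc : mlieBracket I A (mlieBracket I B (φ • Z)) x =
        mlieBracket I A ((fun q ↦ mvfderiv I φ q (B q)) • Z + φ • mlieBracket I B Z) x := by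
      apply Filter.EventuallyEq.mlieBracket_vectorField_eq Filter.EventuallyEq.rfl
      filter_upwards [hs'] with y hy
      exact mlieBracket_smul_right (hφ.mdifferentiableAt n1) ((hZ y hy).mdifferentiableAt n1)
    have hBφ : MDiffAt (fun q ↦ mvfderiv I φ q (B q)) x :=
      (contMDiff_mvfderiv_apply hφ hB).mdifferentiableAt n1
    have hZ' := (hZ x hxs).mdifferentiableAt n1
    have hBZ := (hbr hB x hxs).mdifferentiableAt n1
    rw [hc, mlieBracket_add_right (hBφ.smul_section hZ')
      ((hφ.mdifferentiableAt n1).smul_section hBZ), mlieBracket_smul_right hBφ hZ',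
      mlieBracket_smul_right (hφ.mdifferentiableAt n1) hBZ, hZx]
    abel
  have hφZ : CMDiffAt ∞ (T% (φ • Z)) x := (hφ x).smul_section (hZ x hxs)
  have j1 := jacobi_mlieBracket hX hY hφZ
  have j2 := jacobi_mlieBracket hX hY (hZ x hxs)
  rw [key hX hY, key hY hX, mlieBracket_smul_right (hφ.mdifferentiableAt n1)
    ((hZ x hxs).mdifferentiableAt n1), j2, hZx] at j1
  have j3 : (mvfderiv I φ x (mlieBracket I X Y x)
      - (mvfderiv I (fun q ↦ mvfderiv I φ q (Y q)) x (X x)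
        - mvfderiv I (fun q ↦ mvfderiv I φ q (X q)) x (Y x))) • v' = 0 := by
    rw [← sub_eq_zero] at j1
    rw [← neg_eq_zero, ← j1]
    module
  have hv' : v' ≠ 0 := hv
  exact sub_eq_zero.1 ((smul_eq_zero.1 j3).resolve_right hv')

/-- The local extension of a tangent vector agrees near its base point with a smooth vector
field. -/
theorem exists_contMDiff_eventuallyEq_extend [T2Space M] (x : M) (v : TangentSpace I x) :
    ∃ X : Π y : M, TangentSpace I y, CMDiff ∞ (T% X) ∧
      ∀ᶠ y in 𝓝 x, X y = FiberBundle.extend E v y := by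
  obtain ⟨s, hs, hXs⟩ := FiberBundle.exists_contMDiffOn_extend (k := ∞) I E v
  obtain ⟨f, hf⟩ := (SmoothBumpFunction.nhds_basis_tsupport (I := I) x).mem_iff.1
    (interior_mem_nhds.2 hs)
  refine ⟨(f : M → ℝ) • FiberBundle.extend E v, ?_, ?_⟩
  · exact f.contMDiff.contMDiffOn.smul_section_of_tsupport isOpen_interior hf.2
      (hXs.mono interior_subset)
  · filter_upwards [f.eventuallyEq_one] with y hy
    simp [hy]

/-- Every tangent vector extends to a smooth vector field. -/
theorem exists_contMDiff_field [T2Space M] (x : M) (v : TangentSpace I x) :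
    ∃ X : Π y : M, TangentSpace I y, CMDiff ∞ (T% X) ∧ X x = v := by
  obtain ⟨X, hX, hXv⟩ := exists_contMDiff_eventuallyEq_extend x v
  exact ⟨X, hX, by simpa using hXv.self_of_nhds⟩

/-- A section of `Hom(TM, V)` is smooth if its values on smooth vector fields are smooth. -/
theorem contMDiff_hom_of_apply [T2Space M] {F : Type*} [NormedAddCommGroup F] [NormedSpace ℝ F]
    {V : M → Type*} [TopologicalSpace (TotalSpace F V)]
    [∀ x, AddCommGroup (V x)] [∀ x, Module ℝ (V x)] [∀ x, TopologicalSpace (V x)]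
    [∀ x, IsTopologicalAddGroup (V x)] [∀ x, ContinuousSMul ℝ (V x)]
    [FiberBundle F V] [VectorBundle ℝ F V] [ContMDiffVectorBundle ∞ F V I]
    (A : Π x : M, TangentSpace I x →L[ℝ] V x)
    (h : ∀ X : Π x : M, TangentSpace I x, CMDiff ∞ (T% X) →
      ContMDiff I (I.prod 𝓘(ℝ, F)) ∞ (fun x ↦ TotalSpace.mk' F x (A x (X x)))) :
    ContMDiff I (I.prod 𝓘(ℝ, E →L[ℝ] F)) ∞
      (fun x ↦ TotalSpace.mk' (E →L[ℝ] F) (E := fun x ↦ TangentSpace I x →L[ℝ] V x) x (A x)) := by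
  intro x₀
  rw [contMDiffAt_hom_bundle]
  refine ⟨contMDiffAt_id, ?_⟩
  let b := Module.finBasis ℝ E
  let G : M → (E →L[ℝ] F) := fun x ↦
    ContinuousLinearMap.inCoordinates E (TangentSpace I : M → Type _) F V x₀ x x₀ x (A x)
  change ContMDiffAt I 𝓘(ℝ, E →L[ℝ] F) ∞ G x₀
  -- A linear map is a smooth function of its values on a basis, so only the columns `G x (b i)`
  -- have to be smooth.
  have hG : G = fun x ↦ ∑ i, ContinuousLinearMap.smulRightL ℝ E F
      (LinearMap.toContinuousLinearMap (b.coord i)) (G x (b i)) := by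
    ext x v
    conv_lhs => rw [← b.sum_repr v, map_sum]
    simp
  have hGi (i) : ContMDiffAt I 𝓘(ℝ, F) ∞ (fun x ↦ G x (b i)) x₀ := by
    let e := trivializationAt E (TangentSpace I : M → Type _) x₀
    let v : TangentSpace I x₀ := e.symmL ℝ x₀ (b i)
    -- Near `x₀` the field `X` has constant coordinates `b i`, so the coordinates of `A X` are the
    -- `i`-th column.
    obtain ⟨X, hX, hXv⟩ := exists_contMDiff_eventuallyEq_extend x₀ v
    have h1 := ((contMDiffAt_section x₀).1 (h X hX x₀))
    refine h1.congr_of_eventuallyEq ?_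
    have hb := e.open_baseSet.mem_nhds (FiberBundle.mem_baseSet_trivializationAt' x₀)
    have hb' := (trivializationAt F V x₀).open_baseSet.mem_nhds
      (FiberBundle.mem_baseSet_trivializationAt' x₀)
    filter_upwards [hXv, hb, hb'] with x hx hxb hxb'
    have hx0 : x₀ ∈ e.baseSet := FiberBundle.mem_baseSet_trivializationAt' x₀
    have hxX : X x = e.symmL ℝ x (b i) := by
      rw [hx]
      have hv : (e ⟨x₀, v⟩).2 = b i := by
        simp only [v, e.symmL_apply (R := ℝ) hx0]
        rw [e.apply_mk_symm hx0]
      change e.symm x (e ⟨x₀, v⟩).2 = _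
      rw [hv, e.symmL_apply (R := ℝ) hxb]
    rw [hxX]
    simp only [G, ContinuousLinearMap.inCoordinates, ContinuousLinearMap.comp_apply]
    simp [hxb', e, Bundle.Trivialization.continuousLinearMapAt_apply,
      Bundle.Trivialization.coe_linearMapAt_of_mem]
  rw [hG]
  exact ContMDiffAt.sum fun i _ ↦
    (ContinuousLinearMap.contMDiff _).contMDiffAt.comp x₀ (hGi i)

/-- Smooth functions separate tangent vectors. -/
theorem tangent_ext [T2Space M] {x : M} {v w : TangentSpace I x}
    (h : ∀ φ : M → ℝ, CMDiff ∞ φ → mvfderiv I φ x v = mvfderiv I φ x w) : v = w := by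
  obtain ⟨f⟩ : Nonempty (SmoothBumpFunction I x) := inferInstance
  -- The chart, cut off to a globally smooth map. Its differential at `x` is invertible, and linear
  -- functionals on `E` turn it into real test functions.
  let ψ : M → E := fun y ↦ f y • extChartAt I x y
  have hψ : CMDiff ∞ ψ := f.contMDiff_smul contMDiffOn_extChartAt
  have hev : ψ =ᶠ[𝓝 x] extChartAt I x := by
    filter_upwards [f.eventuallyEq_one] with y hy
    simp [ψ, hy]
  have hinv := isInvertible_mfderiv_extChartAt (I := I) (mem_extChartAt_source (I := I) x)
  have hd : mfderiv I 𝓘(ℝ, E) ψ x v = mfderiv I 𝓘(ℝ, E) ψ x w := by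
    refine (SeparatingDual.eq_iff_forall_dual_eq (R := ℝ) (V := E)).2 fun ℓ ↦ ?_
    have hℓ (u : TangentSpace I x) :
        mvfderiv I (fun y ↦ ℓ (ψ y)) x u = ℓ (mfderiv I 𝓘(ℝ, E) ψ x u) := by
      have := mfderiv_comp (I := I) (I' := 𝓘(ℝ, E)) (I'' := 𝓘(ℝ, ℝ)) (g := ℓ) (f := ψ) x
        ℓ.mdifferentiableAt (hψ.mdifferentiableAt (by simp))
      have h2 := congr($this u)
      rw [ContinuousLinearMap.mfderiv_eq] at h2
      exact h2
    rw [← hℓ, ← hℓ]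
    exact h _ (ℓ.contMDiff.comp hψ)
  rw [hev.mfderiv_eq] at hd
  exact hinv.injective hd

/-- Brackets of related vector fields are related. -/
theorem mfderiv_mlieBracket_of_related [FiniteDimensional ℝ E'] [T2Space N] {f : M → N}
    (hf : CMDiff ∞ f)
    {X Y : Π x : M, TangentSpace I x} (hX : CMDiff ∞ (T% X)) (hY : CMDiff ∞ (T% Y))
    {X' Y' : Π x : N, TangentSpace J x} (hX' : CMDiff ∞ (T% X')) (hY' : CMDiff ∞ (T% Y'))
    (hXX' : ∀ x, mfderiv I J f x (X x) = X' (f x))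
    (hYY' : ∀ x, mfderiv I J f x (Y x) = Y' (f x)) (x : M) :
    mfderiv I J f x (mlieBracket I X Y x) = mlieBracket J X' Y' (f x) := by
  -- Relatedness means `X(φ ∘ f) = (X'φ) ∘ f`; tested on `φ`, both brackets become the same
  -- commutator.
  refine tangent_ext fun φ hφ ↦ ?_
  have n0 : (∞ : WithTop ℕ∞) ≠ 0 := by simp
  have hfd (y) : MDiffAt f y := hf.mdifferentiableAt n0
  have hc {φ : N → ℝ} (hφ : CMDiff ∞ φ) (y : M) (v : TangentSpace I y) :
      mvfderiv J φ (f y) (mfderiv I J f y v) = mvfderiv I (φ ∘ f) y v := by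
    rw [mvfderiv_comp_apply _ (hφ.mdifferentiableAt n0) (hfd y)]
  have e1 : (fun q ↦ mvfderiv I (φ ∘ f) q (Y q)) = (fun q ↦ mvfderiv J φ q (Y' q)) ∘ f := by
    ext q; simp only [Function.comp, ← hYY', hc hφ q]
  have e2 : (fun q ↦ mvfderiv I (φ ∘ f) q (X q)) = (fun q ↦ mvfderiv J φ q (X' q)) ∘ f := by
    ext q; simp only [Function.comp, ← hXX', hc hφ q]
  rw [hc hφ, mvfderiv_mlieBracket hX hY (hφ.comp hf), mvfderiv_mlieBracket hX' hY' hφ, e1, e2,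
    ← hc (contMDiff_mvfderiv_apply hφ hY'), ← hc (contMDiff_mvfderiv_apply hφ hX'), hXX', hYY']

end Fields

/-! ### The Levi-Civita connection of a pseudo-Riemannian metric -/

section LeviCivitaProperties

open VectorField

variable {E : Type*} [NormedAddCommGroup E] [NormedSpace ℝ E]
  {H : Type*} [TopologicalSpace H] {I : ModelWithCorners ℝ E H}
  {M : Type*} [TopologicalSpace M] [ChartedSpace H M] [IsManifold I ∞ M]

/-- A smooth pseudo-Riemannian metric. -/
structure IsPseudoMetric (g : Π p : M, LinearMap.BilinForm ℝ (TangentSpace I p)) : Prop where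
  symm : ∀ p v w, g p v w = g p w v
  nondegenerate : ∀ p v, (∀ w, g p v w = 0) → v = 0
  smooth : ∀ X Y : Π p : M, TangentSpace I p, CMDiff ∞ (T% X) → CMDiff ∞ (T% Y) →
    CMDiff ∞ (fun q ↦ g q (X q) (Y q))
  mdifferentiableAt : ∀ (X Y : Π p : M, TangentSpace I p) (p : M), MDiffAt (T% X) p →
    MDiffAt (T% Y) p → MDiffAt (fun q ↦ g q (X q) (Y q)) p

variable {g : Π p : M, LinearMap.BilinForm ℝ (TangentSpace I p)} {X Y Z : Π p : M, TangentSpace I p}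
  {p : M}

namespace IsPseudoMetric

theorem ext_of_fields (hg : IsPseudoMetric g) {v w : TangentSpace I p}
    (h : ∀ Z : Π p : M, TangentSpace I p, MDiffAt (T% Z) p → g p v (Z p) = g p w (Z p)) :
    v = w := by
  refine sub_eq_zero.1 (hg.nondegenerate p _ fun z ↦ ?_)
  have := h (FiberBundle.extend E z) (FiberBundle.mdifferentiableAt_extend I E z)
  rw [FiberBundle.extend_apply_self] at this
  rw [map_sub, LinearMap.sub_apply, this, sub_self]

variable [FiniteDimensional ℝ E]

theorem koszul_add_left (hg : IsPseudoMetric g) {X' : Π p : M, TangentSpace I p}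
    (hX : MDiffAt (T% X) p) (hX' : MDiffAt (T% X') p)
    (hY : MDiffAt (T% Y) p) (hZ : MDiffAt (T% Z) p) :
    koszul I g (X + X') Y Z p = koszul I g X Y Z p + koszul I g X' Y Z p := by
  have : CompleteSpace E := FiniteDimensional.complete ℝ E
  simp only [koszul, mlieBracket_add_left hX hX', Pi.add_apply, map_add, LinearMap.add_apply]
  rw [mvfderiv_fun_add (hg.mdifferentiableAt _ _ _ hZ hX) (hg.mdifferentiableAt _ _ _ hZ hX'),
    mvfderiv_fun_add (hg.mdifferentiableAt _ _ _ hX hY) (hg.mdifferentiableAt _ _ _ hX' hY)]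
  simp only [add_apply]
  ring

/-- The derivatives of `f` produced by the metric terms cancel those produced by the brackets
`[fX,Y]` and `[fX,Z]`. With the additivity lemmas this makes the Koszul expression tensorial in its
first argument, and likewise in its last. -/
theorem koszul_smul_left (hg : IsPseudoMetric g) {f : M → ℝ} (hf : MDiffAt f p)
    (hX : MDiffAt (T% X) p) (hY : MDiffAt (T% Y) p) (hZ : MDiffAt (T% Z) p) :
    koszul I g (f • X) Y Z p = f p * koszul I g X Y Z p := by
  have : CompleteSpace E := FiniteDimensional.complete ℝ E
  simp only [koszul, mlieBracket_smul_left hf hX, Pi.smul_apply', map_add, map_smul,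
    LinearMap.add_apply, LinearMap.smul_apply, smul_eq_mul]
  rw [mvfderiv_fun_mul hf (hg.mdifferentiableAt _ _ _ hZ hX),
    mvfderiv_fun_mul hf (hg.mdifferentiableAt _ _ _ hX hY)]
  simp only [add_apply, smul_apply, smul_eq_mul, hg.symm p (Z p)]
  ring

theorem koszul_add_middle (hg : IsPseudoMetric g) {Y' : Π p : M, TangentSpace I p}
    (hX : MDiffAt (T% X) p) (hY : MDiffAt (T% Y) p) (hY' : MDiffAt (T% Y') p)
    (hZ : MDiffAt (T% Z) p) :
    koszul I g X (Y + Y') Z p = koszul I g X Y Z p + koszul I g X Y' Z p := by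
  have : CompleteSpace E := FiniteDimensional.complete ℝ E
  simp only [koszul, mlieBracket_add_left hY hY', mlieBracket_add_right hY hY', Pi.add_apply,
    map_add, LinearMap.add_apply]
  rw [mvfderiv_fun_add (hg.mdifferentiableAt _ _ _ hY hZ) (hg.mdifferentiableAt _ _ _ hY' hZ),
    mvfderiv_fun_add (hg.mdifferentiableAt _ _ _ hX hY) (hg.mdifferentiableAt _ _ _ hX hY')]
  simp only [add_apply]
  ring

/-- In the middle argument `X(f g(Y,Z))` and `g([X,fY],Z)` each leave `(Xf) g(Y,Z)`, while the `Zf`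
terms cancel. This is twice the Leibniz rule of the connection. -/
theorem koszul_smul_middle (hg : IsPseudoMetric g) {f : M → ℝ} (hf : MDiffAt f p)
    (hX : MDiffAt (T% X) p) (hY : MDiffAt (T% Y) p) (hZ : MDiffAt (T% Z) p) :
    koszul I g X (f • Y) Z p =
      f p * koszul I g X Y Z p + 2 * mvfderiv I f p (X p) * g p (Y p) (Z p) := by
  have : CompleteSpace E := FiniteDimensional.complete ℝ E
  simp only [koszul, mlieBracket_smul_left hf hY, mlieBracket_smul_right hf hY, Pi.smul_apply',
    map_add, map_smul, LinearMap.add_apply, LinearMap.smul_apply, smul_eq_mul]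
  rw [mvfderiv_fun_mul hf (hg.mdifferentiableAt _ _ _ hY hZ),
    mvfderiv_fun_mul hf (hg.mdifferentiableAt _ _ _ hX hY)]
  simp only [add_apply, smul_apply, smul_eq_mul, hg.symm p (Y p) (X p)]
  ring

theorem koszul_add_right (hg : IsPseudoMetric g) {Z' : Π p : M, TangentSpace I p}
    (hX : MDiffAt (T% X) p) (hY : MDiffAt (T% Y) p)
    (hZ : MDiffAt (T% Z) p) (hZ' : MDiffAt (T% Z') p) :
    koszul I g X Y (Z + Z') p = koszul I g X Y Z p + koszul I g X Y Z' p := by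
  have : CompleteSpace E := FiniteDimensional.complete ℝ E
  simp only [koszul, mlieBracket_add_right hZ hZ', Pi.add_apply, map_add, LinearMap.add_apply]
  rw [mvfderiv_fun_add (hg.mdifferentiableAt _ _ _ hY hZ) (hg.mdifferentiableAt _ _ _ hY hZ'),
    mvfderiv_fun_add (hg.mdifferentiableAt _ _ _ hZ hX) (hg.mdifferentiableAt _ _ _ hZ' hX)]
  simp only [add_apply]
  ring

theorem koszul_smul_right (hg : IsPseudoMetric g) {f : M → ℝ} (hf : MDiffAt f p)
    (hX : MDiffAt (T% X) p) (hY : MDiffAt (T% Y) p) (hZ : MDiffAt (T% Z) p) :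
    koszul I g X Y (f • Z) p = f p * koszul I g X Y Z p := by
  have : CompleteSpace E := FiniteDimensional.complete ℝ E
  simp only [koszul, mlieBracket_smul_right hf hZ, Pi.smul_apply', map_add, map_smul,
    LinearMap.add_apply, LinearMap.smul_apply, smul_eq_mul]
  rw [mvfderiv_fun_mul hf (hg.mdifferentiableAt _ _ _ hY hZ),
    mvfderiv_fun_mul hf (hg.mdifferentiableAt _ _ _ hZ hX)]
  simp only [add_apply, smul_apply, smul_eq_mul, hg.symm p (Z p) (Y p)]
  ring

/-- By tensoriality the Koszul expression is a bilinear form in the values of `X` and `Z` at `p`,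
and a nondegenerate metric on a finite-dimensional space represents it. So the definition of
`leviCivita` never falls back on its default value `0` at a differentiable field. -/
theorem exists_koszul (hg : IsPseudoMetric g) (hY : MDiffAt (T% Y) p) :
    ∃ A : TangentSpace I p →L[ℝ] TangentSpace I p,
      ∀ X Z : Π p : M, TangentSpace I p, IsDiffFieldAt I X p → IsDiffFieldAt I Z p →
        2 * g p (A (X p)) (Z p) = koszul I g X Y Z p := by
  have t₁ (Z : Π p : M, TangentSpace I p) (hZ : MDiffAt (T% Z) p) :
      TensorialAt I E (fun X ↦ koszul I g X Y Z p) p :=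
    ⟨fun hf hX ↦ hg.koszul_smul_left hf hX hY hZ, fun hX hX' ↦ hg.koszul_add_left hX hX' hY hZ⟩
  have t₂ (X : Π p : M, TangentSpace I p) (hX : MDiffAt (T% X) p) :
      TensorialAt I E (fun Z ↦ koszul I g X Y Z p) p :=
    ⟨fun hf hZ ↦ hg.koszul_smul_right hf hX hY hZ, fun hZ hZ' ↦ hg.koszul_add_right hX hY hZ hZ'⟩
  let K := TensorialAt.mkHom₂ (I := I) (F := E) (F' := E) (fun X Z ↦ koszul I g X Y Z p) p t₁ t₂
  have : FiniteDimensional ℝ (TangentSpace I p) := inferInstanceAs (FiniteDimensional ℝ E)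
  have : T2Space (TangentSpace I p) := inferInstanceAs (T2Space E)
  have hnd : (g p).Nondegenerate := by
    refine ⟨fun v hv ↦ hg.nondegenerate p v hv, fun v hv ↦ hg.nondegenerate p v fun w ↦ ?_⟩
    rw [hg.symm]; exact hv w
  let d := (g p).toDual hnd
  let A : TangentSpace I p →ₗ[ℝ] TangentSpace I p :=
    { toFun v := d.symm ((1 / 2 : ℝ) • (K v).toLinearMap)
      map_add' v w := by rw [← map_add, ← smul_add]; simp
      map_smul' c v := by rw [← map_smul, smul_comm]; simp }
  refine ⟨LinearMap.toContinuousLinearMap A, fun X Z hX hZ ↦ ?_⟩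
  have h1 : g p (A (X p)) (Z p) = (1 / 2 : ℝ) * K (X p) (Z p) := by
    have := LinearMap.BilinForm.apply_toDual_symm_apply (hB := hnd)
      ((1 / 2 : ℝ) • (K (X p)).toLinearMap) (Z p)
    exact this
  have h2 : K (X p) (Z p) = koszul I g X Y Z p := TensorialAt.mkHom₂_apply t₁ t₂ hX hZ
  change 2 * g p (A (X p)) (Z p) = _
  rw [h1, h2]; ring

theorem two_mul_leviCivita (hg : IsPseudoMetric g) (hX : MDiffAt (T% X) p)
    (hY : MDiffAt (T% Y) p) (hZ : MDiffAt (T% Z) p) :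
    2 * g p (leviCivita I g Y p (X p)) (Z p) = koszul I g X Y Z p := by
  have h := hg.exists_koszul hY
  rw [leviCivita, dif_pos h]
  exact h.choose_spec X Z hX hZ

theorem isCovariantDerivativeOn (hg : IsPseudoMetric g) :
    IsCovariantDerivativeOn E (leviCivita I g) univ where
  add {Y Y' p} hY hY' _ := by
    ext v
    refine hg.ext_of_fields fun Z hZ ↦ ?_
    have hv := FiberBundle.mdifferentiableAt_extend I E v
    have h0 := hg.two_mul_leviCivita hv (mdifferentiableAt_add_section hY hY') hZ
    have h1 := hg.two_mul_leviCivita hv hY hZ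
    have h2 := hg.two_mul_leviCivita hv hY' hZ
    rw [hg.koszul_add_middle hv hY hY' hZ, ← h1, ← h2, FiberBundle.extend_apply_self] at h0
    simp only [add_apply, map_add, LinearMap.add_apply]
    linarith
  leibniz {Y f p} hY hf _ := by
    ext v
    refine hg.ext_of_fields fun Z hZ ↦ ?_
    have hv := FiberBundle.mdifferentiableAt_extend I E v
    have h0 := hg.two_mul_leviCivita hv (hf.smul_section hY) hZ
    have h1 := hg.two_mul_leviCivita hv hY hZ
    rw [hg.koszul_smul_middle hf hv hY hZ, ← h1, FiberBundle.extend_apply_self] at h0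
    simp only [add_apply, map_add, LinearMap.add_apply, smul_apply, map_smul, smul_eq_mul,
      LinearMap.smul_apply, ContinuousLinearMap.smulRight_apply]
    linarith

/-- Antisymmetrizing the Koszul expression in `X` and `Y` leaves only `2 g([X,Y],Z)`. -/
theorem torsion_free (hg : IsPseudoMetric g) (hX : MDiffAt (T% X) p) (hY : MDiffAt (T% Y) p) :
    leviCivita I g Y p (X p) - leviCivita I g X p (Y p) = mlieBracket I X Y p := by
  refine hg.ext_of_fields fun Z hZ ↦ ?_
  have h1 := hg.two_mul_leviCivita hX hY hZ
  have h2 := hg.two_mul_leviCivita hY hX hZ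
  rw [map_sub, LinearMap.sub_apply]
  have hs (A B : Π p : M, TangentSpace I p) :
      (fun q ↦ g q (A q) (B q)) = fun q ↦ g q (B q) (A q) := by
    ext q; exact hg.symm q _ _
  simp only [koszul, mlieBracket_swap_apply (V := Y) (W := X), hs Y X, hs X Z, hs Y Z,
    map_neg, LinearMap.neg_apply] at h1 h2
  linarith

/-- Symmetrizing the Koszul expression in `Y` and `Z` leaves only `2 X g(Y,Z)`. -/
theorem mvfderiv_metric (hg : IsPseudoMetric g) (hY : MDiffAt (T% Y) p) (hZ : MDiffAt (T% Z) p)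
    (v : TangentSpace I p) :
    mvfderiv I (fun q ↦ g q (Y q) (Z q)) p v =
      g p (leviCivita I g Y p v) (Z p) + g p (Y p) (leviCivita I g Z p v) := by
  have hv := FiberBundle.mdifferentiableAt_extend I E v
  have h1 := hg.two_mul_leviCivita hv hY hZ
  have h2 := hg.two_mul_leviCivita hv hZ hY
  have hs (A B : Π p : M, TangentSpace I p) :
      (fun q ↦ g q (A q) (B q)) = fun q ↦ g q (B q) (A q) := by
    ext q; exact hg.symm q _ _
  rw [hg.symm p (Y p)]
  simp only [koszul, mlieBracket_swap_apply (V := Z) (W := Y), hs _ Y, hs Z,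
    map_neg, LinearMap.neg_apply, FiberBundle.extend_apply_self] at h1 h2
  linarith

theorem contMDiff_koszul (hg : IsPseudoMetric g) (hX : CMDiff ∞ (T% X)) (hY : CMDiff ∞ (T% Y))
    (hZ : CMDiff ∞ (T% Z)) : CMDiff ∞ (koszul I g X Y Z) := by
  have h1 := contMDiff_mvfderiv_apply (hg.smooth _ _ hY hZ) hX
  have h2 := contMDiff_mvfderiv_apply (hg.smooth _ _ hZ hX) hY
  have h3 := contMDiff_mvfderiv_apply (hg.smooth _ _ hX hY) hZ
  have h4 := hg.smooth _ _ (contMDiff_mlieBracket hX hY) hZ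
  have h5 := hg.smooth _ _ (contMDiff_mlieBracket hX hZ) hY
  have h6 := hg.smooth _ _ (contMDiff_mlieBracket hY hZ) hX
  exact ((((h1.add h2).sub h3).add h4).sub h5).sub h6

variable [T2Space M]

/-- A vector field is smooth if its inner products with smooth vector fields are smooth. -/
theorem contMDiff_of_inner (hg : IsPseudoMetric g) {W : Π p : M, TangentSpace I p}
    (h : ∀ Z : Π p : M, TangentSpace I p, CMDiff ∞ (T% Z) →
      CMDiff ∞ (fun q ↦ g q (W q) (Z q))) : CMDiff ∞ (T% W) := by
  have : CompleteSpace E := FiniteDimensional.complete ℝ E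
  intro p
  rw [contMDiffAt_section]
  let b := Module.finBasis ℝ E
  let e := trivializationAt E (TangentSpace I : M → Type _) p
  have hp : p ∈ e.baseSet := FiberBundle.mem_baseSet_trivializationAt' p
  choose Z hZ hZe using fun i ↦
    exists_contMDiff_eventuallyEq_extend (I := I) p (e.symmL ℝ p (b i) : TangentSpace I p)
  have hZb : ∀ᶠ q in 𝓝 p, q ∈ e.baseSet ∧ ∀ i, Z i q = e.symmL ℝ q (b i) := by
    filter_upwards [e.open_baseSet.mem_nhds hp, Filter.eventually_all.2 hZe] with q hq hq'
    refine ⟨hq, fun i ↦ ?_⟩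
    have hv : (e ⟨p, e.symmL ℝ p (b i)⟩).2 = b i := by
      rw [e.symmL_apply (R := ℝ) hp, e.apply_mk_symm hp]
    rw [hq' i]
    change e.symm q (e ⟨p, e.symmL ℝ p (b i)⟩).2 = _
    rw [hv, e.symmL_apply (R := ℝ) hq]
  let S := fun (i : Fin (Module.finrank ℝ E)) ↦
    ContinuousLinearMap.smulRightL ℝ E (Fin (Module.finrank ℝ E) → ℝ)
      (LinearMap.toContinuousLinearMap (b.coord i))
  -- The Gram matrix of the local frame `Z i`: it sends the coordinates of `v` to the inner products
  -- `g(v, Z j)`. Its inverse recovers `W` from the functions `g(W, Z j)`, and inversion is smooth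
  -- on invertible operators.
  let G : M → E →L[ℝ] (Fin (Module.finrank ℝ E) → ℝ) := fun q ↦
    ∑ i, S i (fun j ↦ g q (Z i q) (Z j q))
  have hGs : CMDiffAt ∞ G p := by
    refine ContMDiffAt.sum fun i _ ↦ (S i).contMDiff.contMDiffAt.comp p ?_
    exact contMDiffAt_pi_space.2 fun j ↦ hg.smooth _ _ (hZ i) (hZ j) p
  have hG : ∀ᶠ q in 𝓝 p, q ∈ e.baseSet ∧
      ∀ (v : TangentSpace I q) j, G q (e ⟨q, v⟩).2 j = g q v (Z j q) := by
    filter_upwards [hZb] with q hq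
    refine ⟨hq.1, fun v j ↦ ?_⟩
    have hv : v = ∑ i, (b.repr (e ⟨q, v⟩).2 i) • Z i q := by
      simp_rw [hq.2, ← map_smul, ← map_sum, b.sum_repr]
      rw [e.symmL_apply (R := ℝ) hq.1, e.symm_apply_apply_mk hq.1]
    conv_rhs => rw [hv]
    simp [G, S, Finset.sum_apply]
  have hGe : ∀ᶠ q in 𝓝 p, (G q).IsInvertible ∧
      ∀ v : TangentSpace I q, (e ⟨q, v⟩).2 = (G q).inverse fun j ↦ g q v (Z j q) := by
    filter_upwards [hG, hZb] with q hq hqZ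
    -- A vector orthogonal to the whole frame vanishes by nondegeneracy; injectivity gives
    -- invertibility because the dimensions agree.
    have hker : ∀ x, G q x = 0 → x = 0 := by
      intro x hx
      have hx' : (e ⟨q, e.symmL ℝ q x⟩).2 = x := by
        rw [e.symmL_apply (R := ℝ) hq.1, e.apply_mk_symm hq.1]
      have h0 : (e.symmL ℝ q x : TangentSpace I q) = 0 := by
        refine hg.nondegenerate q _ fun w ↦ ?_
        have hw : w = ∑ i, (b.repr (e ⟨q, w⟩).2 i) • Z i q := by
          simp_rw [hqZ.2, ← map_smul, ← map_sum, b.sum_repr]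
          rw [e.symmL_apply (R := ℝ) hq.1, e.symm_apply_apply_mk hq.1]
        rw [hw, map_sum]
        refine Finset.sum_eq_zero fun j _ ↦ ?_
        rw [map_smul, ← hq.2 _ j, hx', hx]
        simp
      rw [← hx', h0]
      exact (e.linear ℝ hq.1).map_zero
    have hinj : Function.Injective (G q) := (injective_iff_map_eq_zero _).2 hker
    have hinv : (G q).IsInvertible := by
      let L := LinearEquiv.ofInjectiveOfFinrankEq (G q).toLinearMap hinj (by simp)
      exact ⟨L.toContinuousLinearEquiv, by ext; rfl⟩
    refine ⟨hinv, fun v ↦ ?_⟩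
    have hGv : (fun j ↦ g q v (Z j q)) = G q (e ⟨q, v⟩).2 := by
      ext j; exact (hq.2 v j).symm
    rw [hGv, hinv.inverse_apply_self]
  have hin : CMDiffAt ∞ (fun q ↦ (G q).inverse) p := by
    obtain ⟨L, hL⟩ := hGe.self_of_nhds.1
    have := (contDiffAt_map_inverse (n := ∞) (𝕜 := ℝ) L).contMDiffAt
    rw [hL] at this
    exact this.comp p hGs
  have hc : ContMDiffAt I 𝓘(ℝ, Fin (Module.finrank ℝ E) → ℝ) ∞ (fun q j ↦ g q (W q) (Z j q)) p :=
    contMDiffAt_pi_space.2 fun j ↦ h _ (hZ j) p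
  refine (hin.clm_apply hc).congr_of_eventuallyEq ?_
  filter_upwards [hGe] with q hq
  exact hq.2 (W q)

theorem contMDiff_leviCivita_apply (hg : IsPseudoMetric g) (hX : CMDiff ∞ (T% X))
    (hY : CMDiff ∞ (T% Y)) : CMDiff ∞ (T% fun q ↦ leviCivita I g Y q (X q)) := by
  have n0 : (∞ : WithTop ℕ∞) ≠ 0 := by simp
  refine hg.contMDiff_of_inner fun Z hZ ↦ ?_
  have : (fun q ↦ g q (leviCivita I g Y q (X q)) (Z q)) =
      fun q ↦ (1 / 2 : ℝ) * koszul I g X Y Z q := by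
    ext q
    rw [← hg.two_mul_leviCivita (hX.mdifferentiableAt n0) (hY.mdifferentiableAt n0)
      (hZ.mdifferentiableAt n0)]
    simp
  rw [this]
  exact contMDiff_const.mul (hg.contMDiff_koszul hX hY hZ)

theorem contMDiff_leviCivita (hg : IsPseudoMetric g) (hY : CMDiff ∞ (T% Y)) :
    ContMDiff I (I.prod 𝓘(ℝ, E →L[ℝ] E)) ∞ (fun x ↦ TotalSpace.mk' (E →L[ℝ] E)
      (E := fun x ↦ TangentSpace I x →L[ℝ] TangentSpace I x) x (leviCivita I g Y x)) :=
  contMDiff_hom_of_apply _ fun _ hX ↦ hg.contMDiff_leviCivita_apply hX hY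

end IsPseudoMetric

end LeviCivitaProperties

/-! ### Curvature of the Levi-Civita connection and fields with `∇T = Id` -/

section Curvature

open VectorField

variable {E : Type*} [NormedAddCommGroup E] [NormedSpace ℝ E]
  {H : Type*} [TopologicalSpace H] {I : ModelWithCorners ℝ E H}
  {M : Type*} [TopologicalSpace M] [ChartedSpace H M] [IsManifold I ∞ M]
  {g : Π p : M, LinearMap.BilinForm ℝ (TangentSpace I p)} {X Y Z W T : Π p : M, TangentSpace I p}
  {p : M}

namespace IsPseudoMetric

theorem curvature_swap : curvature I (leviCivita I g) X Y Z p =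
    - curvature I (leviCivita I g) Y X Z p := by
  simp only [curvature, mlieBracket_swap_apply (V := Y) (W := X), map_neg]
  module

variable [FiniteDimensional ℝ E]

/-- Since `∇_Y T = Y`, the curvature `R(X,Y)T` is `∇_X Y - ∇_Y X - [X,Y]`, which is the torsion. -/
theorem curvature_apply_homothety (hg : IsPseudoMetric g)
    (hDT : ∀ q, leviCivita I g T q = ContinuousLinearMap.id ℝ _)
    (hX : MDiffAt (T% X) p) (hY : MDiffAt (T% Y) p) :
    curvature I (leviCivita I g) X Y T p = 0 := by
  simp only [curvature, hDT, ContinuousLinearMap.id_apply]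
  rw [← hg.torsion_free hX hY, sub_self]

variable [T2Space M]

theorem contMDiff_curvature (hg : IsPseudoMetric g) (hX : CMDiff ∞ (T% X))
    (hY : CMDiff ∞ (T% Y)) (hZ : CMDiff ∞ (T% Z)) :
    CMDiff ∞ (T% (curvature I (leviCivita I g) X Y Z)) := by
  have h1 := hg.contMDiff_leviCivita_apply hX (hg.contMDiff_leviCivita_apply hY hZ)
  have h2 := hg.contMDiff_leviCivita_apply hY (hg.contMDiff_leviCivita_apply hX hZ)
  have h3 := hg.contMDiff_leviCivita_apply (contMDiff_mlieBracket hX hY) hZ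
  exact (h1.sub_section h2).sub_section h3

theorem mdifferentiableAt_leviCivita_apply (hg : IsPseudoMetric g) (hX : MDiffAt (T% X) p)
    (hZ : CMDiff ∞ (T% Z)) : MDiffAt (T% fun q ↦ leviCivita I g Z q (X q)) p :=
  ((hg.contMDiff_leviCivita hZ).mdifferentiableAt (by simp)).clm_bundle_apply hX

/-- The term `(Yf) ∇_X Z` coming from `∇_Y(f ∇_X Z)` is cancelled by the one from `[fX,Y]`.
Differentiability of `X` at the point suffices, which matters because `ricci` inserts local
extensions of basis vectors in this slot. -/
theorem tensorialAt_curvature (hg : IsPseudoMetric g) (hZ : CMDiff ∞ (T% Z)) :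
    TensorialAt I E (fun X ↦ curvature I (leviCivita I g) X Y Z p) p where
  smul {f X} hf hX := by
    have : CompleteSpace E := FiniteDimensional.complete ℝ E
    have h : leviCivita I g (fun y ↦ leviCivita I g Z y ((f • X) y)) p =
        f p • leviCivita I g (fun y ↦ leviCivita I g Z y (X y)) p
          + (mvfderiv I f p).smulRight (leviCivita I g Z p (X p)) := by
      rw [← hg.isCovariantDerivativeOn.leibniz (hg.mdifferentiableAt_leviCivita_apply hX hZ) hf]
      congr 1
      ext y
      simp
    simp only [curvature, h, mlieBracket_smul_left hf hX]
    simp only [Pi.smul_apply', map_smul, map_add, add_apply, smul_apply,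
      ContinuousLinearMap.smulRight_apply, neg_smul, map_neg]
    module
  add {X X'} hX hX' := by
    have : CompleteSpace E := FiniteDimensional.complete ℝ E
    have h : leviCivita I g (fun y ↦ leviCivita I g Z y ((X + X') y)) p =
        leviCivita I g (fun y ↦ leviCivita I g Z y (X y)) p
          + leviCivita I g (fun y ↦ leviCivita I g Z y (X' y)) p := by
      rw [← hg.isCovariantDerivativeOn.add (hg.mdifferentiableAt_leviCivita_apply hX hZ)
        (hg.mdifferentiableAt_leviCivita_apply hX' hZ)]
      congr 1
      ext y
      simp
    simp only [curvature, h, mlieBracket_add_left hX hX']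
    simp only [Pi.add_apply, map_add, add_apply]
    module

/-- Differentiate `g(Z,W)` twice and antisymmetrize: the mixed products of first derivatives are
symmetric in the two directions and cancel, and the bracket accounts for the remaining term. -/
theorem inner_curvature (hg : IsPseudoMetric g) (hX : CMDiff ∞ (T% X))
    (hY : CMDiff ∞ (T% Y)) (hZ : CMDiff ∞ (T% Z)) (hW : CMDiff ∞ (T% W)) :
    g p (curvature I (leviCivita I g) X Y Z p) (W p) =
      - g p (Z p) (curvature I (leviCivita I g) X Y W p) := by
  have n0 : (∞ : WithTop ℕ∞) ≠ 0 := by simp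
  have key {A B : Π p : M, TangentSpace I p} (hA : CMDiff ∞ (T% A)) (hB : CMDiff ∞ (T% B)) :
      mvfderiv I (fun q ↦ mvfderiv I (fun q ↦ g q (Z q) (W q)) q (B q)) p (A p) =
        g p (leviCivita I g (fun y ↦ leviCivita I g Z y (B y)) p (A p)) (W p)
        + g p (leviCivita I g Z p (B p)) (leviCivita I g W p (A p))
        + g p (leviCivita I g Z p (A p)) (leviCivita I g W p (B p))
        + g p (Z p) (leviCivita I g (fun y ↦ leviCivita I g W y (B y)) p (A p)) := by
    have hBZ := hg.contMDiff_leviCivita_apply hB hZ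
    have hBW := hg.contMDiff_leviCivita_apply hB hW
    have e : (fun q ↦ mvfderiv I (fun q ↦ g q (Z q) (W q)) q (B q)) =
        fun q ↦ g q (leviCivita I g Z q (B q)) (W q) + g q (Z q) (leviCivita I g W q (B q)) := by
      ext q
      exact hg.mvfderiv_metric (hZ.mdifferentiableAt n0) (hW.mdifferentiableAt n0) _
    rw [e, mvfderiv_fun_add ((hg.smooth _ _ hBZ hW).mdifferentiableAt n0)
      ((hg.smooth _ _ hZ hBW).mdifferentiableAt n0), add_apply,
      hg.mvfderiv_metric (hBZ.mdifferentiableAt n0) (hW.mdifferentiableAt n0),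
      hg.mvfderiv_metric (hZ.mdifferentiableAt n0) (hBW.mdifferentiableAt n0)]
    ring
  have hb := mvfderiv_mlieBracket hX hY (hg.smooth _ _ hZ hW) p
  rw [key hX hY, key hY hX, hg.mvfderiv_metric (hZ.mdifferentiableAt n0)
    (hW.mdifferentiableAt n0)] at hb
  simp only [curvature, map_sub, LinearMap.sub_apply]
  linarith

theorem ext_of_contMDiff (hg : IsPseudoMetric g) {v w : TangentSpace I p}
    (h : ∀ Z : Π p : M, TangentSpace I p, CMDiff ∞ (T% Z) → g p v (Z p) = g p w (Z p)) :
    v = w := by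
  refine sub_eq_zero.1 (hg.nondegenerate p _ fun z ↦ ?_)
  obtain ⟨Z, hZ, rfl⟩ := exists_contMDiff_field p z
  rw [map_sub, LinearMap.sub_apply, h Z hZ, sub_self]

/-- The curvature tensor of the Levi-Civita connection at a point. -/
theorem exists_curvatureTensor (hg : IsPseudoMetric g) (p : M) :
    ∃ C : TangentSpace I p →ₗ[ℝ] TangentSpace I p →ₗ[ℝ] TangentSpace I p →ₗ[ℝ] TangentSpace I p,
      ∀ X Y Z : Π p : M, TangentSpace I p, MDiffAt (T% X) p → CMDiff ∞ (T% Y) → CMDiff ∞ (T% Z) →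
        curvature I (leviCivita I g) X Y Z p = C (X p) (Y p) (Z p) := by
  have n0 : (∞ : WithTop ℕ∞) ≠ 0 := by simp
  choose e he hep using exists_contMDiff_field (I := I) p
  have hed (v) : MDiffAt (T% (e v)) p := (he v).mdifferentiableAt n0
  let R (v w z : TangentSpace I p) := curvature I (leviCivita I g) (e v) (e w) (e z) p
  have hR1 {X Y Z : Π p : M, TangentSpace I p} (v : TangentSpace I p) (hX : MDiffAt (T% X) p)
      (hY : CMDiff ∞ (T% Y)) (hZ : CMDiff ∞ (T% Z)) (hv : X p = v) :
      curvature I (leviCivita I g) X Y Z p = curvature I (leviCivita I g) (e v) Y Z p :=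
    (hg.tensorialAt_curvature hZ).pointwise hX (hed v) (by rw [hep, hv])
  -- Dependence on the value of `Z` alone follows from skew-symmetry, which moves `Z` outside the
  -- curvature; no second order Leibniz computation is needed. The middle slot is reduced to the
  -- first by antisymmetry.
  have hR3 {X Y Z : Π p : M, TangentSpace I p} (hX : CMDiff ∞ (T% X))
      (hY : CMDiff ∞ (T% Y)) (hZ : CMDiff ∞ (T% Z)) :
      curvature I (leviCivita I g) X Y Z p = curvature I (leviCivita I g) X Y (e (Z p)) p := by
    refine hg.ext_of_contMDiff fun W hW ↦ ?_
    rw [hg.inner_curvature hX hY hZ hW, hg.inner_curvature hX hY (he _) hW, hep]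
  have hR {X Y Z : Π p : M, TangentSpace I p} (hX : MDiffAt (T% X) p)
      (hY : CMDiff ∞ (T% Y)) (hZ : CMDiff ∞ (T% Z)) :
      curvature I (leviCivita I g) X Y Z p = R (X p) (Y p) (Z p) := by
    rw [hR1 _ hX hY hZ rfl, hR3 (he _) hY hZ, curvature_swap,
      hR1 _ (hY.mdifferentiableAt n0) (he _) (he _) rfl, ← curvature_swap]
  have add₁ (v v' w z) : R (v + v') w z = R v w z + R v' w z := by
    rw [← (hg.tensorialAt_curvature (he z)).add (hed v) (hed v'),
      hR (mdifferentiableAt_add_section (hed v) (hed v')) (he w) (he z)]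
    simp [hep]
  have smul₁ (c : ℝ) (v w z) : R (c • v) w z = c • R v w z := by
    have := (hg.tensorialAt_curvature (p := p) (Y := e w) (he z)).smul
      (f := fun _ ↦ c) mdifferentiableAt_const (hed v)
    rw [hR (mdifferentiableAt_const.smul_section (hed v)) (he w) (he z)] at this
    simpa [hep] using this
  have swap (v w z) : R v w z = - R w v z := curvature_swap
  have anti (v w z) (W : Π p : M, TangentSpace I p) (hW : CMDiff ∞ (T% W)) :
      g p (R v w z) (W p) = - g p z (curvature I (leviCivita I g) (e v) (e w) W p) := by
    rw [hg.inner_curvature (he v) (he w) (he z) hW, hep]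
  have add₃ (v w z z') : R v w (z + z') = R v w z + R v w z' := by
    refine hg.ext_of_contMDiff fun W hW ↦ ?_
    rw [anti _ _ _ W hW, map_add, map_add, LinearMap.add_apply, LinearMap.add_apply,
      anti _ _ _ W hW, anti _ _ _ W hW]
    ring
  have smul₃ (c : ℝ) (v w z) : R v w (c • z) = c • R v w z := by
    refine hg.ext_of_contMDiff fun W hW ↦ ?_
    rw [anti _ _ _ W hW, map_smul, map_smul, LinearMap.smul_apply, LinearMap.smul_apply,
      anti _ _ _ W hW, smul_neg]
  refine ⟨LinearMap.mk₂ ℝ (fun v w ↦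
    { toFun := R v w, map_add' := add₃ v w, map_smul' := fun c z ↦ smul₃ c v w z })
    (fun v v' w ↦ ?_) (fun c v w ↦ ?_) (fun v w w' ↦ ?_) (fun c v w ↦ ?_),
    fun X Y Z hX hY hZ ↦ hR hX hY hZ⟩
  · ext z; exact add₁ v v' w z
  · ext z; exact smul₁ c v w z
  · ext z
    change R v (w + w') z = R v w z + R v w' z
    rw [swap, add₁, swap w, swap w']; abel
  · ext z
    change R v (c • w) z = c • R v w z
    rw [swap, smul₁, swap w]; simp

/-- The curvature tensor of the Levi-Civita connection of a pseudo-Riemannian metric. -/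
def curvatureTensor (hg : IsPseudoMetric g) (p : M) :
    TangentSpace I p →ₗ[ℝ] TangentSpace I p →ₗ[ℝ] TangentSpace I p →ₗ[ℝ] TangentSpace I p :=
  (hg.exists_curvatureTensor p).choose

theorem curvature_eq (hg : IsPseudoMetric g) (hX : MDiffAt (T% X) p) (hY : CMDiff ∞ (T% Y))
    (hZ : CMDiff ∞ (T% Z)) :
    curvature I (leviCivita I g) X Y Z p = hg.curvatureTensor p (X p) (Y p) (Z p) :=
  (hg.exists_curvatureTensor p).choose_spec X Y Z hX hY hZ

theorem curvatureTensor_swap (hg : IsPseudoMetric g) (v w z : TangentSpace I p) :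
    hg.curvatureTensor p v w z = - hg.curvatureTensor p w v z := by
  have n0 : (∞ : WithTop ℕ∞) ≠ 0 := by simp
  obtain ⟨X, hX, rfl⟩ := exists_contMDiff_field p v
  obtain ⟨Y, hY, rfl⟩ := exists_contMDiff_field p w
  obtain ⟨Z, hZ, rfl⟩ := exists_contMDiff_field p z
  rw [← hg.curvature_eq (hX.mdifferentiableAt n0) hY hZ,
    ← hg.curvature_eq (hY.mdifferentiableAt n0) hX hZ, curvature_swap]

theorem inner_curvatureTensor (hg : IsPseudoMetric g) (u v w z : TangentSpace I p) :
    g p (hg.curvatureTensor p u v w) z = - g p w (hg.curvatureTensor p u v z) := by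
  have n0 : (∞ : WithTop ℕ∞) ≠ 0 := by simp
  obtain ⟨X, hX, rfl⟩ := exists_contMDiff_field p u
  obtain ⟨Y, hY, rfl⟩ := exists_contMDiff_field p v
  obtain ⟨Z, hZ, rfl⟩ := exists_contMDiff_field p w
  obtain ⟨W, hW, rfl⟩ := exists_contMDiff_field p z
  rw [← hg.curvature_eq (hX.mdifferentiableAt n0) hY hZ,
    ← hg.curvature_eq (hX.mdifferentiableAt n0) hY hW, hg.inner_curvature hX hY hZ hW]

/-- The Ricci tensor is the trace of the curvature tensor. -/
theorem ricci_eq (hg : IsPseudoMetric g) (hY : CMDiff ∞ (T% Y)) (hZ : CMDiff ∞ (T% Z)) (p : M) :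
    ricci I (leviCivita I g) Y Z p =
      LinearMap.trace ℝ (TangentSpace I p)
        (((hg.curvatureTensor p).flip (Y p)).flip (Z p)) := by
  let b : Module.Basis _ ℝ (TangentSpace I p) := Module.finBasis ℝ E
  rw [LinearMap.trace_eq_matrix_trace ℝ b, Matrix.trace, ricci]
  refine Finset.sum_congr rfl fun i _ ↦ ?_
  have h := hg.curvature_eq (FiberBundle.mdifferentiableAt_extend I E (b i)) hY hZ
  rw [FiberBundle.extend_apply_self] at h
  rw [Matrix.diag_apply, LinearMap.toMatrix_apply]
  change b.coord i (curvature I (leviCivita I g) (FiberBundle.extend E (b i)) Y Z p) = _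
  rw [h]
  rfl

/-! ### Homothetic gradient fields -/

section Homothety

theorem curvatureTensor_right_homothety (hg : IsPseudoMetric g) (hT : CMDiff ∞ (T% T))
    (hDT : ∀ q, leviCivita I g T q = ContinuousLinearMap.id ℝ _) (v w : TangentSpace I p) :
    hg.curvatureTensor p v w (T p) = 0 := by
  have n0 : (∞ : WithTop ℕ∞) ≠ 0 := by simp
  obtain ⟨X, hX, rfl⟩ := exists_contMDiff_field p v
  obtain ⟨Y, hY, rfl⟩ := exists_contMDiff_field p w
  rw [← hg.curvature_eq (hX.mdifferentiableAt n0) hY hT,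
    hg.curvature_apply_homothety hDT (hX.mdifferentiableAt n0) (hY.mdifferentiableAt n0)]

/-- Skew-symmetry converts `R(u,v)T = 0` into the statement that the values of the curvature are
orthogonal to `T`. -/
theorem inner_curvatureTensor_homothety (hg : IsPseudoMetric g) (hT : CMDiff ∞ (T% T))
    (hDT : ∀ q, leviCivita I g T q = ContinuousLinearMap.id ℝ _) (u v w : TangentSpace I p) :
    g p (hg.curvatureTensor p u v w) (T p) = 0 := by
  rw [hg.inner_curvatureTensor, hg.curvatureTensor_right_homothety hT hDT, map_zero, neg_zero]

/-- For `[T,Z] = 0` vanishing torsion gives `∇_T Z = ∇_Z T = Z`. Hence `R(T,Y)Z = ∇_T(∇_Y Z) - ∇_Y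
Z`, and as `∇_W T = W` for `W = ∇_Y Z`, this is `[T, ∇_Y Z]`. -/
theorem curvature_homothety_left (hg : IsPseudoMetric g) (hT : CMDiff ∞ (T% T))
    (hDT : ∀ q, leviCivita I g T q = ContinuousLinearMap.id ℝ _)
    (hY : CMDiff ∞ (T% Y)) (hTY : ∀ q, mlieBracket I T Y q = 0)
    (hZ : CMDiff ∞ (T% Z)) (hTZ : ∀ q, mlieBracket I T Z q = 0) (p : M) :
    curvature I (leviCivita I g) T Y Z p =
      mlieBracket I T (fun q ↦ leviCivita I g Z q (Y q)) p := by
  have n0 : (∞ : WithTop ℕ∞) ≠ 0 := by simp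
  have hTd (q) := hT.mdifferentiableAt (x := q) n0
  have hYZ := hg.contMDiff_leviCivita_apply hY hZ
  have h1 : (fun q ↦ leviCivita I g Z q (T q)) = Z := by
    ext q
    have := hg.torsion_free (hTd q) (hZ.mdifferentiableAt (x := q) n0)
    rw [hTZ, hDT, ContinuousLinearMap.id_apply] at this
    exact sub_eq_zero.1 this
  have h2 := hg.torsion_free (hTd p) (hYZ.mdifferentiableAt (x := p) n0)
  rw [hDT, ContinuousLinearMap.id_apply] at h2
  simp only [curvature, h1, hTY, map_zero, sub_zero]
  exact h2


/-- For fields commuting with `T`, the difference `R(T,Y)Z - R(T,Z)Y` equals `[T,[Y,Z]]`, which is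
zero by Jacobi. So `g(R(T,a)b, c)` is symmetric in `a, b` and skew in `b, c`, and such a trilinear
form vanishes. The hypothesis `hspan` provides enough commuting fields to test on. -/
theorem curvatureTensor_left_homothety (hg : IsPseudoMetric g) (hT : CMDiff ∞ (T% T))
    (hDT : ∀ q, leviCivita I g T q = ContinuousLinearMap.id ℝ _)
    (hspan : ∀ (p : M) (v : TangentSpace I p), ∃ V : Π p : M, TangentSpace I p,
      CMDiff ∞ (T% V) ∧ (∀ q, mlieBracket I T V q = 0) ∧ V p = v) (v w : TangentSpace I p) :
    hg.curvatureTensor p (T p) v w = 0 := by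
  have n0 : (∞ : WithTop ℕ∞) ≠ 0 := by simp
  have symm (v w) : hg.curvatureTensor p (T p) v w = hg.curvatureTensor p (T p) w v := by
    obtain ⟨Y, hY, hTY, rfl⟩ := hspan p v
    obtain ⟨Z, hZ, hTZ, rfl⟩ := hspan p w
    rw [← hg.curvature_eq (hT.mdifferentiableAt n0) hY hZ,
      ← hg.curvature_eq (hT.mdifferentiableAt n0) hZ hY,
      hg.curvature_homothety_left hT hDT hY hTY hZ hTZ,
      hg.curvature_homothety_left hT hDT hZ hTZ hY hTY]
    have hYZ : (fun q ↦ leviCivita I g Z q (Y q)) =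
        (fun q ↦ leviCivita I g Y q (Z q)) + mlieBracket I Y Z := by
      ext q
      rw [Pi.add_apply, ← hg.torsion_free (hY.mdifferentiableAt n0) (hZ.mdifferentiableAt n0)]
      abel
    have : CompleteSpace E := FiniteDimensional.complete ℝ E
    have hj := jacobi_mlieBracket (x := p) hT hY (hZ p)
    have e1 : mlieBracket I T Y = 0 := by ext q; exact hTY q
    have e2 : mlieBracket I T Z = 0 := by ext q; exact hTZ q
    rw [e1, e2, mlieBracket_zero_left, mlieBracket_zero_right] at hj
    rw [hYZ, mlieBracket_add_right
      ((hg.contMDiff_leviCivita_apply hZ hY).mdifferentiableAt n0)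
      ((contMDiff_mlieBracket hY hZ).mdifferentiableAt n0), hj]
    simp
  refine hg.nondegenerate p _ fun z ↦ ?_
  let S (a b c : TangentSpace I p) := g p (hg.curvatureTensor p (T p) a b) c
  have s1 (a b c) : S a b c = S b a c := by simp only [S, symm a b]
  have s2 (a b c) : S a b c = - S a c b := by
    simp only [S]; rw [hg.inner_curvatureTensor, hg.symm p b]
  -- Alternating the two symmetries six times returns to the starting order of the arguments after
  -- three sign changes.
  have h : S v w z = - S v w z := by
    conv_lhs => rw [s1, s2, s1, s2, s1]
    rw [s2 v z w]
    ring
  change S v w z = 0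
  linarith

/-- The covariant derivatives of fields which commute with `T` commute with `T`. -/
theorem mlieBracket_homothety_leviCivita (hg : IsPseudoMetric g) (hT : CMDiff ∞ (T% T))
    (hDT : ∀ q, leviCivita I g T q = ContinuousLinearMap.id ℝ _)
    (hspan : ∀ (p : M) (v : TangentSpace I p), ∃ V : Π p : M, TangentSpace I p,
      CMDiff ∞ (T% V) ∧ (∀ q, mlieBracket I T V q = 0) ∧ V p = v)
    (hY : CMDiff ∞ (T% Y)) (hTY : ∀ q, mlieBracket I T Y q = 0)
    (hZ : CMDiff ∞ (T% Z)) (hTZ : ∀ q, mlieBracket I T Z q = 0) (p : M) :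
    mlieBracket I T (fun q ↦ leviCivita I g Z q (Y q)) p = 0 := by
  rw [← hg.curvature_homothety_left hT hDT hY hTY hZ hTZ,
    hg.curvature_eq (hT.mdifferentiableAt (by simp)) hY hZ,
    hg.curvatureTensor_left_homothety hT hDT hspan]

/-- The curvature fields of fields which commute with `T` commute with `T`. -/
theorem mlieBracket_homothety_curvature (hg : IsPseudoMetric g) (hT : CMDiff ∞ (T% T))
    (hDT : ∀ q, leviCivita I g T q = ContinuousLinearMap.id ℝ _)
    (hspan : ∀ (p : M) (v : TangentSpace I p), ∃ V : Π p : M, TangentSpace I p,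
      CMDiff ∞ (T% V) ∧ (∀ q, mlieBracket I T V q = 0) ∧ V p = v)
    (hX : CMDiff ∞ (T% X)) (hTX : ∀ q, mlieBracket I T X q = 0)
    (hY : CMDiff ∞ (T% Y)) (hTY : ∀ q, mlieBracket I T Y q = 0)
    (hZ : CMDiff ∞ (T% Z)) (hTZ : ∀ q, mlieBracket I T Z q = 0) (p : M) :
    mlieBracket I T (curvature I (leviCivita I g) X Y Z) p = 0 := by
  have n0 : (∞ : WithTop ℕ∞) ≠ 0 := by simp
  have : CompleteSpace E := FiniteDimensional.complete ℝ E
  -- Fields commuting with `T` are closed under brackets and under covariant derivatives, so each of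
  -- the three terms of the curvature commutes with `T`.
  have hXY : ∀ q, mlieBracket I T (mlieBracket I X Y) q = 0 := by
    intro q
    have e1 : mlieBracket I T X = 0 := by ext q; exact hTX q
    have e2 : mlieBracket I T Y = 0 := by ext q; exact hTY q
    rw [jacobi_mlieBracket hT hX (hY q), e1, e2, mlieBracket_zero_left, mlieBracket_zero_right]
    simp
  have hYZ := hg.contMDiff_leviCivita_apply hY hZ
  have hXZ := hg.contMDiff_leviCivita_apply hX hZ
  have c1 := hg.mlieBracket_homothety_leviCivita hT hDT hspan hX hTX hYZ
    (hg.mlieBracket_homothety_leviCivita hT hDT hspan hY hTY hZ hTZ) p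
  have c2 := hg.mlieBracket_homothety_leviCivita hT hDT hspan hY hTY hXZ
    (hg.mlieBracket_homothety_leviCivita hT hDT hspan hX hTX hZ hTZ) p
  have hB := contMDiff_mlieBracket hX hY
  have c3 := hg.mlieBracket_homothety_leviCivita hT hDT hspan hB hXY hZ hTZ p
  have d1 := (hg.contMDiff_leviCivita_apply hX hYZ).mdifferentiableAt (x := p) n0
  have d2 := (hg.contMDiff_leviCivita_apply hY hXZ).mdifferentiableAt (x := p) n0
  have d3 := (hg.contMDiff_leviCivita_apply hB hZ).mdifferentiableAt (x := p) n0
  have e : curvature I (leviCivita I g) X Y Z =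
      (fun q ↦ leviCivita I g (fun y ↦ leviCivita I g Z y (Y y)) q (X q))
      + ((-1 : ℝ) • (fun q ↦ leviCivita I g (fun y ↦ leviCivita I g Z y (X y)) q (Y q))
      + (-1 : ℝ) • fun q ↦ leviCivita I g Z q (mlieBracket I X Y q)) := by
    ext q
    simp only [curvature, Pi.add_apply, Pi.smul_apply]
    module
  rw [e, mlieBracket_add_right d1 (mdifferentiableAt_add_section d2.smul_const_section
    d3.smul_const_section), mlieBracket_add_right d2.smul_const_section d3.smul_const_section,
    mlieBracket_const_smul_right d2, mlieBracket_const_smul_right d3, c1, c2, c3]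
  simp

end Homothety

end IsPseudoMetric

end Curvature

/-! ### Connections in a trivialization and on pullback bundles -/

section CovariantDerivatives

variable {E : Type*} [NormedAddCommGroup E] [NormedSpace ℝ E]
  {H : Type*} [TopologicalSpace H] {I : ModelWithCorners ℝ E H}
  {M : Type*} [TopologicalSpace M] [ChartedSpace H M]
  {E' : Type*} [NormedAddCommGroup E'] [NormedSpace ℝ E']
  {H' : Type*} [TopologicalSpace H'] {J : ModelWithCorners ℝ E' H'}
  {N : Type*} [TopologicalSpace N] [ChartedSpace H' N]
  {F : Type*} [NormedAddCommGroup F] [NormedSpace ℝ F]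
  {V : N → Type*} [TopologicalSpace (TotalSpace F V)]
  [∀ x, AddCommGroup (V x)] [∀ x, Module ℝ (V x)] [∀ x, TopologicalSpace (V x)]
  [∀ x, IsTopologicalAddGroup (V x)] [∀ x, ContinuousSMul ℝ (V x)]
  [FiberBundle F V] [VectorBundle ℝ F V]
  {D : (Π y : N, V y) → (Π y : N, TangentSpace J y →L[ℝ] V y)}

/-- Linearity of the extension holds only near `q`, where the trivialization is fibrewise linear;
this is enough because connections are local. -/
theorem extend_add {q : N} (v w : V q) : ∀ᶠ y in 𝓝 q,
    FiberBundle.extend F (v + w) y = FiberBundle.extend F v y + FiberBundle.extend F w y := by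
  let e := trivializationAt F V q
  have hq : q ∈ e.baseSet := FiberBundle.mem_baseSet_trivializationAt' q
  filter_upwards [e.open_baseSet.mem_nhds hq] with y hy
  change e.symm y (e ⟨q, v + w⟩).2 = e.symm y (e ⟨q, v⟩).2 + e.symm y (e ⟨q, w⟩).2
  rw [(e.linear ℝ hq).map_add]
  simp only [← e.symmL_apply (R := ℝ) hy, map_add]

theorem extend_smul {q : N} (c : ℝ) (v : V q) : ∀ᶠ y in 𝓝 q,
    FiberBundle.extend F (c • v) y = c • FiberBundle.extend F v y := by
  let e := trivializationAt F V q
  have hq : q ∈ e.baseSet := FiberBundle.mem_baseSet_trivializationAt' q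
  filter_upwards [e.open_baseSet.mem_nhds hq] with y hy
  change e.symm y (e ⟨q, c • v⟩).2 = c • e.symm y (e ⟨q, v⟩).2
  rw [(e.linear ℝ hq).map_smul]
  simp only [← e.symmL_apply (R := ℝ) hy, map_smul]

variable [ContMDiffVectorBundle 1 F V J]

theorem covariantDerivative_extend_add (hD : IsCovariantDerivativeOn F D univ) {q : N} (v w : V q) :
    D (FiberBundle.extend F (v + w)) q =
      D (FiberBundle.extend F v) q + D (FiberBundle.extend F w) q := by
  have h (v : V q) := FiberBundle.mdifferentiableAt_extend J F v
  rw [← hD.add (h v) (h w)]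
  exact hD.congr_of_eventuallyEq (h _) (mdifferentiableAt_add_section (h v) (h w)) Filter.univ_mem
    (extend_add v w)

theorem covariantDerivative_extend_smul (hD : IsCovariantDerivativeOn F D univ) {q : N} (c : ℝ)
    (v : V q) : D (FiberBundle.extend F (c • v)) q = c • D (FiberBundle.extend F v) q := by
  have h (v : V q) := FiberBundle.mdifferentiableAt_extend J F v
  rw [← hD.smul_const c (h v)]
  exact hD.congr_of_eventuallyEq (h _) (h v).smul_const_section Filter.univ_mem (extend_smul c v)

/-- A covariant derivative in the preferred trivialization. -/
theorem covariantDerivative_eq_trivialization [FiniteDimensional ℝ F]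
    (hD : IsCovariantDerivativeOn F D univ) {q : N} {s : Π y : N, V y} (hs : MDiffAt (T% s) q) :
    D s q = ((trivializationAt F V q).symmL ℝ q).comp
        (mvfderiv J (fun y ↦ (trivializationAt F V q (TotalSpace.mk' F y (s y))).2) q)
      + D (FiberBundle.extend F (s q)) q := by
  let e := trivializationAt F V q
  have hq : q ∈ e.baseSet := FiberBundle.mem_baseSet_trivializationAt' q
  let c (s : Π y : N, V y) : N → F := fun y ↦ (e (TotalSpace.mk' F y (s y))).2
  -- The difference of the two sides. The Leibniz terms cancel, so it is tensorial and may be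
  -- evaluated on the extension of `s q` with constant coordinates, for which the coordinate
  -- derivative vanishes and the two sides coincide.
  let Δ (s : Π y : N, V y) : TangentSpace J q →L[ℝ] V q :=
    D s q - ((e.symmL ℝ q).comp (mvfderiv J (c s) q) + D (FiberBundle.extend F (s q)) q)
  have hc {s : Π y : N, V y} (hs : MDiffAt (T% s) q) : MDiffAt (c s) q :=
    (mdifferentiableAt_section _ s).1 hs
  have hΔ : TensorialAt J F Δ q :=
    { smul := by
        intro f s hf hs
        have h1 : mvfderiv J (c (f • s)) q =
            f q • mvfderiv J (c s) q + (mvfderiv J f q).smulRight (c s q) := by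
          rw [← mvfderiv_smul hf (hc hs)]
          have : c (f • s) =ᶠ[𝓝 q] f • c s := by
            filter_upwards [e.open_baseSet.mem_nhds hq] with y hy
            exact (e.linear ℝ hy).map_smul _ _
          simp only [mvfderiv, this.mfderiv_eq]
          rfl
        have h2 : e.symmL ℝ q (c s q) = s q := by
          rw [e.symmL_apply (R := ℝ) hq]; exact e.symm_apply_apply_mk hq _
        simp only [Δ]
        rw [hD.leibniz hs hf, h1, Pi.smul_apply', covariantDerivative_extend_smul hD]
        ext v
        simp only [sub_apply, add_apply, smul_apply, ContinuousLinearMap.comp_apply, map_add,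
          map_smul, ContinuousLinearMap.smulRight_apply, h2]
        module
      add := by
        intro s s' hs hs'
        have h1 : mvfderiv J (c (s + s')) q = mvfderiv J (c s) q + mvfderiv J (c s') q := by
          rw [← mvfderiv_add (hc hs) (hc hs')]
          have : c (s + s') =ᶠ[𝓝 q] c s + c s' := by
            filter_upwards [e.open_baseSet.mem_nhds hq] with y hy
            exact (e.linear ℝ hy).map_add _ _
          simp only [mvfderiv, this.mfderiv_eq]
          rfl
        simp only [Δ]
        rw [hD.add hs hs', h1, Pi.add_apply, covariantDerivative_extend_add hD]
        ext v
        simp only [sub_apply, add_apply, ContinuousLinearMap.comp_apply, map_add]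
        module }
  have h0 : Δ s = Δ (FiberBundle.extend F (s q)) :=
    hΔ.pointwise hs (FiberBundle.mdifferentiableAt_extend J F _) (by simp)
  have h1 : c (FiberBundle.extend F (s q)) =ᶠ[𝓝 q] fun _ ↦ (e ⟨q, s q⟩).2 := by
    filter_upwards [e.open_baseSet.mem_nhds hq] with y hy
    change (e ⟨y, e.symm y (e ⟨q, s q⟩).2⟩).2 = _
    rw [e.apply_mk_symm hy]
  have h2 : mvfderiv J (c (FiberBundle.extend F (s q))) q = 0 := by
    rw [← mvfderiv_const (I := J) (x := q) (e ⟨q, s q⟩).2]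
    simp only [mvfderiv, h1.mfderiv_eq]
    rfl
  have h3 : Δ (FiberBundle.extend F (s q)) = 0 := by
    simp only [Δ, h2, FiberBundle.extend_apply_self, ContinuousLinearMap.comp_zero, zero_add,
      sub_self]
  exact sub_eq_zero.1 (h0.trans h3)

variable {f : C^∞⟮I, M; J, N⟯}

/-- The pullback bundle is trivialized by the trivializations of `V`, so both sides say that the
same coordinate functions are smooth; the base map `f` is smooth anyway. -/
theorem contMDiff_pullback_section_iff {σ : Π x : M, (f *ᵖ V) x} :
    ContMDiff I (I.prod 𝓘(ℝ, F)) ∞ (fun x ↦ TotalSpace.mk' F x (σ x)) ↔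
      ContMDiff I (J.prod 𝓘(ℝ, F)) ∞ (fun x ↦ (TotalSpace.mk' F (f x) (σ x) : TotalSpace F V)) := by
  refine forall_congr' fun x ↦ ?_
  rw [contMDiffAt_section, contMDiffAt_totalSpace]
  exact (and_iff_right (f.contMDiff x)).symm

theorem mdifferentiableAt_pullback_section_iff {σ : Π x : M, (f *ᵖ V) x} {x : M} :
    MDifferentiableAt I (I.prod 𝓘(ℝ, F)) (fun x ↦ TotalSpace.mk' F x (σ x)) x ↔
      MDiffAt (fun y ↦ (trivializationAt F V (f x) (TotalSpace.mk' F (f y) (σ y))).2) x := by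
  rw [mdifferentiableAt_section]
  rfl

/-- The induced connection on a section which is the restriction of a section of `V`. -/
theorem pullbackConnection_comp [FiniteDimensional ℝ F] (hD : IsCovariantDerivativeOn F D univ)
    {s : Π y : N, V y} {x : M} (hs : MDiffAt (T% s) (f x)) (v : TangentSpace I x) :
    pullbackConnection F D f (fun y ↦ s (f y)) x v = D s (f x) (mfderiv I J f x v) := by
  have hS := (mdifferentiableAt_section _ s).1 hs
  have hf : MDifferentiableAt I J f x := f.contMDiff.mdifferentiableAt (by simp)
  have h := congr($(mfderiv_comp x hS hf) v)
  rw [covariantDerivative_eq_trivialization hD hs]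
  exact congr((trivializationAt F V (f x)).symmL ℝ (f x) $h
    + D (FiberBundle.extend F (s (f x))) (f x) (mfderiv I J f x v))

/-- The coordinate derivative carries the Leibniz term, while the second summand depends linearly on
the value of the section at `x`. The identities `key` are written in the fibre of `V` over `f x`,
which is the fibre of the pullback by definition. -/
theorem pullbackConnection_isCovariantDerivativeOn (hD : IsCovariantDerivativeOn F D univ) :
    IsCovariantDerivativeOn F (pullbackConnection F D f) univ where
  add {σ τ x} hσ hτ _ := by
    let e := trivializationAt F V (f x)
    let c (σ : Π x : M, (f *ᵖ V) x) (y : M) : F := (e (TotalSpace.mk' F (f y) (σ y))).2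
    have hq : f x ∈ e.baseSet := FiberBundle.mem_baseSet_trivializationAt' (f x)
    rw [mdifferentiableAt_pullback_section_iff] at hσ hτ
    have h1 : mvfderiv I (c (σ + τ)) x = mvfderiv I (c σ) x + mvfderiv I (c τ) x := by
      rw [← mvfderiv_add hσ hτ]
      have : c (σ + τ) =ᶠ[𝓝 x] c σ + c τ := by
        filter_upwards [f.contMDiff.continuous.continuousAt.preimage_mem_nhds
          (e.open_baseSet.mem_nhds hq)] with y hy
        exact (e.linear ℝ hy).map_add _ _
      simp only [mvfderiv, this.mfderiv_eq]
      rfl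
    let s : V (f x) := σ x
    let t : V (f x) := τ x
    ext v
    let w : TangentSpace J (f x) := mfderiv I J f x v
    have key : e.symmL ℝ (f x) (mvfderiv I (c (σ + τ)) x v) + D (FiberBundle.extend F (s + t)) (f x) w
        = (e.symmL ℝ (f x) (mvfderiv I (c σ) x v) + D (FiberBundle.extend F s) (f x) w)
        + (e.symmL ℝ (f x) (mvfderiv I (c τ) x v) + D (FiberBundle.extend F t) (f x) w) := by
      rw [h1, covariantDerivative_extend_add hD, add_apply, add_apply, map_add]
      abel
    exact key
  leibniz {σ φ x} hσ hφ _ := by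
    let e := trivializationAt F V (f x)
    let c (σ : Π x : M, (f *ᵖ V) x) (y : M) : F := (e (TotalSpace.mk' F (f y) (σ y))).2
    have hq : f x ∈ e.baseSet := FiberBundle.mem_baseSet_trivializationAt' (f x)
    rw [mdifferentiableAt_pullback_section_iff] at hσ
    have h1 : mvfderiv I (c (φ • σ)) x =
        φ x • mvfderiv I (c σ) x + (mvfderiv I φ x).smulRight (c σ x) := by
      rw [← mvfderiv_smul hφ hσ]
      have : c (φ • σ) =ᶠ[𝓝 x] φ • c σ := by
        filter_upwards [f.contMDiff.continuous.continuousAt.preimage_mem_nhds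
          (e.open_baseSet.mem_nhds hq)] with y hy
        exact (e.linear ℝ hy).map_smul _ _
      simp only [mvfderiv, this.mfderiv_eq]
      rfl
    let s : V (f x) := σ x
    have h3 : e.symmL ℝ (f x) (c σ x) = s := by
      rw [e.symmL_apply (R := ℝ) hq]; exact e.symm_apply_apply_mk hq _
    ext v
    let w : TangentSpace J (f x) := mfderiv I J f x v
    have key : e.symmL ℝ (f x) (mvfderiv I (c (φ • σ)) x v)
          + D (FiberBundle.extend F (φ x • s)) (f x) w
        = φ x • (e.symmL ℝ (f x) (mvfderiv I (c σ) x v) + D (FiberBundle.extend F s) (f x) w)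
          + mvfderiv I φ x v • s := by
      rw [h1, covariantDerivative_extend_smul hD, add_apply, smul_apply, smul_apply, map_add,
        ContinuousLinearMap.smulRight_apply, map_smul, map_smul, h3]
      module
    exact key

end CovariantDerivatives

/-! ### Open subsets of a vector space -/

section Opens

variable {E : Type*} [NormedAddCommGroup E] [NormedSpace ℝ E] {U : TopologicalSpace.Opens E}

/-- The charts of an open subset are restrictions of the identity, so near `y` the inverse chart
does nothing. -/
theorem opens_val_chartAt_symm (y : U) :
    ∀ᶠ z in 𝓝 (y : E), (((chartAt E y).symm z : U) : E) = z := by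
  have h : (y : E) ∈ (chartAt E y).target := mem_chart_target E y
  filter_upwards [(chartAt E y).open_target.mem_nhds h] with z hz
  exact (chartAt E y).right_inv hz

theorem hasMFDerivAt_opens_val (y : U) :
    HasMFDerivAt 𝓘(ℝ, E) 𝓘(ℝ, E) (Subtype.val : U → E) y (ContinuousLinearMap.id ℝ E) := by
  refine ⟨continuous_subtype_val.continuousAt, ?_⟩
  refine (hasFDerivWithinAt_id (𝕜 := ℝ) (y : E) (range 𝓘(ℝ, E))).congr_of_eventuallyEq ?_ ?_
  · exact Filter.Eventually.filter_mono nhdsWithin_le_nhds (opens_val_chartAt_symm y)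
  · exact (opens_val_chartAt_symm y).self_of_nhds

/-- All the preferred trivializations of the tangent bundle of `U` are the identity on vectors.
Hence smoothness of the `(t, r)`-part of an ambient field can be read off from its components. -/
theorem opens_trivializationAt_snd (x : U) (z : TangentBundle 𝓘(ℝ, E) U) :
    (trivializationAt E (TangentSpace 𝓘(ℝ, E)) x z).2 = z.2 := by
  rw [TangentBundle.trivializationAt_apply]
  change fderivWithin ℝ (fun w ↦ (((chartAt E z.1).symm w : U) : E)) (range 𝓘(ℝ, E)) (z.1 : E) z.2 = _
  rw [modelWithCornersSelf_coe, range_id, fderivWithin_univ,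
    Filter.EventuallyEq.fderiv_eq (f := id) (opens_val_chartAt_symm z.1), fderiv_id]
  rfl

end Opens

/-! ### Coordinates, components and smooth fields on `B × M` -/

section Ambient

variable {n : ℕ} {M : Type*} [TopologicalSpace M] [ChartedSpace (EuclideanSpace ℝ (Fin n)) M]
  [IsManifold (𝓡 n) ∞ M] {δ : ℝ}

theorem hasMFDerivAt_stripCoord (p : Ambient δ M) :
    HasMFDerivAt (ambientModel n) 𝓘(ℝ, ℝ × ℝ) (fun q : Ambient δ M ↦ (q.1 : ℝ × ℝ)) p
      (ContinuousLinearMap.fst ℝ (ℝ × ℝ) (EuclideanSpace ℝ (Fin n))) :=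
  (hasMFDerivAt_opens_val p.1).comp p (hasMFDerivAt_fst p)

theorem contMDiff_tCoord : ContMDiff (ambientModel n) 𝓘(ℝ, ℝ) ∞ (tCoord : Ambient δ M → ℝ) :=
  contDiff_fst.contMDiff.comp (contMDiff_subtype_val.comp contMDiff_fst)

theorem contMDiff_rCoord : ContMDiff (ambientModel n) 𝓘(ℝ, ℝ) ∞ (rCoord : Ambient δ M → ℝ) :=
  contDiff_snd.contMDiff.comp (contMDiff_subtype_val.comp contMDiff_fst)

theorem tCoord_pos (p : Ambient δ M) : 0 < tCoord p := p.1.2.1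

theorem abs_rCoord_lt (p : Ambient δ M) : |rCoord p| < δ := p.1.2.2

theorem mvfderiv_tCoord (p : Ambient δ M) (v : TangentSpace (ambientModel n) p) :
    mvfderiv (ambientModel n) (tCoord : Ambient δ M → ℝ) p v = v.1.1 := by
  have h : HasMFDerivAt 𝓘(ℝ, ℝ × ℝ) 𝓘(ℝ, ℝ) (Prod.fst : ℝ × ℝ → ℝ) (p.1 : ℝ × ℝ)
    (ContinuousLinearMap.fst ℝ ℝ ℝ) := (ContinuousLinearMap.fst ℝ ℝ ℝ).hasMFDerivAt
  exact congr($((h.comp p (hasMFDerivAt_stripCoord p)).mfderiv) v)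

theorem mvfderiv_rCoord (p : Ambient δ M) (v : TangentSpace (ambientModel n) p) :
    mvfderiv (ambientModel n) (rCoord : Ambient δ M → ℝ) p v = v.1.2 := by
  have h : HasMFDerivAt 𝓘(ℝ, ℝ × ℝ) 𝓘(ℝ, ℝ) (Prod.snd : ℝ × ℝ → ℝ) (p.1 : ℝ × ℝ)
    (ContinuousLinearMap.snd ℝ ℝ ℝ) := (ContinuousLinearMap.snd ℝ ℝ ℝ).hasMFDerivAt
  exact congr($((h.comp p (hasMFDerivAt_stripCoord p)).mfderiv) v)

theorem mfderiv_snd_apply (p : Ambient δ M) (v : TangentSpace (ambientModel n) p) :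
    mfderiv (ambientModel n) (𝓡 n) (Prod.snd : Ambient δ M → M) p v = v.2 := by
  rw [mfderiv_snd]; rfl

/-- The differential of `t`. -/
def dt (p : Ambient δ M) : TangentSpace (ambientModel n) p →L[ℝ] ℝ :=
  mvfderiv (ambientModel n) (tCoord : Ambient δ M → ℝ) p

/-- The differential of `r`. -/
def dr (p : Ambient δ M) : TangentSpace (ambientModel n) p →L[ℝ] ℝ :=
  mvfderiv (ambientModel n) (rCoord : Ambient δ M → ℝ) p

/-- The differential of the projection `B × M → M`. -/
def dproj (p : Ambient δ M) : TangentSpace (ambientModel n) p →L[ℝ] TangentSpace (𝓡 n) p.2 :=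
  mfderiv (ambientModel n) (𝓡 n) (Prod.snd : Ambient δ M → M) p

/-- The tangent vector `a ∂_t + b ∂_r + w`. -/
def ambientVector (p : Ambient δ M) (a b : ℝ) (w : TangentSpace (𝓡 n) p.2) :
    TangentSpace (ambientModel n) p :=
  (((a, b), w) : (ℝ × ℝ) × EuclideanSpace ℝ (Fin n))

@[simp] theorem dt_ambientVector (p : Ambient δ M) (a b : ℝ) (w : TangentSpace (𝓡 n) p.2) :
    dt p (ambientVector p a b w) = a := mvfderiv_tCoord p _

@[simp] theorem dr_ambientVector (p : Ambient δ M) (a b : ℝ) (w : TangentSpace (𝓡 n) p.2) :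
    dr p (ambientVector p a b w) = b := mvfderiv_rCoord p _

@[simp] theorem dproj_ambientVector (p : Ambient δ M) (a b : ℝ) (w : TangentSpace (𝓡 n) p.2) :
    dproj p (ambientVector p a b w) = w := mfderiv_snd_apply p _

theorem ambientVector_ext {p : Ambient δ M} {v w : TangentSpace (ambientModel n) p}
    (ht : dt p v = dt p w) (hr : dr p v = dr p w) (hπ : dproj p v = dproj p w) : v = w := by
  rw [dt, mvfderiv_tCoord, mvfderiv_tCoord] at ht
  rw [dr, mvfderiv_rCoord, mvfderiv_rCoord] at hr
  rw [dproj, mfderiv_snd_apply, mfderiv_snd_apply] at hπ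
  exact Prod.ext (Prod.ext ht hr) hπ

/-- The inclusion of the tangent space of `M` in that of `B × M`. -/
def inclusion (p : Ambient δ M) : TangentSpace (𝓡 n) p.2 →L[ℝ] TangentSpace (ambientModel n) p :=
  mfderiv (𝓡 n) (ambientModel n) (fun y : M ↦ ((p.1, y) : Ambient δ M)) p.2

theorem inclusion_eq (p : Ambient δ M) (w : TangentSpace (𝓡 n) p.2) :
    inclusion p w = ambientVector p 0 0 w := by
  have := mfderiv_prod_right (I := 𝓘(ℝ, ℝ × ℝ)) (I' := 𝓡 n) (x₀ := p.1) (y₀ := p.2)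
  rw [inclusion, this]; rfl

@[simp] theorem dt_inclusion (p : Ambient δ M) (w : TangentSpace (𝓡 n) p.2) :
    dt p (inclusion p w) = 0 := by rw [inclusion_eq, dt_ambientVector]

@[simp] theorem dr_inclusion (p : Ambient δ M) (w : TangentSpace (𝓡 n) p.2) :
    dr p (inclusion p w) = 0 := by rw [inclusion_eq, dr_ambientVector]

@[simp] theorem dproj_inclusion (p : Ambient δ M) (w : TangentSpace (𝓡 n) p.2) :
    dproj p (inclusion p w) = w := by rw [inclusion_eq, dproj_ambientVector]

theorem lift_apply (X : Π x : M, TangentSpace (𝓡 n) x) (p : Ambient δ M) :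
    lift X p = inclusion p (X p.2) := rfl

@[simp] theorem dt_partialT (p : Ambient δ M) : dt p (partialT (n := n) p) = 1 :=
  dt_ambientVector p 1 0 0

@[simp] theorem dr_partialT (p : Ambient δ M) : dr p (partialT (n := n) p) = 0 :=
  dr_ambientVector p 1 0 0

@[simp] theorem dproj_partialT (p : Ambient δ M) : dproj p (partialT (n := n) p) = 0 :=
  dproj_ambientVector p 1 0 0

/-- The field `∂_r`. -/
def partialR (p : Ambient δ M) : TangentSpace (ambientModel n) p := ambientVector p 0 1 0

@[simp] theorem dt_partialR (p : Ambient δ M) : dt p (partialR (n := n) p) = 0 :=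
  dt_ambientVector p 0 1 0

@[simp] theorem dr_partialR (p : Ambient δ M) : dr p (partialR (n := n) p) = 1 :=
  dr_ambientVector p 0 1 0

@[simp] theorem dproj_partialR (p : Ambient δ M) : dproj p (partialR (n := n) p) = 0 :=
  dproj_ambientVector p 0 1 0

theorem eq_add_inclusion (p : Ambient δ M) (v : TangentSpace (ambientModel n) p) :
    v = dt p v • partialT p + dr p v • partialR p + inclusion p (dproj p v) :=
  ambientVector_ext (by simp) (by simp) (by simp)

/-- The field `t ∂_t`. -/
def eulerField (p : Ambient δ M) : TangentSpace (ambientModel n) p := tCoord p • partialT p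

@[simp] theorem dt_eulerField (p : Ambient δ M) : dt p (eulerField (n := n) p) = tCoord p := by
  simp [eulerField]

@[simp] theorem dr_eulerField (p : Ambient δ M) : dr p (eulerField (n := n) p) = 0 := by
  simp [eulerField]

@[simp] theorem dproj_eulerField (p : Ambient δ M) : dproj p (eulerField (n := n) p) = 0 := by
  simp [eulerField]

/-- A field on `B × M` given by its components is smooth if its components are. -/
theorem isSmoothField_ambientVector {a b : Ambient δ M → ℝ}
    {X : Π p : Ambient δ M, TangentSpace (𝓡 n) p.2}
    (ha : ContMDiff (ambientModel n) 𝓘(ℝ, ℝ) ∞ a) (hb : ContMDiff (ambientModel n) 𝓘(ℝ, ℝ) ∞ b)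
    (hX : ContMDiff (ambientModel n) (𝓡 n).tangent ∞
      (fun p : Ambient δ M ↦ (⟨p.2, X p⟩ : TangentBundle (𝓡 n) M))) :
    IsSmoothField (ambientModel n) (fun p ↦ ambientVector p (a p) (b p) (X p)) := by
  have h1 : ContMDiff (ambientModel n) (𝓘(ℝ, ℝ × ℝ)).tangent ∞
      (fun p : Ambient δ M ↦ (⟨p.1, (a p, b p)⟩ : TangentBundle 𝓘(ℝ, ℝ × ℝ) (strip δ))) := by
    intro p
    rw [contMDiffAt_totalSpace]
    refine ⟨contMDiff_fst p,
      ((ha.prodMk_space hb) p).congr_of_eventuallyEq (.of_forall fun q ↦ ?_)⟩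
    exact opens_trivializationAt_snd p.1 _
  exact (contMDiff_equivTangentBundleProd_symm (I := 𝓘(ℝ, ℝ × ℝ)) (I' := 𝓡 n)).comp
    (h1.prodMk hX)

theorem isSmoothField_of_components {V : Π p : Ambient δ M, TangentSpace (ambientModel n) p}
    (ht : ContMDiff (ambientModel n) 𝓘(ℝ, ℝ) ∞ (fun p ↦ dt p (V p)))
    (hr : ContMDiff (ambientModel n) 𝓘(ℝ, ℝ) ∞ (fun p ↦ dr p (V p)))
    (hπ : ContMDiff (ambientModel n) (𝓡 n).tangent ∞
      (fun p : Ambient δ M ↦ (⟨p.2, dproj p (V p)⟩ : TangentBundle (𝓡 n) M))) :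
    IsSmoothField (ambientModel n) V := by
  have : V = fun p ↦ ambientVector p (dt p (V p)) (dr p (V p)) (dproj p (V p)) :=
    funext fun p ↦ ambientVector_ext (by simp) (by simp) (by simp)
  rw [this]
  exact isSmoothField_ambientVector ht hr hπ

theorem contMDiff_zero_snd : ContMDiff (ambientModel n) (𝓡 n).tangent ∞
    (fun p : Ambient δ M ↦ (⟨p.2, 0⟩ : TangentBundle (𝓡 n) M)) :=
  (contMDiff_zeroSection ℝ (TangentSpace (𝓡 n) : M → Type _)).comp contMDiff_snd

theorem isSmoothField_eulerField :
    IsSmoothField (ambientModel n) (eulerField (n := n) (δ := δ) (M := M)) := by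
  refine isSmoothField_of_components ?_ ?_ ?_
  · simpa using contMDiff_tCoord
  · simpa using contMDiff_const
  · simpa using contMDiff_zero_snd

theorem isSmoothField_partialR :
    IsSmoothField (ambientModel n) (partialR (n := n) (δ := δ) (M := M)) :=
  isSmoothField_ambientVector contMDiff_const contMDiff_const contMDiff_zero_snd

theorem isSmoothField_lift {X : Π x : M, TangentSpace (𝓡 n) x} (hX : IsSmoothField (𝓡 n) X) :
    IsSmoothField (ambientModel n) (lift (δ := δ) X) := by
  refine isSmoothField_of_components ?_ ?_ ?_
  · simpa [lift_apply] using contMDiff_const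
  · simpa [lift_apply] using contMDiff_const
  · simp only [lift_apply, dproj_inclusion]
    exact ContMDiff.comp (g := fun x ↦ (⟨x, X x⟩ : TangentBundle (𝓡 n) M)) hX contMDiff_snd

end Ambient

/-! ### The ambient metric is pseudo-Riemannian -/

section AmbientMetric

variable {n : ℕ} {M : Type*} [TopologicalSpace M] [ChartedSpace (EuclideanSpace ℝ (Fin n)) M]
  [IsManifold (𝓡 n) ∞ M] {g : Metric n M}
  {γ : ℝ → Π x : M, TangentSpace (𝓡 n) x →L[ℝ] TangentSpace (𝓡 n) x} {δ : ℝ}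

theorem ambientMetric_apply (p : Ambient δ M) (v w : TangentSpace (ambientModel n) p) :
    ambientMetric g γ δ p v w =
      (rCoord p * dt p v + tCoord p * dr p v) * dt p w
        + dt p v * (rCoord p * dt p w + tCoord p * dr p w)
        + tCoord p ^ 2 * g.inner p.2 (γ (rCoord p) p.2 (dproj p v)) (dproj p w) := by
  have n0 : (∞ : WithTop ℕ∞) ≠ 0 := by simp
  have h (v : TangentSpace (ambientModel n) p) :
      mvfderiv (ambientModel n) (fun q : Ambient δ M ↦ rCoord q * tCoord q) p v =
        rCoord p * dt p v + tCoord p * dr p v := by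
    rw [mvfderiv_fun_mul (contMDiff_rCoord.mdifferentiableAt n0)
      (contMDiff_tCoord.mdifferentiableAt n0)]
    rfl
  rw [ambientMetric, LinearMap.mk₂_apply, h, h]
  rfl

theorem IsAdmissible.inner_symm (hγ : IsAdmissible g γ) (r : ℝ) (x : M)
    (v w : TangentSpace (𝓡 n) x) :
    g.inner x (γ r x v) w = g.inner x (γ r x w) v := by
  rw [hγ.selfAdjoint g ⟨0, contMDiff_const, by simp⟩, g.symm]

theorem ambientMetric_symm (hγ : IsAdmissible g γ) (p : Ambient δ M)
    (v w : TangentSpace (ambientModel n) p) :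
    ambientMetric g γ δ p v w = ambientMetric g γ δ p w v := by
  rw [ambientMetric_apply, ambientMetric_apply, hγ.inner_symm]
  ring

/-- Pairing with `∂_r` detects `dt v`; then pairing with `∂_t` detects `dr v`. Pairing with `γ(r)`
applied to the `TM`-part gives the `g`-square of that vector times `t²`, and injectivity of `γ(r)`
for `|r| < δ` finishes. -/
theorem ambientMetric_nondegenerate (hγδ : IsNonsingularBelow γ δ) (p : Ambient δ M)
    (v : TangentSpace (ambientModel n) p) (h : ∀ w, ambientMetric g γ δ p v w = 0) : v = 0 := by
  have ht := (tCoord_pos p).ne'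
  have h1 : dt p v = 0 := by
    have := h (partialR p)
    rw [ambientMetric_apply] at this
    simpa [ht] using this
  have h2 : dr p v = 0 := by
    have := h (partialT p)
    rw [ambientMetric_apply] at this
    simpa [ht, h1] using this
  have h3 : γ (rCoord p) p.2 (dproj p v) = 0 := by
    by_contra hne
    have := h (inclusion p (γ (rCoord p) p.2 (dproj p v)))
    rw [ambientMetric_apply] at this
    refine (g.pos _ _ hne).ne' ?_
    simpa [ht, h1] using this
  have h4 : dproj p v = 0 := (hγδ _ (abs_rCoord_lt p) p.2).1 (h3.trans (map_zero _).symm)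
  exact ambientVector_ext (h1.trans (map_zero _).symm) (h2.trans (map_zero _).symm)
    (h4.trans (map_zero _).symm)

theorem contMDiff_inner_snd : ContMDiff (ambientModel n)
    ((𝓡 n).prod 𝓘(ℝ, EuclideanSpace ℝ (Fin n) →L[ℝ] EuclideanSpace ℝ (Fin n) →L[ℝ] ℝ)) ∞
    (fun q : Ambient δ M ↦ TotalSpace.mk'
      (EuclideanSpace ℝ (Fin n) →L[ℝ] EuclideanSpace ℝ (Fin n) →L[ℝ] ℝ)
      (E := fun x : M ↦ TangentSpace (𝓡 n) x →L[ℝ] TangentSpace (𝓡 n) x →L[ℝ] ℝ)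
      q.2 (g.inner q.2)) :=
  g.contMDiff.comp contMDiff_snd

theorem IsAdmissible.contMDiff_snd (hγ : IsAdmissible g γ) : ContMDiff (ambientModel n)
    ((𝓡 n).prod 𝓘(ℝ, EuclideanSpace ℝ (Fin n) →L[ℝ] EuclideanSpace ℝ (Fin n))) ∞
    (fun q : Ambient δ M ↦ TotalSpace.mk'
      (EuclideanSpace ℝ (Fin n) →L[ℝ] EuclideanSpace ℝ (Fin n))
      (E := fun x : M ↦ TangentSpace (𝓡 n) x →L[ℝ] TangentSpace (𝓡 n) x)
      q.2 (γ (rCoord q) q.2)) :=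
  hγ.smooth.comp (contMDiff_rCoord.prodMk _root_.contMDiff_snd)

theorem isPseudoMetric_ambientMetric (hγ : IsAdmissible g γ) (hγδ : IsNonsingularBelow γ δ) :
    IsPseudoMetric (ambientMetric g γ δ) where
  symm := ambientMetric_symm hγ
  nondegenerate := ambientMetric_nondegenerate hγδ
  smooth X Y hX hY := by
    have hπ : ContMDiff (ambientModel n).tangent (𝓡 n).tangent ∞
      (tangentMap (ambientModel n) (𝓡 n) (Prod.snd : Ambient δ M → M)) :=
      ContMDiff.contMDiff_tangentMap (n := ∞) contMDiff_snd (by simp)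
    have h : ContMDiff (ambientModel n) ((𝓡 n).prod 𝓘(ℝ, ℝ)) ∞ (fun q : Ambient δ M ↦
        TotalSpace.mk' ℝ (E := Bundle.Trivial M ℝ) q.2
          (g.inner q.2 (γ (rCoord q) q.2 (dproj q (X q))) (dproj q (Y q)))) :=
      contMDiff_inner_snd.clm_bundle_apply₂
        (hγ.contMDiff_snd.clm_bundle_apply (hπ.comp hX)) (hπ.comp hY)
    have h' : ContMDiff (ambientModel n) 𝓘(ℝ, ℝ) ∞ (fun q : Ambient δ M ↦
        g.inner q.2 (γ (rCoord q) q.2 (dproj q (X q))) (dproj q (Y q))) :=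
      fun q ↦ (contMDiffAt_totalSpace.1 (h q)).2
    have ht {X : Π p : Ambient δ M, TangentSpace (ambientModel n) p}
      (hX : IsSmoothField (ambientModel n) X) := contMDiff_mvfderiv_apply contMDiff_tCoord hX
    have hrt {X : Π p : Ambient δ M, TangentSpace (ambientModel n) p}
      (hX : IsSmoothField (ambientModel n) X) :=
      contMDiff_mvfderiv_apply (contMDiff_rCoord.mul contMDiff_tCoord) hX
    exact (((hrt hX).mul (ht hY)).add ((ht hX).mul (hrt hY))).add
      ((contMDiff_tCoord.pow 2).mul h')
  mdifferentiableAt X Y p hX hY := by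
    have n0 : (∞ : WithTop ℕ∞) ≠ 0 := by simp
    have hπ : ContMDiff (ambientModel n).tangent (𝓡 n).tangent ∞
      (tangentMap (ambientModel n) (𝓡 n) (Prod.snd : Ambient δ M → M)) :=
      ContMDiff.contMDiff_tangentMap (n := ∞) contMDiff_snd (by simp)
    have hπ' {X : Π p : Ambient δ M, TangentSpace (ambientModel n) p}
        (hX : IsDiffFieldAt (ambientModel n) X p) :
        MDifferentiableAt (ambientModel n) (𝓡 n).tangent
          (fun q ↦ (⟨q.2, dproj q (X q)⟩ : TangentBundle (𝓡 n) M)) p :=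
      (hπ.mdifferentiableAt n0).comp p hX
    have h : MDifferentiableAt (ambientModel n) ((𝓡 n).prod 𝓘(ℝ, ℝ)) (fun q : Ambient δ M ↦
        TotalSpace.mk' ℝ (E := Bundle.Trivial M ℝ) q.2
          (g.inner q.2 (γ (rCoord q) q.2 (dproj q (X q))) (dproj q (Y q)))) p :=
      (contMDiff_inner_snd.mdifferentiableAt n0).clm_bundle_apply₂
        ((hγ.contMDiff_snd.mdifferentiableAt n0).clm_bundle_apply (hπ' hX)) (hπ' hY)
    have h' : MDifferentiableAt (ambientModel n) 𝓘(ℝ, ℝ) (fun q : Ambient δ M ↦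
        g.inner q.2 (γ (rCoord q) q.2 (dproj q (X q))) (dproj q (Y q))) p :=
      ((mdifferentiableAt_totalSpace ..).1 h).2
    have ht {X : Π p : Ambient δ M, TangentSpace (ambientModel n) p}
      (hX : IsDiffFieldAt (ambientModel n) X p) :=
      mdifferentiableAt_mvfderiv_apply contMDiff_tCoord hX
    have hrt {X : Π p : Ambient δ M, TangentSpace (ambientModel n) p}
      (hX : IsDiffFieldAt (ambientModel n) X p) :=
      mdifferentiableAt_mvfderiv_apply (contMDiff_rCoord.mul contMDiff_tCoord) hX
    exact (((hrt hX).mul (ht hY)).add ((ht hX).mul (hrt hY))).add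
      (((contMDiff_tCoord.mdifferentiableAt n0).pow 2).mul h')

end AmbientMetric

/-! ### The flow of `t ∂_t` -/

section EulerFlow

variable {n : ℕ} {M : Type*} [TopologicalSpace M] [ChartedSpace (EuclideanSpace ℝ (Fin n)) M]
  [IsManifold (𝓡 n) ∞ M] {δ : ℝ}

/-- The flow of `t ∂_t`. -/
def eulerFlow (p : Ambient δ M) (τ : ℝ) : Ambient δ M :=
  (⟨(Real.exp τ * tCoord p, rCoord p), mul_pos (Real.exp_pos τ) (tCoord_pos p), abs_rCoord_lt p⟩,
    p.2)

theorem eulerFlow_zero (p : Ambient δ M) : eulerFlow p 0 = p := by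
  refine Prod.ext (Subtype.ext (Prod.ext ?_ rfl)) rfl
  simp [eulerFlow, tCoord]

theorem contMDiff_eulerFlow (p : Ambient δ M) :
    ContMDiff 𝓘(ℝ, ℝ) (ambientModel n) ∞ (eulerFlow p) := by
  refine ContMDiff.prodMk ?_ contMDiff_const
  rw [← ContMDiff.subtypeVal_comp_iff]
  exact ((Real.contDiff_exp.mul contDiff_const).prodMk contDiff_const).contMDiff

theorem mvfderiv_comp_eulerFlow (p : Ambient δ M) {φ : Ambient δ M → ℝ} {τ : ℝ}
    (hφ : MDifferentiableAt (ambientModel n) 𝓘(ℝ, ℝ) φ (eulerFlow p τ)) :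
    mvfderiv (ambientModel n) φ (eulerFlow p τ)
      (mfderiv 𝓘(ℝ, ℝ) (ambientModel n) (eulerFlow p) τ (1 : ℝ)) =
        deriv (fun τ ↦ φ (eulerFlow p τ)) τ := by
  have hc := (contMDiff_eulerFlow (n := n) p).mdifferentiableAt (x := τ) (by simp)
  have h := congr($(mfderiv_comp τ hφ hc) (1 : ℝ))
  rw [mfderiv_eq_fderiv] at h
  exact h.symm

theorem mfderiv_eulerFlow (p : Ambient δ M) (τ : ℝ) :
    mfderiv 𝓘(ℝ, ℝ) (ambientModel n) (eulerFlow p) τ (1 : ℝ) = eulerField (eulerFlow p τ) := by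
  have n0 : (∞ : WithTop ℕ∞) ≠ 0 := by simp
  have hc := (contMDiff_eulerFlow (n := n) p).mdifferentiableAt (x := τ) n0
  refine ambientVector_ext ?_ ?_ ?_
  · refine (mvfderiv_comp_eulerFlow p (contMDiff_tCoord.mdifferentiableAt n0)).trans ?_
    rw [dt_eulerField]
    change deriv (fun τ ↦ Real.exp τ * tCoord p) τ = Real.exp τ * tCoord p
    simp
  · refine (mvfderiv_comp_eulerFlow p (contMDiff_rCoord.mdifferentiableAt n0)).trans ?_
    rw [dr_eulerField]
    exact deriv_const τ (rCoord p)
  · rw [dproj_eulerField]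
    have h := congr($(mfderiv_comp τ (mdifferentiableAt_snd (I := 𝓘(ℝ, ℝ × ℝ)) (I' := 𝓡 n)) hc) (1 : ℝ))
    refine h.symm.trans ?_
    exact congr($(mfderiv_const (I := 𝓘(ℝ, ℝ)) (I' := 𝓡 n) (c := p.2)) (1 : ℝ))

/-- Turns derivatives in the direction `T` into ordinary derivatives in the flow parameter, so that
homogeneity in `t` can be exploited. -/
theorem mvfderiv_eulerField (p : Ambient δ M) {φ : Ambient δ M → ℝ} {τ : ℝ}
    (hφ : MDifferentiableAt (ambientModel n) 𝓘(ℝ, ℝ) φ (eulerFlow p τ)) :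
    mvfderiv (ambientModel n) φ (eulerFlow p τ) (eulerField (eulerFlow p τ)) =
      deriv (fun τ ↦ φ (eulerFlow p τ)) τ := by
  rw [← mfderiv_eulerFlow, mvfderiv_comp_eulerFlow p hφ]

end EulerFlow

/-! ### Fields commuting with `t ∂_t`, and `∇(t ∂_t) = Id` -/

section HomogeneousFields

variable {n : ℕ} {M : Type*} [TopologicalSpace M] [ChartedSpace (EuclideanSpace ℝ (Fin n)) M]
  [IsManifold (𝓡 n) ∞ M] {δ : ℝ}

/-- The field `a t ∂_t + b ∂_r + X`, where `X` is the lift of a vector field on `M`. -/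
def homogeneousField (a b : ℝ) (X : Π x : M, TangentSpace (𝓡 n) x) (p : Ambient δ M) :
    TangentSpace (ambientModel n) p :=
  a • eulerField p + b • partialR p + lift X p

variable {a b a' b' : ℝ} {X X' : Π x : M, TangentSpace (𝓡 n) x} {p : Ambient δ M}

@[simp] theorem dt_homogeneousField : dt p (homogeneousField a b X p) = a * tCoord p := by
  simp [homogeneousField, lift_apply]

@[simp] theorem dr_homogeneousField : dr p (homogeneousField a b X p) = b := by
  simp [homogeneousField, lift_apply]

@[simp] theorem dproj_homogeneousField : dproj p (homogeneousField a b X p) = X p.2 := by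
  simp [homogeneousField, lift_apply]

theorem isSmoothField_homogeneousField (hX : IsSmoothField (𝓡 n) X) :
    IsSmoothField (ambientModel n) (homogeneousField (δ := δ) a b X) := by
  refine isSmoothField_of_components ?_ ?_ ?_
  · simp only [dt_homogeneousField]
    exact contMDiff_const.mul contMDiff_tCoord
  · simpa using contMDiff_const
  · simp only [dproj_homogeneousField]
    exact ContMDiff.comp (g := fun x ↦ (⟨x, X x⟩ : TangentBundle (𝓡 n) M)) hX contMDiff_snd

theorem isSmoothField_zero : IsSmoothField (𝓡 n) (fun x : M ↦ (0 : TangentSpace (𝓡 n) x)) :=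
  contMDiff_zeroSection ℝ (TangentSpace (𝓡 n) : M → Type _)

theorem eulerField_eq_homogeneousField :
    eulerField (n := n) (δ := δ) (M := M) = homogeneousField 1 0 (fun _ ↦ 0) :=
  funext fun p ↦ ambientVector_ext (by simp) (by simp) (by simp)

variable [T2Space M]

/-- `t ∂_t`, `∂_r` and lifts commute mutually except for lifts among themselves. The three
components of the bracket are obtained by testing on `t` and `r` and by relatedness under the
projection to `M`. -/
theorem mlieBracket_homogeneousField (hX : IsSmoothField (𝓡 n) X) (hX' : IsSmoothField (𝓡 n) X') :
    mlieBracket (ambientModel n) (homogeneousField a b X) (homogeneousField a' b' X') p =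
      lift (mlieBracket (𝓡 n) X X') p := by
  have hV := isSmoothField_homogeneousField (δ := δ) (a := a) (b := b) hX
  have hV' := isSmoothField_homogeneousField (δ := δ) (a := a') (b := b') hX'
  have n0 : (∞ : WithTop ℕ∞) ≠ 0 := by simp
  have h (c : ℝ) (v : TangentSpace (ambientModel n) p) :
      mvfderiv (ambientModel n) (fun q : Ambient δ M ↦ c * tCoord q) p v = c * dt p v := by
    rw [mvfderiv_fun_mul mdifferentiableAt_const (contMDiff_tCoord.mdifferentiableAt n0),
      mvfderiv_const]
    simp [dt]
  refine ambientVector_ext ?_ ?_ ?_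
  · refine (mvfderiv_mlieBracket hV hV' contMDiff_tCoord p).trans ?_
    change mvfderiv (ambientModel n)
        (fun q : Ambient δ M ↦ dt q (homogeneousField a' b' X' q)) p _
      - mvfderiv (ambientModel n) (fun q : Ambient δ M ↦ dt q (homogeneousField a b X q)) p _ = _
    simp only [dt_homogeneousField, h, lift_apply, dt_inclusion]
    ring
  · refine (mvfderiv_mlieBracket hV hV' contMDiff_rCoord p).trans ?_
    change mvfderiv (ambientModel n)
        (fun q : Ambient δ M ↦ dr q (homogeneousField a' b' X' q)) p _
      - mvfderiv (ambientModel n) (fun q : Ambient δ M ↦ dr q (homogeneousField a b X q)) p _ = _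
    simp only [dr_homogeneousField, mvfderiv_const, lift_apply, dr_inclusion]
    simp
  · rw [lift_apply, dproj_inclusion]
    exact mfderiv_mlieBracket_of_related contMDiff_snd hV hV' hX hX'
      (fun _ ↦ dproj_homogeneousField) (fun _ ↦ dproj_homogeneousField) p

theorem mlieBracket_eulerField (hX : IsSmoothField (𝓡 n) X) :
    mlieBracket (ambientModel n) eulerField (homogeneousField a b X) p = 0 := by
  rw [eulerField_eq_homogeneousField, mlieBracket_homogeneousField isSmoothField_zero hX,
    lift_apply]
  have : mlieBracket (𝓡 n) (fun x : M ↦ (0 : TangentSpace (𝓡 n) x)) X = 0 :=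
    mlieBracket_zero_left
  rw [this, Pi.zero_apply, map_zero]

/-- As `t > 0`, these fields take every tangent vector as a value. They are the test fields for the
Koszul formula and supply the hypothesis `hspan` of the general results. -/
theorem exists_homogeneousField (p : Ambient δ M) (v : TangentSpace (ambientModel n) p) :
    ∃ (a b : ℝ) (X : Π x : M, TangentSpace (𝓡 n) x), IsSmoothField (𝓡 n) X ∧
      homogeneousField a b X p = v := by
  obtain ⟨X, hX, hXv⟩ := exists_contMDiff_field p.2 (dproj p v)
  refine ⟨dt p v / tCoord p, dr p v, X, hX, ambientVector_ext ?_ ?_ ?_⟩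
  · rw [dt_homogeneousField, div_mul_cancel₀ _ (tCoord_pos p).ne']
  · simp
  · simpa using hXv

theorem exists_field_commuting_eulerField (p : Ambient δ M) (v : TangentSpace (ambientModel n) p) :
    ∃ V : Π p : Ambient δ M, TangentSpace (ambientModel n) p, IsSmoothField (ambientModel n) V ∧
      (∀ q, mlieBracket (ambientModel n) eulerField V q = 0) ∧ V p = v := by
  obtain ⟨a, b, X, hX, h⟩ := exists_homogeneousField p v
  exact ⟨_, isSmoothField_homogeneousField hX, fun _ ↦ mlieBracket_eulerField hX, h⟩

variable {g : Metric n M} {γ : ℝ → Π x : M, TangentSpace (𝓡 n) x →L[ℝ] TangentSpace (𝓡 n) x}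

/-- The right-hand side is `d(r t²)(v)`: the field `T` is the gradient of `r t²`. -/
theorem ambientMetric_eulerField (p : Ambient δ M) (v : TangentSpace (ambientModel n) p) :
    ambientMetric g γ δ p (eulerField p) v =
      tCoord p * (2 * (rCoord p * dt p v) + tCoord p * dr p v) := by
  rw [ambientMetric_apply]
  simp
  ring

/-- The field `t ∂_t` is a homothetic gradient field. -/
theorem ambientConnection_eulerField (hγ : IsAdmissible g γ) (hγδ : IsNonsingularBelow γ δ)
    (p : Ambient δ M) :
    ambientConnection g γ δ eulerField p = ContinuousLinearMap.id ℝ _ := by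
  have n0 : (∞ : WithTop ℕ∞) ≠ 0 := by simp
  have hg := isPseudoMetric_ambientMetric hγ hγδ
  ext v
  refine sub_eq_zero.1 (hg.nondegenerate p _ fun w ↦ ?_)
  obtain ⟨a, b, X, hX, rfl⟩ := exists_homogeneousField p v
  obtain ⟨a', b', X', hX', rfl⟩ := exists_homogeneousField p w
  have hV := isSmoothField_homogeneousField (δ := δ) (a := a) (b := b) hX
  have hV' := isSmoothField_homogeneousField (δ := δ) (a := a') (b := b') hX'
  have hT := isSmoothField_eulerField (n := n) (M := M) (δ := δ)
  have key := hg.two_mul_leviCivita (hV.mdifferentiableAt n0 (x := p)) (hT.mdifferentiableAt n0)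
    (hV'.mdifferentiableAt n0)
  have hsymm : ∀ q : Ambient δ M, ambientMetric g γ δ q (homogeneousField a b X q) (eulerField q)
      = ambientMetric g γ δ q (eulerField q) (homogeneousField a b X q) := fun q ↦ hg.symm _ _ _
  have hinner (a b : ℝ) (X : Π x : M, TangentSpace (𝓡 n) x) (q : Ambient δ M) :
      ambientMetric g γ δ q (eulerField q) (homogeneousField a b X q)
        = tCoord q * (tCoord q * (2 * a * rCoord q + b)) := by
    rw [ambientMetric_eulerField, dt_homogeneousField, dr_homogeneousField]
    ring
  have hd (a b : ℝ) (v : TangentSpace (ambientModel n) p) :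
      mvfderiv (ambientModel n)
        (fun q : Ambient δ M ↦ tCoord q * (tCoord q * (2 * a * rCoord q + b))) p v =
      2 * tCoord p * (2 * a * rCoord p + b) * dt p v + 2 * a * tCoord p ^ 2 * dr p v := by
    have ht := contMDiff_tCoord.mdifferentiableAt (I := ambientModel n) n0 (x := p)
    have hr := contMDiff_rCoord.mdifferentiableAt (I := ambientModel n) n0 (x := p)
    have hc (c : ℝ) : MDifferentiableAt (ambientModel n) 𝓘(ℝ, ℝ) (fun _ : Ambient δ M ↦ c) p :=
      mdifferentiableAt_const
    have h1 : MDifferentiableAt (ambientModel n) 𝓘(ℝ, ℝ)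
      (fun q : Ambient δ M ↦ 2 * a * rCoord q) p := (hc _).mul hr
    have h2 : MDifferentiableAt (ambientModel n) 𝓘(ℝ, ℝ)
      (fun q : Ambient δ M ↦ 2 * a * rCoord q + b) p := h1.add (hc b)
    have h3 : MDifferentiableAt (ambientModel n) 𝓘(ℝ, ℝ)
      (fun q : Ambient δ M ↦ tCoord q * (2 * a * rCoord q + b)) p := ht.mul h2
    rw [mvfderiv_fun_mul ht h3, mvfderiv_fun_mul ht h2, mvfderiv_fun_add h1 (hc _),
      mvfderiv_fun_mul (hc _) hr, mvfderiv_const, mvfderiv_const]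
    simp [dt, dr]
    ring
  -- Homogeneity: the `∂_t`-components of these fields are proportional to `t` and the others do not
  -- depend on it, so along the flow every term of the metric is multiplied by `e^{2τ}`.
  have hflow : mvfderiv (ambientModel n) (fun q ↦ ambientMetric g γ δ q
      (homogeneousField a' b' X' q) (homogeneousField a b X q)) p (eulerField p) =
      2 * ambientMetric g γ δ p (homogeneousField a b X p) (homogeneousField a' b' X' p) := by
    have h := mvfderiv_eulerField p (τ := 0)
      ((hg.smooth _ _ hV' hV).mdifferentiableAt n0)
    have h1 (τ : ℝ) : ambientMetric g γ δ (eulerFlow p τ)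
        (homogeneousField a' b' X' (eulerFlow p τ)) (homogeneousField a b X (eulerFlow p τ)) =
        Real.exp τ ^ 2 *
          ambientMetric g γ δ p (homogeneousField a b X p) (homogeneousField a' b' X' p) := by
      rw [hg.symm, ambientMetric_apply, ambientMetric_apply]
      simp only [dt_homogeneousField, dr_homogeneousField, dproj_homogeneousField]
      change (rCoord p * (a * (Real.exp τ * tCoord p)) + (Real.exp τ * tCoord p) * b)
          * (a' * (Real.exp τ * tCoord p)) + (a * (Real.exp τ * tCoord p)) *
          (rCoord p * (a' * (Real.exp τ * tCoord p)) + (Real.exp τ * tCoord p) * b')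
          + (Real.exp τ * tCoord p) ^ 2 * g.inner p.2 (γ (rCoord p) p.2 (X p.2)) (X' p.2) = _
      ring
    simp only [h1] at h
    rw [eulerFlow_zero] at h
    rw [h]
    simp
  have hbr : mlieBracket (ambientModel n) (homogeneousField a b X) eulerField p = 0 := by
    rw [mlieBracket_swap_apply, mlieBracket_eulerField hX, neg_zero]
  -- Two brackets with `T` vanish. With `α = g̃(T, ·)`, the terms `V α(V') - V' α(V) - α([V,V'])`
  -- add up to `dα(V,V') = 0`, and the derivative along `T` leaves `2 g̃(V,V')`.
  rw [koszul, hbr, mlieBracket_eulerField hX', mlieBracket_homogeneousField hX hX', hflow,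
    hg.symm p (lift _ p), ambientMetric_eulerField] at key
  simp only [hsymm, hinner, hd, lift_apply, dt_inclusion, dr_inclusion, dt_homogeneousField,
    dr_homogeneousField, map_zero, LinearMap.zero_apply] at key
  rw [map_sub, LinearMap.sub_apply, ContinuousLinearMap.id_apply]
  change ambientMetric g γ δ p (leviCivita (ambientModel n) (ambientMetric g γ δ) eulerField p _) _
    - _ = 0
  linarith

end HomogeneousFields

/-! ### Curvature and Ricci tensor of the ambient metric -/

section AmbientCurvature

variable {n : ℕ} {M : Type*} [TopologicalSpace M] [ChartedSpace (EuclideanSpace ℝ (Fin n)) M]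
  [IsManifold (𝓡 n) ∞ M] [T2Space M] {δ : ℝ}
  {g : Metric n M} {γ : ℝ → Π x : M, TangentSpace (𝓡 n) x →L[ℝ] TangentSpace (𝓡 n) x}

/-- A field which commutes with `t ∂_t` has constant projection along the flow. -/
theorem dproj_eulerFlow {V : Π p : Ambient δ M, TangentSpace (ambientModel n) p}
    (hV : IsSmoothField (ambientModel n) V)
    (hTV : ∀ q, mlieBracket (ambientModel n) eulerField V q = 0) (p : Ambient δ M) (τ : ℝ) :
    (dproj (eulerFlow p τ) (V (eulerFlow p τ)) : TangentSpace (𝓡 n) p.2) = dproj p (V p) := by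
  have n0 : (∞ : WithTop ℕ∞) ≠ 0 := by simp
  refine tangent_ext fun φ hφ ↦ ?_
  have hφπ : ContMDiff (ambientModel n) 𝓘(ℝ, ℝ) ∞ (fun q : Ambient δ M ↦ φ q.2) :=
    hφ.comp contMDiff_snd
  have hcomp (q : Ambient δ M) (v : TangentSpace (ambientModel n) q) :
      mvfderiv (ambientModel n) (fun q : Ambient δ M ↦ φ q.2) q v =
        mvfderiv (𝓡 n) φ q.2 (dproj q v) :=
    congr($(mfderiv_comp q (hφ.mdifferentiableAt n0) (mdifferentiableAt_snd
      (I := 𝓘(ℝ, ℝ × ℝ)) (I' := 𝓡 n))) v)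
  have hT : (fun q : Ambient δ M ↦ mvfderiv (ambientModel n) (fun q : Ambient δ M ↦ φ q.2) q
      (eulerField q)) = fun _ ↦ 0 := by
    ext q
    rw [hcomp, dproj_eulerField, map_zero]
  let ψ : Ambient δ M → ℝ := fun q ↦
    mvfderiv (ambientModel n) (fun q : Ambient δ M ↦ φ q.2) q (V q)
  have hψ : ContMDiff (ambientModel n) 𝓘(ℝ, ℝ) ∞ ψ := contMDiff_mvfderiv_apply hφπ hV
  -- `T(V(φ ∘ π)) = [T,V](φ ∘ π) + V(T(φ ∘ π))`, and both terms vanish: `T` commutes with `V` and is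
  -- vertical for the projection `π` to `M`.
  have hTψ (q : Ambient δ M) : mvfderiv (ambientModel n) ψ q (eulerField q) = 0 := by
    have := mvfderiv_mlieBracket isSmoothField_eulerField hV hφπ q
    rw [hTV, hT, mvfderiv_const, map_zero] at this
    simpa using this.symm
  have hd (τ : ℝ) : HasDerivAt (fun τ ↦ ψ (eulerFlow p τ)) 0 τ := by
    have h1 : MDifferentiableAt 𝓘(ℝ, ℝ) 𝓘(ℝ, ℝ) (fun τ ↦ ψ (eulerFlow p τ)) τ :=
      (hψ.comp (contMDiff_eulerFlow p)).mdifferentiableAt n0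
    have h2 := h1.differentiableAt.hasDerivAt
    rwa [← mvfderiv_eulerField p (hψ.mdifferentiableAt n0), hTψ] at h2
  have hconst := is_const_of_deriv_eq_zero (fun τ ↦ (hd τ).differentiableAt)
    (fun τ ↦ (hd τ).deriv) τ 0
  rw [eulerFlow_zero] at hconst
  simp only [ψ, hcomp] at hconst
  exact hconst

/-- At `r = 0` the orthogonal complement of `T` is therefore `ker dr`. -/
theorem inner_eulerField_of_rCoord_eq_zero {p : Ambient δ M} (hp : rCoord p = 0)
    (v : TangentSpace (ambientModel n) p) :
    ambientMetric g γ δ p (eulerField p) v = tCoord p ^ 2 * dr p v := by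
  rw [ambientMetric_eulerField, hp]
  ring

variable (hγ : IsAdmissible g γ) (hγδ : IsNonsingularBelow γ δ)

/-- The curvature tensor of the ambient metric. -/
def ambientCurvature (p : Ambient δ M) :=
  (isPseudoMetric_ambientMetric hγ hγδ).curvatureTensor p

theorem ambientCurvature_swap {p : Ambient δ M} (u v w : TangentSpace (ambientModel n) p) :
    ambientCurvature hγ hγδ p u v w = - ambientCurvature hγ hγδ p v u w :=
  (isPseudoMetric_ambientMetric hγ hγδ).curvatureTensor_swap u v w

theorem ambientCurvature_eulerField {p : Ambient δ M} (v w : TangentSpace (ambientModel n) p) :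
    ambientCurvature hγ hγδ p (eulerField p) v w = 0 :=
  (isPseudoMetric_ambientMetric hγ hγδ).curvatureTensor_left_homothety isSmoothField_eulerField
    (ambientConnection_eulerField hγ hγδ) exists_field_commuting_eulerField v w

theorem ambientCurvature_eulerField_middle {p : Ambient δ M}
    (v w : TangentSpace (ambientModel n) p) :
    ambientCurvature hγ hγδ p v (eulerField p) w = 0 := by
  rw [ambientCurvature_swap, ambientCurvature_eulerField, neg_zero]

theorem ambientCurvature_eulerField_right {p : Ambient δ M}
    (v w : TangentSpace (ambientModel n) p) :
    ambientCurvature hγ hγδ p v w (eulerField p) = 0 :=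
  (isPseudoMetric_ambientMetric hγ hγδ).curvatureTensor_right_homothety isSmoothField_eulerField
    (ambientConnection_eulerField hγ hγδ) v w

/-- Used to discard the component `du(v) T` of `dΨ^u(v)`. -/
theorem ambientCurvature_add_smul_eulerField {p : Ambient δ M}
    (v w z : TangentSpace (ambientModel n) p) (a b : ℝ) :
    ambientCurvature hγ hγδ p (v + a • eulerField p) (w + b • eulerField p) z =
      ambientCurvature hγ hγδ p v w z := by
  simp only [map_add, map_smul, LinearMap.add_apply, LinearMap.smul_apply,
    ambientCurvature_eulerField, ambientCurvature_eulerField_middle, smul_zero, add_zero]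

theorem ambientCurvature_smul_add_smul_eulerField {p : Ambient δ M}
    (v w z : TangentSpace (ambientModel n) p) (a b : ℝ) :
    ambientCurvature hγ hγδ p v w (a • z + b • eulerField p) =
      a • ambientCurvature hγ hγδ p v w z := by
  rw [map_add, map_smul, map_smul, ambientCurvature_eulerField_right, smul_zero, add_zero]

/-- The values of the curvature are orthogonal to `T`, hence have no `∂_r`-component at `r = 0`. -/
theorem dr_ambientCurvature {p : Ambient δ M} (hp : rCoord p = 0)
    (u v w : TangentSpace (ambientModel n) p) : dr p (ambientCurvature hγ hγδ p u v w) = 0 := by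
  have h := (isPseudoMetric_ambientMetric hγ hγδ).inner_curvatureTensor_homothety
    isSmoothField_eulerField (ambientConnection_eulerField hγ hγδ) u v w
  rw [(isPseudoMetric_ambientMetric hγ hγδ).symm, inner_eulerField_of_rCoord_eq_zero hp] at h
  exact (mul_eq_zero.1 h).resolve_left (pow_ne_zero 2 (tCoord_pos p).ne')

/-- The `TM`-component of the curvature tensor of the ambient metric. -/
def tangentialCurvature (p : Ambient δ M) : TangentSpace (𝓡 n) p.2 →ₗ[ℝ]
    TangentSpace (𝓡 n) p.2 →ₗ[ℝ] TangentSpace (𝓡 n) p.2 →ₗ[ℝ] TangentSpace (𝓡 n) p.2 :=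
  LinearMap.mk₂ ℝ (fun u v ↦ (dproj p).toLinearMap ∘ₗ
      ambientCurvature hγ hγδ p (inclusion p u) (inclusion p v) ∘ₗ (inclusion p).toLinearMap)
    (fun _ _ _ ↦ by ext; simp) (fun _ _ _ ↦ by ext; simp) (fun _ _ _ ↦ by ext; simp)
    (fun _ _ _ ↦ by ext; simp)

theorem curvature_lift {X Y Z : Π x : M, TangentSpace (𝓡 n) x} (hX : IsSmoothField (𝓡 n) X)
    (hY : IsSmoothField (𝓡 n) Y) (hZ : IsSmoothField (𝓡 n) Z) (p : Ambient δ M) :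
    curvature (ambientModel n) (ambientConnection g γ δ) (lift X) (lift Y) (lift Z) p =
      ambientCurvature hγ hγδ p (inclusion p (X p.2)) (inclusion p (Y p.2))
        (inclusion p (Z p.2)) :=
  (isPseudoMetric_ambientMetric hγ hγδ).curvature_eq
    ((isSmoothField_lift hX).mdifferentiableAt (by simp)) (isSmoothField_lift hY)
    (isSmoothField_lift hZ)

theorem lift_eq_homogeneousField (X : Π x : M, TangentSpace (𝓡 n) x) :
    lift (δ := δ) X = homogeneousField 0 0 X :=
  funext fun p ↦ ambientVector_ext (by simp [lift_apply]) (by simp [lift_apply])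
    (by simp [lift_apply])

theorem mlieBracket_eulerField_lift {X : Π x : M, TangentSpace (𝓡 n) x}
    (hX : IsSmoothField (𝓡 n) X) (p : Ambient δ M) :
    mlieBracket (ambientModel n) eulerField (lift X) p = 0 := by
  rw [lift_eq_homogeneousField, mlieBracket_eulerField hX]

/-- Lifts commute with `T`, hence so does `R(X,Y)Z`, and its projection to `M` is constant along the
flow. This removes the dependence on `t`. -/
theorem tangentialCurvature_eulerFlow (p : Ambient δ M) (τ : ℝ) :
    tangentialCurvature hγ hγδ (eulerFlow p τ) = tangentialCurvature hγ hγδ p := by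
  have hg := isPseudoMetric_ambientMetric hγ hγδ
  ext u v w : 3
  obtain ⟨X, hX, rfl⟩ := exists_contMDiff_field p.2 u
  obtain ⟨Y, hY, rfl⟩ := exists_contMDiff_field p.2 v
  obtain ⟨Z, hZ, rfl⟩ := exists_contMDiff_field p.2 w
  have h := dproj_eulerFlow (hg.contMDiff_curvature (isSmoothField_lift hX) (isSmoothField_lift hY)
    (isSmoothField_lift hZ))
    (hg.mlieBracket_homothety_curvature isSmoothField_eulerField
      (ambientConnection_eulerField hγ hγδ) exists_field_commuting_eulerField
      (isSmoothField_lift hX) (mlieBracket_eulerField_lift hX)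
      (isSmoothField_lift hY) (mlieBracket_eulerField_lift hY)
      (isSmoothField_lift hZ) (mlieBracket_eulerField_lift hZ)) p τ
  have h1 (q : Ambient δ M) := curvature_lift hγ hγδ hX hY hZ q
  simp only [ambientConnection] at h1
  rw [h1, h1] at h
  exact h

theorem trace_smulRight_comp {V : Type*} [AddCommGroup V] [Module ℝ V] [FiniteDimensional ℝ V]
    (f : V →ₗ[ℝ] ℝ) (A : V →ₗ[ℝ] V) (v : V) :
    LinearMap.trace ℝ V (A ∘ₗ f.smulRight v) = f (A v) := by
  have : A ∘ₗ f.smulRight v = f.smulRight (A v) := by ext; simp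
  rw [this, LinearMap.trace_smulRight]

/-- At `r = 0` the Ricci tensor is the trace of the `TM`-component of the curvature. -/
theorem ricci_lift {Y Z : Π x : M, TangentSpace (𝓡 n) x} (hY : IsSmoothField (𝓡 n) Y)
    (hZ : IsSmoothField (𝓡 n) Z) {p : Ambient δ M} (hp : rCoord p = 0) :
    ricci (ambientModel n) (ambientConnection g γ δ) (lift Y) (lift Z) p =
      LinearMap.trace ℝ (TangentSpace (𝓡 n) p.2)
        (((tangentialCurvature hγ hγδ p).flip (Y p.2)).flip (Z p.2)) := by
  have : FiniteDimensional ℝ (TangentSpace (ambientModel n) p) :=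
    inferInstanceAs (FiniteDimensional ℝ ((ℝ × ℝ) × EuclideanSpace ℝ (Fin n)))
  have : FiniteDimensional ℝ (TangentSpace (𝓡 n) p.2) :=
    inferInstanceAs (FiniteDimensional ℝ (EuclideanSpace ℝ (Fin n)))
  have h := (isPseudoMetric_ambientMetric hγ hγδ).ricci_eq (isSmoothField_lift hY)
    (isSmoothField_lift hZ) p
  refine h.trans ?_
  let A : TangentSpace (ambientModel n) p →ₗ[ℝ] TangentSpace (ambientModel n) p :=
    ((ambientCurvature hγ hγδ p).flip (lift Y p)).flip (lift Z p)
  change LinearMap.trace ℝ _ A = _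
  have hA (v) : A v = ambientCurvature hγ hγδ p v (lift Y p) (lift Z p) := rfl
  -- The trace is split along `∂_t`, `∂_r` and `TM`. The first part is `dt(A ∂_t) = 0` because `∂_t`
  -- is a multiple of `T`; the second is `dr(A ∂_r) = 0`; the third becomes a trace on `TM` by
  -- cyclicity.
  have hid : A = A ∘ₗ (dt p).toLinearMap.smulRight (partialT p)
      + A ∘ₗ (dr p).toLinearMap.smulRight (partialR p)
      + A ∘ₗ ((inclusion p).toLinearMap ∘ₗ (dproj p).toLinearMap) := by
    ext v : 1
    nth_rw 1 [eq_add_inclusion p v]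
    simp
  have hT : A (partialT p) = 0 := by
    have h0 : partialT (n := n) p = (tCoord p)⁻¹ • eulerField p := by
      rw [eulerField, smul_smul, inv_mul_cancel₀ (tCoord_pos p).ne', one_smul]
    rw [h0, map_smul, hA, ambientCurvature_eulerField, smul_zero]
  have hR : dr p (A (partialR p)) = 0 := dr_ambientCurvature hγ hγδ hp _ _ _
  rw [hid, map_add, map_add, trace_smulRight_comp, trace_smulRight_comp, hT, map_zero, zero_add,
    ← LinearMap.comp_assoc, LinearMap.trace_comp_comm']
  refine (congr($hR + _)).trans ?_
  rw [zero_add]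
  rfl

end AmbientCurvature

/-! ### The immersion `Ψ^u` and sections of the pullback bundle -/

section InducedConnection

variable {n : ℕ} {M : Type*} [TopologicalSpace M] [ChartedSpace (EuclideanSpace ℝ (Fin n)) M]
  [IsManifold (𝓡 n) ∞ M] {δ : ℝ} (hδ : 0 < δ) (u : C^∞⟮𝓡 n, M; 𝓘(ℝ, ℝ), ℝ⟯)

@[simp] theorem rCoord_immersion (x : M) : rCoord (immersion hδ u x) = 0 := rfl

theorem tCoord_immersion (x : M) : tCoord (immersion hδ u x) = Real.exp (u x) := rfl

theorem mem_xiLine {x : M} {v : PullbackTangent hδ u x} :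
    v ∈ xiLine hδ u x ↔ ∃ c : ℝ, c • eulerField (immersion hδ u x) = v :=
  Submodule.mem_span_singleton

/-- The inclusion of `TM` in the pullback of the tangent bundle of `B × M`. -/
def pullbackInclusion (x : M) :
    TangentSpace (𝓡 n) x →L[ℝ] TangentSpace (ambientModel n) (immersion hδ u x) :=
  inclusion (immersion hδ u x)

/-- The projection of the pullback of the tangent bundle of `B × M` to `TM`. -/
def pullbackProj (x : M) :
    TangentSpace (ambientModel n) (immersion hδ u x) →L[ℝ] TangentSpace (𝓡 n) x :=
  dproj (immersion hδ u x)

@[simp] theorem dt_pullbackInclusion (x : M) (v : TangentSpace (𝓡 n) x) :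
    dt _ (pullbackInclusion hδ u x v) = 0 := dt_inclusion _ _

@[simp] theorem dr_pullbackInclusion (x : M) (v : TangentSpace (𝓡 n) x) :
    dr _ (pullbackInclusion hδ u x v) = 0 := dr_inclusion _ _

@[simp] theorem pullbackProj_pullbackInclusion (x : M) (v : TangentSpace (𝓡 n) x) :
    pullbackProj hδ u x (pullbackInclusion hδ u x v) = v := dproj_inclusion _ _

@[simp] theorem pullbackProj_eulerField (x : M) :
    pullbackProj hδ u x (eulerField (immersion hδ u x)) = 0 := dproj_eulerField _

@[simp] theorem pullbackProj_partialR (x : M) :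
    pullbackProj hδ u x (partialR (immersion hδ u x)) = 0 := dproj_partialR _

@[simp] theorem pullbackProj_partialT (x : M) :
    pullbackProj hδ u x (partialT (immersion hδ u x)) = 0 := dproj_partialT _

theorem pullbackVector_ext {x : M} {v w : TangentSpace (ambientModel n) (immersion hδ u x)}
    (ht : dt _ v = dt _ w) (hr : dr _ v = dr _ w)
    (hπ : pullbackProj hδ u x v = pullbackProj hδ u x w) : v = w :=
  ambientVector_ext ht hr hπ

/-- The `t`-component of `Ψ^u` is `e^u`, whose derivative `e^u du` is `t du` along the image; this
produces the multiple of `T = t ∂_t`. -/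
theorem mfderiv_immersion (x : M) (v : TangentSpace (𝓡 n) x) :
    mfderiv (𝓡 n) (ambientModel n) (immersion hδ u) x v =
      pullbackInclusion hδ u x v
        + mvfderiv (𝓡 n) u x v • eulerField (immersion hδ u x) := by
  have n0 : (∞ : WithTop ℕ∞) ≠ 0 := by simp
  have hΨ : MDifferentiableAt (𝓡 n) (ambientModel n) (immersion hδ u) x :=
    (immersion hδ u).contMDiff.mdifferentiableAt n0
  refine pullbackVector_ext hδ u ?_ ?_ ?_
  · have h := congr($(mfderiv_comp x (contMDiff_tCoord.mdifferentiableAt n0) hΨ) v)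
    refine h.symm.trans ?_
    have hu : MDifferentiableAt (𝓡 n) 𝓘(ℝ, ℝ) u x := u.contMDiff.mdifferentiableAt n0
    have he : HasMFDerivAt 𝓘(ℝ, ℝ) 𝓘(ℝ, ℝ) Real.exp (u x) _ :=
      (Real.hasDerivAt_exp (u x)).hasFDerivAt.hasMFDerivAt
    have h' := congr($((he.comp x hu.hasMFDerivAt).mfderiv) v)
    refine h'.trans ?_
    simp only [map_add, dt_pullbackInclusion, map_smul, dt_eulerField, tCoord_immersion, zero_add]
    rfl
  · have h := congr($(mfderiv_comp x (contMDiff_rCoord.mdifferentiableAt n0) hΨ) v)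
    refine h.symm.trans ?_
    simp only [map_add, dr_pullbackInclusion, map_smul, dr_eulerField, smul_zero, add_zero]
    exact congr($(mfderiv_const (I := 𝓡 n) (I' := 𝓘(ℝ, ℝ)) (x := x) (c := (0 : ℝ))) v)
  · have h := congr($(mfderiv_comp x (mdifferentiableAt_snd (I := 𝓘(ℝ, ℝ × ℝ)) (I' := 𝓡 n)) hΨ) v)
    refine h.symm.trans ?_
    simp only [map_add, pullbackProj_pullbackInclusion, map_smul, pullbackProj_eulerField,
      smul_zero, add_zero]
    exact congr($(mfderiv_id (I := 𝓡 n) (x := x)) v)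

/-- The field on `B × M` which is related to `X` by the immersion. -/
def relatedField (X : Π x : M, TangentSpace (𝓡 n) x) (p : Ambient δ M) :
    TangentSpace (ambientModel n) p :=
  lift X p + mvfderiv (𝓡 n) u p.2 (X p.2) • eulerField p

variable {u}
variable {X Y Z : Π x : M, TangentSpace (𝓡 n) x}

theorem mfderiv_immersion_field (X : Π x : M, TangentSpace (𝓡 n) x) (x : M) :
    mfderiv (𝓡 n) (ambientModel n) (immersion hδ u) x (X x) =
      relatedField u X (immersion hδ u x) :=
  mfderiv_immersion hδ u x (X x)

theorem isSmoothField_relatedField (hX : IsSmoothField (𝓡 n) X) :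
    IsSmoothField (ambientModel n) (relatedField (δ := δ) u X) := by
  have h : ContMDiff (ambientModel n) 𝓘(ℝ, ℝ) ∞
      (fun p : Ambient δ M ↦ mvfderiv (𝓡 n) u p.2 (X p.2)) :=
    (contMDiff_mvfderiv_apply u.contMDiff hX).comp contMDiff_snd
  exact (isSmoothField_lift hX).add_section (h.smul_section isSmoothField_eulerField)

/-- An extension to `B × M` of a section of the pullback of its tangent bundle. -/
def extendSection (σ : Π x : M, PullbackTangent hδ u x) (p : Ambient δ M) :
    TangentSpace (ambientModel n) p :=
  (dt (immersion hδ u p.2) (σ p.2) / tCoord (immersion hδ u p.2)) • eulerField p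
    + dr (immersion hδ u p.2) (σ p.2) • partialR p
    + lift (fun x ↦ pullbackProj hδ u x (σ x)) p

theorem extendSection_immersion (σ : Π x : M, PullbackTangent hδ u x) (x : M) :
    extendSection hδ σ (immersion hδ u x) = σ x := by
  change (dt (immersion hδ u x) (σ x) / tCoord (immersion hδ u x)) • eulerField (immersion hδ u x)
    + dr (immersion hδ u x) (σ x) • partialR (immersion hδ u x)
    + pullbackInclusion hδ u x (pullbackProj hδ u x (σ x)) = _
  refine pullbackVector_ext hδ u ?_ ?_ ?_
  · simp only [map_add, map_smul, dt_eulerField, dt_partialR, dt_pullbackInclusion, smul_eq_mul,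
      mul_zero, add_zero]
    exact div_mul_cancel₀ _ (tCoord_pos _).ne'
  · simp only [map_add, map_smul, dr_eulerField, dr_partialR, dr_pullbackInclusion,
      smul_eq_mul, mul_zero, mul_one, zero_add, add_zero]
  · simp only [map_add, map_smul, pullbackProj_eulerField, pullbackProj_partialR,
      pullbackProj_pullbackInclusion, smul_zero, zero_add]

variable {σ τ : Π x : M, PullbackTangent hδ u x}

theorem isSmoothSection_pullback_iff :
    IsSmoothSection (𝓡 n) ((ℝ × ℝ) × EuclideanSpace ℝ (Fin n)) σ ↔
      ContMDiff (𝓡 n) (ambientModel n).tangent ∞ (fun x ↦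
        (⟨immersion hδ u x, σ x⟩ : TangentBundle (ambientModel n) (Ambient δ M))) :=
  contMDiff_pullback_section_iff (V := (TangentSpace (ambientModel n) : Ambient δ M → Type))
    (f := immersion hδ u) (σ := σ)

theorem contMDiff_mvfderiv_pullback {φ : Ambient δ M → ℝ}
    (hφ : ContMDiff (ambientModel n) 𝓘(ℝ, ℝ) ∞ φ)
    (hσ : IsSmoothSection (𝓡 n) ((ℝ × ℝ) × EuclideanSpace ℝ (Fin n)) σ) :
    ContMDiff (𝓡 n) 𝓘(ℝ, ℝ) ∞ (fun x ↦ mvfderiv (ambientModel n) φ (immersion hδ u x) (σ x)) := by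
  have h : ContMDiff (ambientModel n).tangent 𝓘(ℝ, ℝ).tangent ∞
    (tangentMap (ambientModel n) 𝓘(ℝ, ℝ) φ) := hφ.contMDiff_tangentMap (n := ∞) (by simp)
  exact (contMDiff_snd_tangentBundle_modelSpace ℝ 𝓘(ℝ, ℝ) (n := ∞)).comp
    (h.comp ((isSmoothSection_pullback_iff hδ).1 hσ))

theorem isSmoothField_extendSection
    (hσ : IsSmoothSection (𝓡 n) ((ℝ × ℝ) × EuclideanSpace ℝ (Fin n)) σ) :
    IsSmoothField (ambientModel n) (extendSection hδ σ) := by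
  have htΨ : ContMDiff (𝓡 n) 𝓘(ℝ, ℝ) ∞ (fun x ↦ tCoord (immersion hδ u x)) :=
    contMDiff_tCoord.comp (immersion hδ u).contMDiff
  have ht : ContMDiff (𝓡 n) 𝓘(ℝ, ℝ) ∞
      (fun x ↦ dt (immersion hδ u x) (σ x) / tCoord (immersion hδ u x)) :=
    (contMDiff_mvfderiv_pullback hδ contMDiff_tCoord hσ).div₀ htΨ
      fun x ↦ (tCoord_pos _).ne'
  have hr : ContMDiff (𝓡 n) 𝓘(ℝ, ℝ) ∞ (fun x ↦ dr (immersion hδ u x) (σ x)) :=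
    contMDiff_mvfderiv_pullback hδ contMDiff_rCoord hσ
  have hπ : ContMDiff (ambientModel n).tangent (𝓡 n).tangent ∞
    (tangentMap (ambientModel n) (𝓡 n) (Prod.snd : Ambient δ M → M)) :=
    ContMDiff.contMDiff_tangentMap (n := ∞) contMDiff_snd (by simp)
  have hX : IsSmoothField (𝓡 n) (fun x ↦ pullbackProj hδ u x (σ x)) :=
    hπ.comp ((isSmoothSection_pullback_iff hδ).1 hσ)
  exact (((ht.comp contMDiff_snd).smul_section isSmoothField_eulerField).add_section
    ((hr.comp contMDiff_snd).smul_section isSmoothField_partialR)).add_section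
    (isSmoothField_lift hX)

theorem isSmoothSection_comp_immersion {s : Π p : Ambient δ M, TangentSpace (ambientModel n) p}
    (hs : IsSmoothField (ambientModel n) s) :
    IsSmoothSection (𝓡 n) ((ℝ × ℝ) × EuclideanSpace ℝ (Fin n))
      (V := PullbackTangent hδ u) (fun x ↦ s (immersion hδ u x)) := by
  refine (isSmoothSection_pullback_iff hδ).2 ?_
  exact ContMDiff.comp (g := fun p ↦ (⟨p, s p⟩ : TangentBundle (ambientModel n) (Ambient δ M)))
    hs (immersion hδ u).contMDiff

variable [T2Space M]
variable {g : Metric n M} {γ : ℝ → Π x : M, TangentSpace (𝓡 n) x →L[ℝ] TangentSpace (𝓡 n) x}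
variable (hγ : IsAdmissible g γ) (hγδ : IsNonsingularBelow γ δ)
include hγ hγδ

theorem inducedConnection_comp {s : Π p : Ambient δ M, TangentSpace (ambientModel n) p}
    (hs : IsSmoothField (ambientModel n) s) (x : M) (v : TangentSpace (𝓡 n) x) :
    inducedConnection g γ hδ u (fun x ↦ s (immersion hδ u x)) x v =
      ambientConnection g γ δ s (immersion hδ u x)
        (mfderiv (𝓡 n) (ambientModel n) (immersion hδ u) x v) :=
  pullbackConnection_comp (isPseudoMetric_ambientMetric hγ hγδ).isCovariantDerivativeOn
    (hs.mdifferentiableAt (by simp)) v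

end InducedConnection

/-! ### Metric, curvature and derivatives of sections for the induced connection -/

section TractorConnection

variable {n : ℕ} {M : Type*} [TopologicalSpace M] [ChartedSpace (EuclideanSpace ℝ (Fin n)) M]
  [IsManifold (𝓡 n) ∞ M] [T2Space M] {δ : ℝ} (hδ : 0 < δ) {u : C^∞⟮𝓡 n, M; 𝓘(ℝ, ℝ), ℝ⟯}
  {g : Metric n M} {γ : ℝ → Π x : M, TangentSpace (𝓡 n) x →L[ℝ] TangentSpace (𝓡 n) x}
  (hγ : IsAdmissible g γ) (hγδ : IsNonsingularBelow γ δ)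
  {X Y Z : Π x : M, TangentSpace (𝓡 n) x} {σ τ : Π x : M, PullbackTangent hδ u x}

/-- The coefficient is recovered as `dt(σ)/t`, which shows that it is smooth. -/
theorem exists_eq_smul_eulerField
    (hσ : IsSectionOf (𝓡 n) ((ℝ × ℝ) × EuclideanSpace ℝ (Fin n)) (xiLine hδ u) σ) :
    ∃ f : M → ℝ, ContMDiff (𝓡 n) 𝓘(ℝ, ℝ) ∞ f ∧
      ∀ x, σ x = f x • eulerField (immersion hδ u x) := by
  have htΨ : ContMDiff (𝓡 n) 𝓘(ℝ, ℝ) ∞ (fun x ↦ tCoord (immersion hδ u x)) :=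
    contMDiff_tCoord.comp (immersion hδ u).contMDiff
  refine ⟨fun x ↦ dt (immersion hδ u x) (σ x) / tCoord (immersion hδ u x),
    (contMDiff_mvfderiv_pullback hδ contMDiff_tCoord hσ.1).div₀ htΨ fun x ↦ (tCoord_pos _).ne',
    fun x ↦ ?_⟩
  obtain ⟨c, hc⟩ := (mem_xiLine hδ u).1 (hσ.2 x)
  have h : dt (immersion hδ u x) (σ x) = c * tCoord (immersion hδ u x) :=
    (congrArg (dt (immersion hδ u x)) hc).symm.trans
      (by rw [map_smul, dt_eulerField, smul_eq_mul])
  have h' : dt (immersion hδ u x) (σ x) / tCoord (immersion hδ u x) = c := by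
    rw [h, mul_div_cancel_right₀ _ (tCoord_pos _).ne']
  exact hc.symm.trans congr($h'.symm • eulerField (immersion hδ u x))

include hγ hγδ

/-- Every section of the pullback bundle is the restriction of an ambient field, so properties of
the induced connection reduce to those of `∇̃`. -/
theorem inducedConnection_eq
    (hσ : IsSmoothSection (𝓡 n) ((ℝ × ℝ) × EuclideanSpace ℝ (Fin n)) σ) (x : M)
    (v : TangentSpace (𝓡 n) x) :
    inducedConnection g γ hδ u σ x v =
      ambientConnection g γ δ (extendSection hδ σ) (immersion hδ u x)
        (mfderiv (𝓡 n) (ambientModel n) (immersion hδ u) x v) := by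
  have h := inducedConnection_comp hδ hγ hγδ (u := u) (isSmoothField_extendSection hδ hσ) x v
  have h' : (fun x ↦ extendSection hδ σ (immersion hδ u x)) = σ :=
    funext (extendSection_immersion hδ σ)
  rw [h'] at h
  exact h

theorem isSmoothSection_inducedConnection
    (hσ : IsSmoothSection (𝓡 n) ((ℝ × ℝ) × EuclideanSpace ℝ (Fin n)) σ)
    (hX : IsSmoothField (𝓡 n) X) :
    IsSmoothSection (𝓡 n) ((ℝ × ℝ) × EuclideanSpace ℝ (Fin n))
      (fun x ↦ inducedConnection g γ hδ u σ x (X x)) := by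
  have h : (fun x ↦ inducedConnection g γ hδ u σ x (X x)) = fun x ↦
      ambientConnection g γ δ (extendSection hδ σ) (immersion hδ u x)
        (relatedField u X (immersion hδ u x)) := by
    ext x
    rw [inducedConnection_eq hδ hγ hγδ hσ, mfderiv_immersion_field]
  rw [h]
  exact isSmoothSection_comp_immersion hδ
    ((isPseudoMetric_ambientMetric hγ hγδ).contMDiff_leviCivita_apply
      (isSmoothField_relatedField hX) (isSmoothField_extendSection hδ hσ))

theorem contMDiff_restrictedMetric
    (hσ : IsSmoothSection (𝓡 n) ((ℝ × ℝ) × EuclideanSpace ℝ (Fin n)) σ)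
    (hτ : IsSmoothSection (𝓡 n) ((ℝ × ℝ) × EuclideanSpace ℝ (Fin n)) τ) :
    ContMDiff (𝓡 n) 𝓘(ℝ, ℝ) ∞ (fun x ↦ restrictedMetric g γ hδ u x (σ x) (τ x)) := by
  have h := ((isPseudoMetric_ambientMetric hγ hγδ).smooth _ _ (isSmoothField_extendSection hδ hσ)
    (isSmoothField_extendSection hδ hτ)).comp (immersion hδ u).contMDiff
  refine h.congr fun x ↦ ?_
  simp only [Function.comp_apply, extendSection_immersion]
  rfl

theorem mvfderiv_restrictedMetric
    (hσ : IsSmoothSection (𝓡 n) ((ℝ × ℝ) × EuclideanSpace ℝ (Fin n)) σ)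
    (hτ : IsSmoothSection (𝓡 n) ((ℝ × ℝ) × EuclideanSpace ℝ (Fin n)) τ) (x : M)
    (v : TangentSpace (𝓡 n) x) :
    mvfderiv (𝓡 n) (fun y ↦ restrictedMetric g γ hδ u y (σ y) (τ y)) x v =
      restrictedMetric g γ hδ u x (inducedConnection g γ hδ u σ x v) (τ x)
        + restrictedMetric g γ hδ u x (σ x) (inducedConnection g γ hδ u τ x v) := by
  have n0 : (∞ : WithTop ℕ∞) ≠ 0 := by simp
  have hg := isPseudoMetric_ambientMetric hγ hγδ
  have hσ' := isSmoothField_extendSection hδ hσ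
  have hτ' := isSmoothField_extendSection hδ hτ
  have hΨ : MDifferentiableAt (𝓡 n) (ambientModel n) (immersion hδ u) x :=
    (immersion hδ u).contMDiff.mdifferentiableAt n0
  have hm := hg.mvfderiv_metric (hσ'.mdifferentiableAt n0 (x := immersion hδ u x))
    (hτ'.mdifferentiableAt n0)
    (mfderiv (𝓡 n) (ambientModel n) (immersion hδ u) x v)
  have hc := congr($(mfderiv_comp x ((hg.smooth _ _ hσ' hτ').mdifferentiableAt n0) hΨ) v)
  rw [inducedConnection_eq hδ hγ hγδ hσ, inducedConnection_eq hδ hγ hγδ hτ]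
  have h1 : (fun y ↦ restrictedMetric g γ hδ u y (σ y) (τ y)) =
      (fun q ↦ ambientMetric g γ δ q (extendSection hδ σ q) (extendSection hδ τ q))
        ∘ immersion hδ u := by
    ext y
    simp only [Function.comp_apply, extendSection_immersion]
    rfl
  rw [h1]
  refine (hc.trans hm).trans ?_
  rw [extendSection_immersion, extendSection_immersion]
  rfl

/-- The curvature of the induced connection is the restriction of that of the ambient metric. -/
theorem curvature_inducedConnection (hX : IsSmoothField (𝓡 n) X) (hY : IsSmoothField (𝓡 n) Y)
    (hσ : IsSmoothSection (𝓡 n) ((ℝ × ℝ) × EuclideanSpace ℝ (Fin n)) σ) (x : M) :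
    curvature (𝓡 n) (inducedConnection g γ hδ u) X Y σ x =
      ambientCurvature hγ hγδ (immersion hδ u x) (pullbackInclusion hδ u x (X x))
        (pullbackInclusion hδ u x (Y x)) (σ x) := by
  have n0 : (∞ : WithTop ℕ∞) ≠ 0 := by simp
  have hg := isPseudoMetric_ambientMetric hγ hγδ
  have hs := isSmoothField_extendSection hδ hσ
  have hX' := isSmoothField_relatedField (δ := δ) (u := u) hX
  have hY' := isSmoothField_relatedField (δ := δ) (u := u) hY
  have h (Z) (hZ : IsSmoothField (𝓡 n) Z) : (fun x ↦ inducedConnection g γ hδ u σ x (Z x)) = fun x ↦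
      ambientConnection g γ δ (extendSection hδ σ) (immersion hδ u x)
        (relatedField u Z (immersion hδ u x)) := by
    ext x
    rw [inducedConnection_eq hδ hγ hγδ hσ, mfderiv_immersion_field]
  -- The bracket terms of the two curvatures match because `X` and `Y` are `Ψ^u`-related to the
  -- ambient fields.
  have hb : mfderiv (𝓡 n) (ambientModel n) (immersion hδ u) x (mlieBracket (𝓡 n) X Y x) =
      mlieBracket (ambientModel n) (relatedField u X) (relatedField u Y) (immersion hδ u x) :=
    mfderiv_mlieBracket_of_related (immersion hδ u).contMDiff hX hY hX' hY'
      (mfderiv_immersion_field hδ X) (mfderiv_immersion_field hδ Y) x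
  have h1 : curvature (𝓡 n) (inducedConnection g γ hδ u) X Y σ x =
      curvature (ambientModel n) (ambientConnection g γ δ) (relatedField u X) (relatedField u Y)
        (extendSection hδ σ) (immersion hδ u x) := by
    rw [curvature, h Y hY, h X hX]
    rw [inducedConnection_eq hδ hγ hγδ hσ, hb]
    have h2 (Z W : Π x : M, TangentSpace (𝓡 n) x) (hZ : IsSmoothField (𝓡 n) Z) :=
      inducedConnection_comp hδ hγ hγδ (u := u) (hg.contMDiff_leviCivita_apply
        (isSmoothField_relatedField (u := u) hZ) hs) x (W x)
    simp only [mfderiv_immersion_field] at h2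
    exact congrArg₂ (fun a b : TangentSpace (ambientModel n) (immersion hδ u x) ↦ a - b
      - ambientConnection g γ δ (extendSection hδ σ) (immersion hδ u x)
        (mlieBracket (ambientModel n) (relatedField u X) (relatedField u Y) (immersion hδ u x)))
      (h2 Y X hY) (h2 X Y hX)
  refine h1.trans ((hg.curvature_eq (hX'.mdifferentiableAt n0) hY' hs).trans ?_)
  rw [extendSection_immersion]
  -- The related fields differ from lifts by multiples of `T`, which the curvature ignores.
  exact ambientCurvature_add_smul_eulerField hγ hγδ _ _ _ _ _

theorem inducedConnection_isCovariantDerivativeOn :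
    IsCovariantDerivativeOn ((ℝ × ℝ) × EuclideanSpace ℝ (Fin n))
      (inducedConnection g γ hδ u) univ :=
  pullbackConnection_isCovariantDerivativeOn
    (isPseudoMetric_ambientMetric hγ hγδ).isCovariantDerivativeOn

/-- From `∇̃T = Id` one gets `∇_v T = dΨ^u(v) = v + du(v) T`; the Leibniz rule does the rest. The
tractor condition, the conformal class and the form of `W` are all read off from this formula. -/
theorem inducedConnection_smul_eulerField {f : M → ℝ} (hf : ContMDiff (𝓡 n) 𝓘(ℝ, ℝ) ∞ f)
    (hσ : ∀ x, σ x = f x • eulerField (immersion hδ u x)) (x : M) (v : TangentSpace (𝓡 n) x) :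
    inducedConnection g γ hδ u σ x v = f x • pullbackInclusion hδ u x v
      + (f x * mvfderiv (𝓡 n) u x v + mvfderiv (𝓡 n) f x v) • eulerField (immersion hδ u x) := by
  have n0 : (∞ : WithTop ℕ∞) ≠ 0 := by simp
  let ζ : Π x : M, PullbackTangent hδ u x := fun x ↦ eulerField (immersion hδ u x)
  have hζ : IsSmoothSection (𝓡 n) ((ℝ × ℝ) × EuclideanSpace ℝ (Fin n)) ζ :=
    isSmoothSection_comp_immersion hδ isSmoothField_eulerField
  have h0 : σ = f • ζ := funext hσ
  have h1 := congr($((inducedConnection_isCovariantDerivativeOn hδ hγ hγδ (u := u)).leibniz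
    (hζ.mdifferentiableAt n0 (x := x)) (hf.mdifferentiableAt n0)) v)
  have h2 : inducedConnection g γ hδ u ζ x v = pullbackInclusion hδ u x v
      + mvfderiv (𝓡 n) u x v • eulerField (immersion hδ u x) := by
    refine (inducedConnection_comp hδ hγ hγδ isSmoothField_eulerField x v).trans ?_
    rw [ambientConnection_eulerField hγ hγδ, mfderiv_immersion]
    rfl
  rw [h0]
  refine h1.trans ?_
  have key (w : TangentSpace (ambientModel n) (immersion hδ u x))
      (hw : w = pullbackInclusion hδ u x v + mvfderiv (𝓡 n) u x v • eulerField _) :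
      f x • w + mvfderiv (𝓡 n) f x v • eulerField _ = f x • pullbackInclusion hδ u x v
        + (f x * mvfderiv (𝓡 n) u x v + mvfderiv (𝓡 n) f x v) • eulerField _ := by
    rw [hw]
    module
  exact key _ h2

end TractorConnection

/-! ### The pullback bundle is a standard conformal tractor bundle -/

section TractorBundle

variable {n : ℕ} {M : Type*} [TopologicalSpace M] [ChartedSpace (EuclideanSpace ℝ (Fin n)) M]
  [IsManifold (𝓡 n) ∞ M] {δ : ℝ} (hδ : 0 < δ) {u : C^∞⟮𝓡 n, M; 𝓘(ℝ, ℝ), ℝ⟯}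
  {g : Metric n M} {γ : ℝ → Π x : M, TangentSpace (𝓡 n) x →L[ℝ] TangentSpace (𝓡 n) x}
  (hγ : IsAdmissible g γ) (hγδ : IsNonsingularBelow γ δ)

theorem restrictedMetric_apply (hγ : IsAdmissible g γ) (x : M)
    (v w : TangentSpace (ambientModel n) (immersion hδ u x)) :
    restrictedMetric g γ hδ u x v w =
      tCoord (immersion hδ u x) * (dr _ v * dt _ w + dt _ v * dr _ w)
        + tCoord (immersion hδ u x) ^ 2
          * g.inner x (pullbackProj hδ u x v) (pullbackProj hδ u x w) := by
  have h0 : γ 0 x (pullbackProj hδ u x v) = pullbackProj hδ u x v := by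
    rw [hγ.zero]; rfl
  refine (ambientMetric_apply (immersion hδ u x) v w).trans ?_
  refine (congrArg₂ (· + ·) (?_ : _ = tCoord (immersion hδ u x) * (dr _ v * dt _ w
    + dt _ v * dr _ w)) (congr(tCoord (immersion hδ u x) ^ 2
      * g.inner x $h0 (pullbackProj hδ u x w))))
  rw [rCoord_immersion]
  ring

theorem isLorentzian_restrictedMetric (hγ : IsAdmissible g γ) (x : M) :
    IsLorentzian (restrictedMetric g γ hδ u x) where
  symm := ambientMetric_symm hγ (immersion hδ u x)
  signature := by
    have ht := tCoord_pos (immersion hδ u x)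
    -- `∂_t - ∂_r` has square `-2t`. Orthogonality to it means `dr w = dt w`, so the square of such
    -- a `w` is `2t (dt w)²` plus `t²` times the `g`-square of its `TM`-part.
    refine ⟨(partialT (immersion hδ u x) - partialR (immersion hδ u x) :
      TangentSpace (ambientModel n) (immersion hδ u x)), ?_, fun w hw hw0 ↦ ?_⟩
    · rw [restrictedMetric_apply hδ hγ]
      simp
      linarith
    · refine lt_of_lt_of_eq ?_ (restrictedMetric_apply hδ hγ x w w).symm
      replace hw := (restrictedMetric_apply hδ hγ x (partialT _ - partialR _) w).symm.trans hw
      simp only [map_sub, dt_partialT, dr_partialT, dt_partialR, dr_partialR,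
        pullbackProj_partialT, pullbackProj_partialR, sub_self, map_zero, zero_apply,
        mul_zero, add_zero] at hw
      have h1 : dr (immersion hδ u x) w = dt (immersion hδ u x) w := by
        have := (mul_eq_zero.1 hw).resolve_left ht.ne'
        linarith
      by_cases h2 : pullbackProj hδ u x w = 0
      · have h3 : dt (immersion hδ u x) w ≠ 0 := fun h3 ↦ hw0 <| by
          refine pullbackVector_ext hδ u (v := w) (w := 0) ?_ ?_ ?_
          · rw [h3, map_zero]
          · rw [h1, h3, map_zero]
          · rw [h2, map_zero]
        rw [h1, h2, map_zero, mul_zero, add_zero]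
        have := mul_self_pos.2 h3
        positivity
      · rw [h1]
        have h3 := g.pos x _ h2
        have h4 := mul_self_nonneg (dt (immersion hδ u x) w)
        positivity

theorem restrictedMetric_eulerField (hγ : IsAdmissible g γ) (x : M)
    (v : TangentSpace (ambientModel n) (immersion hδ u x)) :
    restrictedMetric g γ hδ u x (eulerField (immersion hδ u x)) v =
      tCoord (immersion hδ u x) ^ 2 * dr _ v := by
  rw [restrictedMetric_apply hδ hγ]
  simp only [dr_eulerField, dt_eulerField, pullbackProj_eulerField, map_zero, zero_apply]
  ring

theorem mem_orthogonal_xiLine (hγ : IsAdmissible g γ) {x : M} {v : PullbackTangent hδ u x} :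
    v ∈ (restrictedMetric g γ hδ u x).orthogonal (xiLine hδ u x) ↔
      dr (immersion hδ u x) v = 0 := by
  have ht := (tCoord_pos (immersion hδ u x)).ne'
  rw [LinearMap.BilinForm.mem_orthogonal_iff]
  constructor
  · intro h
    have h1 := h (xi hδ u x) (Submodule.mem_span_singleton_self _)
    have h2 := (restrictedMetric_eulerField hδ hγ x v).symm.trans h1
    exact (mul_eq_zero.1 h2).resolve_left (pow_ne_zero 2 ht)
  · intro h w hw
    obtain ⟨c, rfl⟩ := Submodule.mem_span_singleton.1 hw
    have h2 := restrictedMetric_eulerField hδ hγ x v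
    rw [h, mul_zero] at h2
    rw [map_smul, LinearMap.smul_apply]
    exact (congrArg (c • ·) h2).trans (smul_zero c)

theorem isConformalTractorBundle_pullback [T2Space M] (hγ : IsAdmissible g γ)
    (hγδ : IsNonsingularBelow γ δ) :
    IsConformalTractorBundle (𝓡 n) ((ℝ × ℝ) × EuclideanSpace ℝ (Fin n))
      (restrictedMetric g γ hδ u) (xiLine hδ u) (xiPos hδ u) where
  rank := by
    simp
    ring
  metric_smooth σ τ hσ hτ := contMDiff_restrictedMetric hδ hγ hγδ hσ hτ
  metric_lorentzian := isLorentzian_restrictedMetric hδ hγ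
  line x₀ := by
    -- Along `Ψ^u` the section `ξ^u = e^u ∂_t` is the restriction of `T = t ∂_t`, so it is a smooth
    -- global frame of the line.
    refine ⟨univ, Filter.univ_mem, xi hδ u, ContMDiff.contMDiffOn
      (isSmoothSection_comp_immersion hδ isSmoothField_eulerField), fun x _ ↦ ⟨fun h ↦ ?_, rfl, rfl⟩⟩
    have h1 : dt (immersion hδ u x) (eulerField (immersion hδ u x)) = 0 :=
      (congrArg (dt (immersion hδ u x)) h).trans (map_zero _)
    rw [dt_eulerField] at h1
    exact (tCoord_pos _).ne' h1
  lightlike x v hv := by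
    obtain ⟨c, rfl⟩ := Submodule.mem_span_singleton.1 hv
    have h2 := restrictedMetric_eulerField hδ hγ (u := u) x (eulerField (immersion hδ u x))
    rw [dr_eulerField, mul_zero] at h2
    rw [map_smul, map_smul, LinearMap.smul_apply]
    exact (congrArg (fun a : ℝ ↦ c • c • a) h2).trans (by simp)

/-- The isomorphism `TM ≅ Hom(L, L^⊥ / L)`. -/
def betaMap (hγ : IsAdmissible g γ) (x : M) : TangentSpace (𝓡 n) x →ₗ[ℝ]
    (xiLine hδ u x →ₗ[ℝ] ((restrictedMetric g γ hδ u x).orthogonal (xiLine hδ u x) ⧸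
      (xiLine hδ u x).submoduleOf ((restrictedMetric g γ hδ u x).orthogonal (xiLine hδ u x)))) :=
  let d : TangentSpace (ambientModel n) (immersion hδ u x) →ₗ[ℝ] ℝ :=
    (tCoord (immersion hδ u x))⁻¹ • (dt (immersion hδ u x)).toLinearMap
  let c : PullbackTangent hδ u x →ₗ[ℝ] ℝ := d
  let ι : TangentSpace (𝓡 n) x →ₗ[ℝ] PullbackTangent hδ u x :=
    (pullbackInclusion hδ u x).toLinearMap
  LinearMap.smulRightₗ (c ∘ₗ (xiLine hδ u x).subtype) ∘ₗ (Submodule.mkQ _) ∘ₗ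
    ι.codRestrict _ fun v ↦ (mem_orthogonal_xiLine hδ hγ).2 (dr_pullbackInclusion hδ u x v)

theorem betaMap_apply (hγ : IsAdmissible g γ) (x : M) (v : TangentSpace (𝓡 n) x)
    (c : ℝ) (ℓ : xiLine hδ u x) (hℓ : (ℓ : PullbackTangent hδ u x) = c • eulerField (immersion hδ u x))
    (hv : (pullbackInclusion hδ u x v : PullbackTangent hδ u x) ∈
      (restrictedMetric g γ hδ u x).orthogonal (xiLine hδ u x)) :
    betaMap hδ hγ x v ℓ = c • Submodule.Quotient.mk ⟨pullbackInclusion hδ u x v, hv⟩ := by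
  have ht := (tCoord_pos (immersion hδ u x)).ne'
  have h : (tCoord (immersion hδ u x))⁻¹ * dt (immersion hδ u x) (ℓ : PullbackTangent hδ u x) = c := by
    have h1 : dt (immersion hδ u x) (ℓ : PullbackTangent hδ u x) = c * tCoord (immersion hδ u x) :=
      (congrArg (dt (immersion hδ u x)) hℓ).trans (by rw [map_smul, dt_eulerField, smul_eq_mul])
    rw [h1, mul_comm, mul_inv_cancel_right₀ ht]
  rw [← h]
  rfl

/-- `L^⊥ = ker dr = TM ⊕ L`, so `TM` is a complement of `L` in `L^⊥`; a linear map on the line `L`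
is determined by its value at `ξ^u`. -/
theorem betaMap_bijective (hγ : IsAdmissible g γ) (x : M) :
    Function.Bijective (betaMap hδ (u := u) hγ x) := by
  have ht := (tCoord_pos (immersion hδ u x)).ne'
  have hι (v) : (pullbackInclusion hδ u x v : PullbackTangent hδ u x) ∈
      (restrictedMetric g γ hδ u x).orthogonal (xiLine hδ u x) :=
    (mem_orthogonal_xiLine hδ hγ).2 (dr_pullbackInclusion hδ u x v)
  have hξ (v) : betaMap hδ hγ x v ⟨xi hδ u x, Submodule.mem_span_singleton_self _⟩ =
      Submodule.Quotient.mk ⟨pullbackInclusion hδ u x v, hι v⟩ := by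
    rw [betaMap_apply hδ hγ x v 1 _ (one_smul ℝ _).symm (hι v), one_smul]
  constructor
  · rw [← LinearMap.ker_eq_bot, LinearMap.ker_eq_bot']
    intro v hv
    have h := hξ v
    rw [hv, LinearMap.zero_apply, eq_comm, Submodule.Quotient.mk_eq_zero] at h
    obtain ⟨c, hc⟩ := (mem_xiLine hδ u).1 h
    have h1 := congrArg (pullbackProj hδ u x) hc
    rw [map_smul, pullbackProj_eulerField, smul_zero] at h1
    exact (h1.trans (pullbackProj_pullbackInclusion hδ u x v)).symm
  · intro A
    obtain ⟨⟨w, hw⟩, hAw⟩ := Submodule.Quotient.mk_surjective _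
      (A ⟨xi hδ u x, Submodule.mem_span_singleton_self _⟩)
    refine ⟨pullbackProj hδ u x w, LinearMap.ext fun ⟨ℓ, hℓ⟩ ↦ ?_⟩
    obtain ⟨c, rfl⟩ := Submodule.mem_span_singleton.1 hℓ
    have h1 : betaMap hδ hγ x (pullbackProj hδ u x w)
        ⟨xi hδ u x, Submodule.mem_span_singleton_self _⟩ =
        A ⟨xi hδ u x, Submodule.mem_span_singleton_self _⟩ := by
      rw [hξ, ← hAw, Submodule.Quotient.eq]
      refine (mem_xiLine hδ u).2 ⟨- (dt (immersion hδ u x) w / tCoord (immersion hδ u x)), ?_⟩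
      have key (w : TangentSpace (ambientModel n) (immersion hδ u x)) (hr : dr _ w = 0) :
          -(dt _ w / tCoord (immersion hδ u x)) • eulerField (immersion hδ u x) =
            pullbackInclusion hδ u x (pullbackProj hδ u x w) - w := by
        refine pullbackVector_ext hδ u ?_ ?_ ?_
        · rw [map_smul, map_sub, dt_eulerField, dt_pullbackInclusion, smul_eq_mul, neg_mul,
            div_mul_cancel₀ _ ht, zero_sub]
        · rw [map_smul, map_sub, dr_eulerField, dr_pullbackInclusion, hr, smul_zero, sub_zero]
        · rw [map_smul, map_sub, pullbackProj_eulerField, pullbackProj_pullbackInclusion,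
            smul_zero, sub_self]
      exact key w ((mem_orthogonal_xiLine hδ hγ).1 hw)
    exact ((betaMap hδ hγ x (pullbackProj hδ u x w)).map_smul c
      ⟨xi hδ u x, Submodule.mem_span_singleton_self _⟩).trans
      ((congrArg (c • ·) h1).trans (A.map_smul c _).symm)

variable [T2Space M]

theorem isTractorConnection_inducedConnection (hγ : IsAdmissible g γ)
    (hγδ : IsNonsingularBelow γ δ) :
    IsTractorConnection (𝓡 n) ((ℝ × ℝ) × EuclideanSpace ℝ (Fin n))
      (restrictedMetric g γ hδ u) (xiLine hδ u) (inducedConnection g γ hδ u) where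
  linear := inducedConnection_isCovariantDerivativeOn hδ hγ hγδ
  smooth.contMDiff {σ} hσ := by
    have hσ' : IsSmoothSection (𝓡 n) ((ℝ × ℝ) × EuclideanSpace ℝ (Fin n)) σ :=
      contMDiffOn_univ.1 hσ
    rw [contMDiffOn_univ]
    exact contMDiff_hom_of_apply _ fun X hX ↦ isSmoothSection_inducedConnection hδ hγ hγδ hσ' hX
  metric σ τ hσ hτ x v := mvfderiv_restrictedMetric hδ hγ hγδ hσ hτ x v
  beta := by
    refine ⟨fun x ↦ LinearEquiv.ofBijective (betaMap hδ hγ x) (betaMap_bijective hδ hγ x),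
      fun σ hσ x v ↦ ?_⟩
    obtain ⟨f, hf, hσf⟩ := exists_eq_smul_eulerField hδ hσ
    have hD := inducedConnection_smul_eulerField hδ hγ hγδ hf hσf x v
    have hι : (pullbackInclusion hδ u x v : PullbackTangent hδ u x) ∈
        (restrictedMetric g γ hδ u x).orthogonal (xiLine hδ u x) :=
      (mem_orthogonal_xiLine hδ hγ).2 (dr_pullbackInclusion hδ u x v)
    have hr : dr (immersion hδ u x) (inducedConnection g γ hδ u σ x v) = 0 := by
      have key (a b : ℝ) : dr (immersion hδ u x)
          (a • pullbackInclusion hδ u x v + b • eulerField (immersion hδ u x)) = 0 := by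
        rw [map_add, map_smul, map_smul, dr_pullbackInclusion, dr_eulerField, smul_zero, smul_zero,
          add_zero]
      exact (congrArg (dr (immersion hδ u x)) hD).trans (key _ _)
    refine ⟨(mem_orthogonal_xiLine hδ hγ).2 hr, ?_⟩
    rw [LinearEquiv.ofBijective_apply, betaMap_apply hδ hγ x v (f x) _ (hσf x) hι,
      ← Submodule.Quotient.mk_smul, Submodule.Quotient.eq]
    refine (mem_xiLine hδ u).2 ⟨-(f x * mvfderiv (𝓡 n) u x v + mvfderiv (𝓡 n) f x v), ?_⟩
    have key (w : TangentSpace (ambientModel n) (immersion hδ u x))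
        (hw : w = f x • pullbackInclusion hδ u x v
        + (f x * mvfderiv (𝓡 n) u x v + mvfderiv (𝓡 n) f x v) • eulerField (immersion hδ u x)) :
        -(f x * mvfderiv (𝓡 n) u x v + mvfderiv (𝓡 n) f x v) • eulerField (immersion hδ u x) =
          f x • pullbackInclusion hδ u x v - w := by
      rw [hw]
      module
    exact key _ hD

theorem inducesConformalClass_inducedConnection (hγ : IsAdmissible g γ)
    (hγδ : IsNonsingularBelow γ δ) :
    InducesConformalClass (𝓡 n) ((ℝ × ℝ) × EuclideanSpace ℝ (Fin n))
      (restrictedMetric g γ hδ u) (xiLine hδ u) (inducedConnection g γ hδ u) g := by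
  intro σ hσ hσ0
  obtain ⟨f, hf, hσf⟩ := exists_eq_smul_eulerField hδ hσ
  have hf0 (x : M) : f x ≠ 0 := fun h ↦ hσ0 x <| (hσf x).trans <| by
    rw [h]
    exact zero_smul ℝ (eulerField (immersion hδ u x))
  -- The induced metric is `f² e^{2u} g`. As `Real.log (f x)` is the logarithm of `|f x|`, this
  -- exponent also serves where `f` is negative.
  refine ⟨fun x ↦ u x + Real.log (f x), u.contMDiff.add fun x ↦
    (Real.contDiffAt_log.2 (hf0 x)).contMDiffAt.comp x (hf x), fun x v w ↦ ?_⟩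
  have hD (v) := inducedConnection_smul_eulerField hδ hγ hγδ hf hσf x v
  have key (v' w' : TangentSpace (ambientModel n) (immersion hδ u x))
      (hv : v' = f x • pullbackInclusion hδ u x v
        + (f x * mvfderiv (𝓡 n) u x v + mvfderiv (𝓡 n) f x v) • eulerField (immersion hδ u x))
      (hw : w' = f x • pullbackInclusion hδ u x w
        + (f x * mvfderiv (𝓡 n) u x w + mvfderiv (𝓡 n) f x w) • eulerField (immersion hδ u x)) :
      restrictedMetric g γ hδ u x v' w' =
        Real.exp (2 * (u x + Real.log (f x))) * g.inner x v w := by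
    rw [restrictedMetric_apply hδ hγ, hv, hw]
    simp only [map_add, map_smul, dr_pullbackInclusion, dr_eulerField,
      pullbackProj_pullbackInclusion, pullbackProj_eulerField, smul_zero, add_zero, zero_mul,
      mul_zero, zero_add, smul_apply, smul_eq_mul]
    rw [tCoord_immersion, mul_comm 2, Real.exp_mul, Real.exp_add, Real.exp_log_eq_abs (hf0 x)]
    norm_num
    rw [mul_pow, sq_abs]
    ring
  exact key _ _ (hD v) (hD w)

theorem isStandardTractorBundle_pullback (hγ : IsAdmissible g γ) (hγδ : IsNonsingularBelow γ δ) :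
    IsStandardTractorBundle (𝓡 n) ((ℝ × ℝ) × EuclideanSpace ℝ (Fin n)) g
      (restrictedMetric g γ hδ u) (xiLine hδ u) (xiPos hδ u) (inducedConnection g γ hδ u) where
  bundle := isConformalTractorBundle_pullback hδ hγ hγδ
  connection := isTractorConnection_inducedConnection hδ hγ hγδ
  conformal := inducesConformalClass_inducedConnection hδ hγ hγδ

end TractorBundle

/-! ### The normalization conditions and the Ricci tensor -/

section Normality

variable {n : ℕ} {M : Type*} [TopologicalSpace M] [ChartedSpace (EuclideanSpace ℝ (Fin n)) M]
  [IsManifold (𝓡 n) ∞ M] [T2Space M] {δ : ℝ} (hδ : 0 < δ) {u : C^∞⟮𝓡 n, M; 𝓘(ℝ, ℝ), ℝ⟯}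
  {g : Metric n M} {γ : ℝ → Π x : M, TangentSpace (𝓡 n) x →L[ℝ] TangentSpace (𝓡 n) x}
  {X Y Z : Π x : M, TangentSpace (𝓡 n) x} {σ : Π x : M, PullbackTangent hδ u x}
  (hγ : IsAdmissible g γ) (hγδ : IsNonsingularBelow γ δ)

include hγ hγδ in
-- Sections of `L` are multiples of `T`, which the curvature annihilates; so the condition `R(X,Y)L
-- ⊆ L` holds automatically.
theorem curvature_sectionOf_xiLine (hX : IsSmoothField (𝓡 n) X) (hY : IsSmoothField (𝓡 n) Y)
    (hσ : IsSectionOf (𝓡 n) ((ℝ × ℝ) × EuclideanSpace ℝ (Fin n)) (xiLine hδ u) σ) (x : M) :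
    curvature (𝓡 n) (inducedConnection g γ hδ u) X Y σ x = 0 := by
  obtain ⟨f, -, hσf⟩ := exists_eq_smul_eulerField hδ hσ
  refine (curvature_inducedConnection hδ hγ hγδ hX hY hσ.1 x).trans ?_
  refine (congrArg (ambientCurvature hγ hγδ (immersion hδ u x) _ _) (hσf x)).trans ?_
  rw [map_smul, ambientCurvature_eulerField_right, smul_zero]
  rfl

theorem curvature_inducedConnection_smul_eulerField {f : M → ℝ}
    (hf : ContMDiff (𝓡 n) 𝓘(ℝ, ℝ) ∞ f)
    (hσ : IsSmoothSection (𝓡 n) ((ℝ × ℝ) × EuclideanSpace ℝ (Fin n)) σ)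
    (hσf : ∀ x, σ x = f x • eulerField (immersion hδ u x)) (hX : IsSmoothField (𝓡 n) X)
    (hY : IsSmoothField (𝓡 n) Y) (hZ : IsSmoothField (𝓡 n) Z) (x : M) :
    curvature (𝓡 n) (inducedConnection g γ hδ u) X Y
        (fun y ↦ inducedConnection g γ hδ u σ y (Z y)) x =
      f x • ambientCurvature hγ hγδ (immersion hδ u x) (pullbackInclusion hδ u x (X x))
        (pullbackInclusion hδ u x (Y x)) (pullbackInclusion hδ u x (Z x)) := by
  refine (curvature_inducedConnection hδ hγ hγδ hX hY
    (isSmoothSection_inducedConnection hδ hγ hγδ hσ hZ) x).trans ?_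
  refine (congrArg (ambientCurvature hγ hγδ (immersion hδ u x) _ _)
    (inducedConnection_smul_eulerField hδ hγ hγδ hf hσf x (Z x))).trans ?_
  exact ambientCurvature_smul_add_smul_eulerField hγ hγδ _ _ _ _ _

/-- The endomorphism of `TM` corresponding to the curvature of the induced connection. -/
def weylCurvature (x : M) : TangentSpace (𝓡 n) x →ₗ[ℝ] TangentSpace (𝓡 n) x →ₗ[ℝ]
    TangentSpace (𝓡 n) x →ₗ[ℝ] TangentSpace (𝓡 n) x :=
  tangentialCurvature hγ hγδ (immersion hδ u x)

theorem weylCurvature_apply (x : M) (v w z : TangentSpace (𝓡 n) x) :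
    weylCurvature hδ hγ hγδ (u := u) x v w z = pullbackProj hδ u x
      (ambientCurvature hγ hγδ (immersion hδ u x) (pullbackInclusion hδ u x v)
        (pullbackInclusion hδ u x w) (pullbackInclusion hδ u x z)) := rfl

/-- The `TM`-component of the curvature represents the action of the curvature on `L^⊥ / L`. -/
theorem curvature_sub_mem_xiLine_iff {f : M → ℝ} (hf : ContMDiff (𝓡 n) 𝓘(ℝ, ℝ) ∞ f)
    (hσ : IsSmoothSection (𝓡 n) ((ℝ × ℝ) × EuclideanSpace ℝ (Fin n)) σ)
    (hσf : ∀ x, σ x = f x • eulerField (immersion hδ u x)) (hX : IsSmoothField (𝓡 n) X)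
    (hY : IsSmoothField (𝓡 n) Y) (hZ : IsSmoothField (𝓡 n) Z) (x : M)
    (w : TangentSpace (𝓡 n) x) :
    curvature (𝓡 n) (inducedConnection g γ hδ u) X Y
        (fun y ↦ inducedConnection g γ hδ u σ y (Z y)) x
        - inducedConnection g γ hδ u σ x w ∈ xiLine hδ u x ↔
      f x • weylCurvature hδ hγ hγδ (u := u) x (X x) (Y x) (Z x) = f x • w := by
  have ht := (tCoord_pos (immersion hδ u x)).ne'
  have hC := curvature_inducedConnection_smul_eulerField hδ hγ hγδ hf hσ hσf hX hY hZ x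
  have hD := inducedConnection_smul_eulerField hδ hγ hγδ hf hσf x w
  rw [weylCurvature_apply]
  have hr := dr_ambientCurvature hγ hγδ (rCoord_immersion hδ u x)
    (pullbackInclusion hδ u x (X x)) (pullbackInclusion hδ u x (Y x))
    (pullbackInclusion hδ u x (Z x))
  generalize ambientCurvature hγ hγδ (immersion hδ u x) (pullbackInclusion hδ u x (X x))
    (pullbackInclusion hδ u x (Y x)) (pullbackInclusion hδ u x (Z x)) = R at hC hr ⊢
  have key (C D : TangentSpace (ambientModel n) (immersion hδ u x)) (hC : C = f x • R)
      (b : ℝ) (hD : D = f x • pullbackInclusion hδ u x w + b • eulerField (immersion hδ u x)) :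
      (∃ c : ℝ, c • eulerField (immersion hδ u x) = C - D) ↔
        f x • pullbackProj hδ u x R = f x • w := by
    rw [hC, hD]
    constructor
    · rintro ⟨c, hc⟩
      have h := congrArg (pullbackProj hδ u x) hc
      simp only [map_sub, map_add, map_smul, pullbackProj_eulerField, smul_zero, add_zero,
        pullbackProj_pullbackInclusion] at h
      exact sub_eq_zero.1 h.symm
    · intro h
      -- The coefficient is found by comparing `∂_t`-components; the `∂_r`-components agree because
      -- `dr R = 0`.
      refine ⟨f x * dt _ R / tCoord (immersion hδ u x) - b, pullbackVector_ext hδ u ?_ ?_ ?_⟩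
      · simp only [map_sub, map_add, map_smul, dt_eulerField, dt_pullbackInclusion, smul_eq_mul,
          mul_zero, zero_add]
        rw [sub_mul, div_mul_cancel₀ _ ht]
      · simp only [map_sub, map_add, map_smul, dr_eulerField, dr_pullbackInclusion, smul_eq_mul,
          mul_zero, add_zero, hr, sub_zero]
      · simp only [map_sub, map_add, map_smul, pullbackProj_eulerField, smul_zero, add_zero,
          pullbackProj_pullbackInclusion, h, sub_self]
  exact (mem_xiLine hδ u).trans (key _ _ hC _ hD)

/-- Testing with `σ = ξ^u` forces any admissible `W` to be the `TM`-component of the ambient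
curvature, so the existential quantifier in the definition disappears. The other conditions are
already established, and only the trace remains. -/
theorem isNormalTractorBundle_iff_trace :
    IsNormalTractorBundle (𝓡 n) ((ℝ × ℝ) × EuclideanSpace ℝ (Fin n)) g
        (restrictedMetric g γ hδ u) (xiLine hδ u) (xiPos hδ u) (inducedConnection g γ hδ u) ↔
      ∀ (x : M) (v w : TangentSpace (𝓡 n) x), LinearMap.trace ℝ (TangentSpace (𝓡 n) x)
        (((weylCurvature hδ hγ hγδ (u := u) x).flip v).flip w) = 0 := by
  constructor
  · rintro ⟨-, -, W, hW, htr⟩ x v w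
    have h : W x = weylCurvature hδ hγ hγδ (u := u) x := by
      ext v w z : 3
      obtain ⟨X, hX, rfl⟩ := exists_contMDiff_field x v
      obtain ⟨Y, hY, rfl⟩ := exists_contMDiff_field x w
      obtain ⟨Z, hZ, rfl⟩ := exists_contMDiff_field x z
      have hξ := isSmoothSection_comp_immersion hδ (u := u) isSmoothField_eulerField
      have h := hW X Y Z hX hY hZ (xi hδ u) ⟨hξ, fun x ↦ Submodule.mem_span_singleton_self _⟩ x
      have h' := (curvature_sub_mem_xiLine_iff hδ hγ hγδ (f := fun _ ↦ 1) contMDiff_const hξ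
        (fun x ↦ (one_smul ℝ (eulerField (immersion hδ u x))).symm) hX hY hZ x _).1 h
      rw [one_smul, one_smul] at h'
      exact h'.symm
    rw [← h]
    exact htr x v w
  · intro h
    refine ⟨isStandardTractorBundle_pullback hδ hγ hγδ, fun X Y hX hY σ hσ x ↦ ?_,
      weylCurvature hδ hγ hγδ, fun X Y Z hX hY hZ σ hσ x ↦ ?_, h⟩
    · rw [curvature_sectionOf_xiLine hδ hγ hγδ hX hY hσ]
      exact Submodule.zero_mem _
    · obtain ⟨f, hf, hσf⟩ := exists_eq_smul_eulerField hδ hσ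
      exact (curvature_sub_mem_xiLine_iff hδ hγ hγδ hf hσ.1 hσf hX hY hZ x _).2 rfl

/-- The flow line through `(e^{u(x)}, 0, x)` is the whole ray over `x`, and the point with
coordinate `t` is reached at time `log t - u(x)`. -/
theorem exists_eulerFlow_immersion (u : C^∞⟮𝓡 n, M; 𝓘(ℝ, ℝ), ℝ⟯) {p : Ambient δ M}
    (hp : rCoord p = 0) : ∃ (x : M) (τ : ℝ), p = eulerFlow (immersion hδ u x) τ := by
  refine ⟨p.2, Real.log (tCoord p) - u p.2, Prod.ext (Subtype.ext (Prod.ext ?_ hp)) rfl⟩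
  change tCoord p = Real.exp (Real.log (tCoord p) - u p.2) * Real.exp (u p.2)
  rw [← Real.exp_add, sub_add_cancel, Real.exp_log (tCoord_pos p)]

/-- On the image of `Ψ^u` both conditions concern the same trace; flow invariance of the
`TM`-component carries the vanishing to the rest of `{r = 0}`. -/
theorem trace_weylCurvature_iff :
    (∀ (x : M) (v w : TangentSpace (𝓡 n) x), LinearMap.trace ℝ (TangentSpace (𝓡 n) x)
        (((weylCurvature hδ hγ hγδ (u := u) x).flip v).flip w) = 0) ↔
      ∀ X Y : Π x : M, TangentSpace (𝓡 n) x, IsSmoothField (𝓡 n) X → IsSmoothField (𝓡 n) Y →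
        ∀ p : Ambient δ M, rCoord p = 0 →
          ricci (ambientModel n) (ambientConnection g γ δ) (lift X) (lift Y) p = 0 := by
  constructor
  · intro h X Y hX hY p hp
    rw [ricci_lift hγ hγδ hX hY hp]
    obtain ⟨x, τ, rfl⟩ := exists_eulerFlow_immersion hδ u hp
    rw [tangentialCurvature_eulerFlow]
    exact h x (X x) (Y x)
  · intro h x v w
    obtain ⟨X, hX, rfl⟩ := exists_contMDiff_field x v
    obtain ⟨Y, hY, rfl⟩ := exists_contMDiff_field x w
    have := h X Y hX hY (immersion hδ u x) (rCoord_immersion hδ u x)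
    rw [ricci_lift hγ hγδ hX hY (rCoord_immersion hδ u x)] at this
    exact this

end Normality

end ExtrinsicTractor

end

theorem theorem1501202439578 {n : ℕ} (hn : 2 ≤ n) {M : Type*} [TopologicalSpace M] [T2Space M]
    [SigmaCompactSpace M] [ChartedSpace (EuclideanSpace ℝ (Fin n)) M] [IsManifold (𝓡 n) ∞ M]
    (g : ExtrinsicTractor.Metric n M)
    (γ : ℝ → Π x : M, TangentSpace (𝓡 n) x →L[ℝ] TangentSpace (𝓡 n) x)
    (hγ : ExtrinsicTractor.IsAdmissible g γ)
    (δ : ℝ) (hδ : 0 < δ) (hγδ : ExtrinsicTractor.IsNonsingularBelow γ δ)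
    (u : C^∞⟮𝓡 n, M; 𝓘(ℝ, ℝ), ℝ⟯) :
    ExtrinsicTractor.IsStandardTractorBundle (𝓡 n) ((ℝ × ℝ) × EuclideanSpace ℝ (Fin n)) g
        (ExtrinsicTractor.restrictedMetric g γ hδ u) (ExtrinsicTractor.xiLine hδ u)
        (ExtrinsicTractor.xiPos hδ u) (ExtrinsicTractor.inducedConnection g γ hδ u) ∧
    (ExtrinsicTractor.IsNormalTractorBundle (𝓡 n) ((ℝ × ℝ) × EuclideanSpace ℝ (Fin n)) g
        (ExtrinsicTractor.restrictedMetric g γ hδ u) (ExtrinsicTractor.xiLine hδ u)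
        (ExtrinsicTractor.xiPos hδ u) (ExtrinsicTractor.inducedConnection g γ hδ u) ↔
      ∀ X Y : Π x : M, TangentSpace (𝓡 n) x,
        ExtrinsicTractor.IsSmoothField (𝓡 n) X → ExtrinsicTractor.IsSmoothField (𝓡 n) Y →
        ∀ p : ExtrinsicTractor.Ambient δ M, ExtrinsicTractor.rCoord p = 0 →
          ExtrinsicTractor.ricci (ExtrinsicTractor.ambientModel n)
            (ExtrinsicTractor.ambientConnection g γ δ)
            (ExtrinsicTractor.lift X) (ExtrinsicTractor.lift Y) p = 0) :=
  ⟨ExtrinsicTractor.isStandardTractorBundle_pullback hδ hγ hγδ,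
    (ExtrinsicTractor.isNormalTractorBundle_iff_trace hδ hγ hγδ).trans
      (ExtrinsicTractor.trace_weylCurvature_iff hδ hγ hγδ)⟩
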